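/- Conventions. Vector spaces are over $\mathbb{R}$, $S^1=\mathbb{R}/\mathbb{Z}$, and gradings are homological. A mixed complex $(C_*,b,B)$ is a $\mathbb{Z}$-graded vector space with linear maps $b:C_*\to C_{*-1}$, $B:C_*\to C_{*+1}$ such that $b^2=0$, $B^2=0$, $bB+Bb=0$. An $\infty$-morphism $f:(C,b,B)\to(C'',b'',B'')$ is a sequence of linear maps $f_i:C_*\to C''_{*+2i}$ ($i\ge 0$) with $b''f_0=f_0b$ and $B''f_{i-1}+b''f_i=f_{i-1}B+f_ib$ for $i\ge1$; it is an $\infty$-quasi-isomorphism if $f_0:(C,b)\to(C'',b'')$ induces an isomorphism on homology. Two $\infty$-morphisms $f,g$ are $\infty$-homotopic if there are linear maps $h_i:C_*\to C''_{*+2i+1}$ ($i\ge 0$) with $f_0-g_0=b''h_0+h_0b$ and $f_i-g_i=b''h_i+h_ib+B''h_{i-1}+h_{i-1}B$ for $i\ge1$. Let $\Delta^k=\{(t_1,\dots,t_k)\in\mathbb{R}^k\mid 0\le t_1\le\dots\le t_k\le 1\}$, with the maps $\delta_i:\Delta^{k-1}\to\Delta^k$ ($0\le i\le k$), $\delta_0(t)=(0,t_1,\dots,t_{k-1})$,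 $\delta_i(t)=(t_1,\dots,t_i,t_i,\dots,t_{k-1})$ for $1\le i\le k-1$, $\delta_k(t)=(t_1,\dots,t_{k-1},1)$, and $\sigma_i:\Delta^{k+1}\to\Delta^k$ ($0\le i\le k$) omitting $t_{i+1}$. Let $S_*(Y)$ be the real singular chains of a space $Y$ (zero in negative degrees), with boundary $\partial\sigma=\sum_i(-1)^i\sigma\circ\delta_i$, let $\times$ be the simplicial cross product given by the standard (shuffle) decomposition of $\Delta^p\times\Delta^q$ into $(p+q)$-simplices, and let $\varepsilon:S_0(Y)\to\mathbb{R}$ be the augmentation. For a topological $S^1$-space $Y$ with action $F^Y:S^1\times Y\to Y$ put $J(a)=F^Y_*([S^1]\times a)$, where $[S^1]\in S_1(S^1)$ is the projection $\Delta^1=[0,1]\to S^1$. Let $X$ be a topological $S^1$-space. Let $S^1$ act on $X\times\Delta^k$ through $X$, let $\delta_i,\sigma_i$ act on the spaces $X\times\Delta^k$ through $\Delta^k$, and let $\tau_k(x,t_1,\dots,t_k)=(F^X([t_1],x),t_2-t_1,\dots,t_k-t_1,1-t_1)$ ($\tau_0=\mathrm{id}$). On $S^{X\Delta}_n=\prod_{k\ge0}S_{n+k}(X\times\Delta^k)$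 ($n\in\mathbb{Z}$) put $b=\partial+\delta$ with $\delta(c)=(-1)^{p+k-1}\sum_{i=0}^k(-1)^i\delta_i(c)$ for $c\in S_p(X\times\Delta^{k-1})$, put $B=Ns(1-\lambda)$ with $\lambda=(-1)^k\tau_k$ and $N=1+\lambda+\dots+\lambda^k$ on the $k$-th factor and $s(c)=(-1)^{n-1}(\sigma_k\tau_{k+1}(c_{k+1}))_{k\ge0}$ for $c\in S^{X\Delta}_n$, and let $J$ act componentwise. Let $S^{X\Delta,\mathrm{nm}}_n\subset S^{X\Delta}_n$ consist of the $(c_k)_k$ with $\sigma_i(c_k)=0$ for all $0\le i\le k-1$. Proposition. $(S_*(X),\partial,J)$ and $(S^{X\Delta,\mathrm{nm}}_*,b,B)$ are mixed complexes, and the following hold. (i) Let $\xi=\{\xi^n\}_{n\ge0}$ be a sequence of elements $\xi^n=(\xi^n_k)_{k\ge0}\in S^{S^1\Delta,\mathrm{nm}}_{2n}$, for $S^1$ acting on itself by rotation, such that $\varepsilon(\xi^0_0)=1$, $b(\xi^0)=0$ and $b(\xi^n)=(J-B)(\xi^{n-1})$ for $n\ge1$. Let $f^\xi_n(a)=\big((F_k)_*(a\times\xi^n_k)\big)_{k\ge0}$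 for $a\in S_*(X)$, where $F_k:X\times S^1\times\Delta^k\to X\times\Delta^k$, $F_k(x,z,t)=(F^X(z,x),t)$. Then the maps $f^\xi_n$ take values in $S^{X\Delta,\mathrm{nm}}_{*+2n}$, and $f^\xi=\{f^\xi_n\}_{n\ge0}$ is an $\infty$-quasi-isomorphism from $(S_*(X),\partial,J)$ to $(S^{X\Delta,\mathrm{nm}}_*,b,B)$. (ii) For two sequences $\xi,\xi'$ as in (i), $f^\xi$ and $f^{\xi'}$ are $\infty$-homotopic. -/

import Mathlib

noncomputable section

namespace CocyclicChains

/-! ### Mixed chain complexes, infinity-morphisms and infinity-homotopies -/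

/-- A graded real vector space `(C_n)_{n ∈ ℤ}` (homological grading), given as a family of
subspaces of a vector space `V`, with two operators `b` and `B`. The laws of a mixed complex are
`MixedData.IsMixedComplex`. -/
structure MixedData (V : Type*) [AddCommGroup V] [Module ℝ V] where
  /-- The homogeneous component of degree `n`. -/
  piece : ℤ → Submodule ℝ V
  /-- The differential. -/
  b : V →ₗ[ℝ] V
  /-- The operator of degree `1`. -/
  B : V →ₗ[ℝ] V

namespace MixedData

variable {V W : Type*} [AddCommGroup V] [Module ℝ V] [AddCommGroup W] [Module ℝ W]

/-- `(C_*, b, B)` is a mixed chain complex: `b : C_n → C_{n-1}`, `B : C_n → C_{n+1}`,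
`b² = 0`, `B² = 0`, `bB + Bb = 0`. -/
structure IsMixedComplex (C : MixedData V) : Prop where
  b_mem : ∀ n : ℤ, ∀ x ∈ C.piece n, C.b x ∈ C.piece (n - 1)
  B_mem : ∀ n : ℤ, ∀ x ∈ C.piece n, C.B x ∈ C.piece (n + 1)
  b_b : ∀ n : ℤ, ∀ x ∈ C.piece n, C.b (C.b x) = 0
  B_B : ∀ n : ℤ, ∀ x ∈ C.piece n, C.B (C.B x) = 0
  b_B : ∀ n : ℤ, ∀ x ∈ C.piece n, C.b (C.B x) + C.B (C.b x) = 0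

/-- The cycles of degree `n` with respect to `b`. -/
def cycles (C : MixedData V) (n : ℤ) : Submodule ℝ V := C.piece n ⊓ LinearMap.ker C.b

/-- The boundaries of degree `n` with respect to `b`. -/
def boundaries (C : MixedData V) (n : ℤ) : Submodule ℝ V := (C.piece (n + 1)).map C.b

/-- The homology `H_n(C, b)`. -/
abbrev Homology (C : MixedData V) (n : ℤ) : Type _ :=
  ↥(C.cycles n) ⧸ (C.boundaries n).comap (C.cycles n).subtype

/-- `g : (C_*, b) → (D_*, b)` is a chain map of degree `0`. -/
structure IsChainMap (C : MixedData V) (D : MixedData W) (g : V →ₗ[ℝ] W) : Prop where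
  mem : ∀ n : ℤ, ∀ x ∈ C.piece n, g x ∈ D.piece n
  comm : ∀ n : ℤ, ∀ x ∈ C.piece n, D.b (g x) = g (C.b x)

lemma IsChainMap.cycles_mem {C : MixedData V} {D : MixedData W} {g : V →ₗ[ℝ] W}
    (hg : IsChainMap C D g) (n : ℤ) : ∀ x ∈ C.cycles n, g x ∈ D.cycles n := by
  rintro x ⟨hx, hbx⟩
  refine ⟨hg.mem n x hx, ?_⟩
  have hbx' : C.b x = 0 := hbx
  change D.b (g x) = 0
  rw [hg.comm n x hx, hbx', map_zero]

/-- The map induced on homology by a chain map. -/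
def homologyMap {C : MixedData V} {D : MixedData W} {g : V →ₗ[ℝ] W}
    (hg : IsChainMap C D g) (n : ℤ) : C.Homology n →ₗ[ℝ] D.Homology n :=
  Submodule.mapQ _ _ (g.restrict (hg.cycles_mem n)) <| by
    rintro ⟨x, hx⟩ ⟨y, hy, hyx⟩
    exact ⟨g y, hg.mem _ y hy, by rw [hg.comm _ y hy, hyx]; rfl⟩

/-- A chain map inducing isomorphisms on homology in every degree. -/
def IsQuasiIso (C : MixedData V) (D : MixedData W) (g : V →ₗ[ℝ] W) : Prop :=
  ∃ hg : IsChainMap C D g, ∀ n : ℤ, Function.Bijective (homologyMap hg n)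

/-- `{f_i : C_* → D_{*+2i}}` is an infinity-morphism. -/
structure IsInftyMorphism (C : MixedData V) (D : MixedData W) (f : ℕ → V →ₗ[ℝ] W) : Prop where
  mem : ∀ (i : ℕ) (n : ℤ), ∀ x ∈ C.piece n, f i x ∈ D.piece (n + 2 * i)
  zero : ∀ n : ℤ, ∀ x ∈ C.piece n, D.b (f 0 x) = f 0 (C.b x)
  succ : ∀ (i : ℕ) (n : ℤ), ∀ x ∈ C.piece n,
    D.B (f i x) + D.b (f (i + 1) x) = f i (C.B x) + f (i + 1) (C.b x)

/-- An infinity-morphism whose `0`-th term is a quasi-isomorphism. -/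
def IsInftyQuasiIso (C : MixedData V) (D : MixedData W) (f : ℕ → V →ₗ[ℝ] W) : Prop :=
  IsInftyMorphism C D f ∧ IsQuasiIso C D (f 0)

/-- `{h_i : C_* → D_{*+2i+1}}` is an infinity-homotopy between `f` and `g`. -/
structure IsInftyHomotopy (C : MixedData V) (D : MixedData W) (f g h : ℕ → V →ₗ[ℝ] W) :
    Prop where
  mem : ∀ (i : ℕ) (n : ℤ), ∀ x ∈ C.piece n, h i x ∈ D.piece (n + 2 * i + 1)
  zero : ∀ n : ℤ, ∀ x ∈ C.piece n, f 0 x - g 0 x = D.b (h 0 x) + h 0 (C.b x)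
  succ : ∀ (i : ℕ) (n : ℤ), ∀ x ∈ C.piece n,
    f (i + 1) x - g (i + 1) x =
      D.b (h (i + 1) x) + h (i + 1) (C.b x) + D.B (h i x) + h i (C.B x)

/-- `f` and `g` are infinity-homotopic. -/
def InftyHomotopic (C : MixedData V) (D : MixedData W) (f g : ℕ → V →ₗ[ℝ] W) : Prop :=
  ∃ h : ℕ → V →ₗ[ℝ] W, IsInftyHomotopy C D f g h

end MixedData

/-! ### The standard simplices and their cocyclic structure -/

/-- `Δ^k = {(t_1, …, t_k) ∈ ℝ^k | 0 ≤ t_1 ≤ … ≤ t_k ≤ 1}`; `t_j` is `t ⟨j - 1, _⟩`. -/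
abbrev Simplex (k : ℕ) : Type :=
  {t : Fin k → ℝ // Monotone t ∧ ∀ i, t i ∈ Set.Icc (0 : ℝ) 1}

/-- The coordinate `t_j` of a point of `Δ^k`, where `t_0 = 0` and `t_j = 1` for `j > k`. -/
def coord {k : ℕ} (t : Simplex k) (j : ℕ) : ℝ :=
  if j = 0 then 0 else if h : j - 1 < k then t.1 ⟨j - 1, h⟩ else 1

lemma continuous_coord {k : ℕ} (j : ℕ) : Continuous fun t : Simplex k => coord t j := by
  unfold coord
  split_ifs
  · exact continuous_const
  · exact (continuous_apply _).comp continuous_subtype_val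
  · exact continuous_const

lemma coord_mem {k : ℕ} (t : Simplex k) (j : ℕ) : coord t j ∈ Set.Icc (0 : ℝ) 1 := by
  unfold coord
  split_ifs
  · simp
  · exact t.2.2 _
  · simp

lemma coord_mono {k : ℕ} (t : Simplex k) : Monotone (coord t) := by
  intro i j hij
  by_cases hi : i = 0
  · have h0 : coord t i = 0 := by simp [coord, hi]
    rw [h0]
    exact (coord_mem t j).1
  by_cases hj : j - 1 < k
  · have hi' : i - 1 < k := by omega
    have hj0 : j ≠ 0 := by omega
    simp only [coord, hi, hj0, hj, hi', dif_pos, if_false]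
    exact t.2.1 (by simp only [Fin.mk_le_mk]; omega)
  · have hj0 : j ≠ 0 := by omega
    have h1 : coord t j = 1 := by simp [coord, hj0, hj]
    rw [h1]
    exact (coord_mem t i).2

/-- The coface `δ_i : Δ^k → Δ^{k+1}`: `δ_0 t = (0, t_1, …, t_k)`,
`δ_i t = (t_1, …, t_i, t_i, …, t_k)` for `1 ≤ i ≤ k`, `δ_{k+1} t = (t_1, …, t_k, 1)`. -/
def coface {k : ℕ} (i : Fin (k + 2)) : C(Simplex k, Simplex (k + 1)) where
  toFun t := ⟨fun j => coord t (if (j : ℕ) + 1 ≤ i then j + 1 else j),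
    fun a b hab => coord_mono t (by
      have hab' : (a : ℕ) ≤ b := hab
      split_ifs <;> omega),
    fun j => coord_mem t _⟩
  continuous_toFun := Continuous.subtype_mk (continuous_pi fun j => continuous_coord _) _

/-- Precomposing the coordinates with an order embedding `Fin k ↪o Fin m` is a map
`Δ^m → Δ^k`. -/
def restrictCoords {k m : ℕ} (e : Fin k ↪o Fin m) : C(Simplex m, Simplex k) where
  toFun t := ⟨fun j => t.1 (e j), fun _ _ hab => t.2.1 (e.monotone hab), fun j => t.2.2 _⟩
  continuous_toFun := by
    refine Continuous.subtype_mk (continuous_pi fun j => ?_) _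
    exact (continuous_apply (e j)).comp continuous_subtype_val

/-- The codegeneracy `σ_i : Δ^{k+1} → Δ^k` forgetting the coordinate `t_{i+1}`. -/
def codegen {k : ℕ} (i : Fin (k + 1)) : C(Simplex (k + 1), Simplex k) :=
  restrictCoords (Fin.succAboveOrderEmb i)

/-- The cyclic map `τ_k (t_1, …, t_k) = (t_2 - t_1, …, t_k - t_1, 1 - t_1)` of `Δ^k`. -/
def cyc (k : ℕ) : C(Simplex k, Simplex k) where
  toFun t := ⟨fun j => coord t (j + 2) - coord t 1,
    fun a b hab => sub_le_sub_right (coord_mono t (by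
      have hab' : (a : ℕ) ≤ b := hab
      omega)) _,
    fun j => ⟨sub_nonneg.2 (coord_mono t (by omega)), by
      have h1 := (coord_mem t (j + 2)).2
      have h2 := (coord_mem t 1).1
      linarith⟩⟩
  continuous_toFun := Continuous.subtype_mk
    (continuous_pi fun j => (continuous_coord _).sub (continuous_coord _)) _

/-! ### Singular chains and the simplicial cross product -/

/-- Singular simplices of all dimensions of a topological space. -/
abbrev SingularSimplex (X : Type*) [TopologicalSpace X] : Type _ :=
  Σ p : ℕ, C(Simplex p, X)

/-- `S_*(X)`: real singular chains (the direct sum over all dimensions). -/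
abbrev Chain (X : Type*) [TopologicalSpace X] : Type _ := SingularSimplex X →₀ ℝ

section Chains

variable {X Y : Type*} [TopologicalSpace X] [TopologicalSpace Y]

/-- `S_n(X) ⊆ S_*(X)`, which is `0` for `n < 0`. -/
def chainPiece (X : Type*) [TopologicalSpace X] (n : ℤ) : Submodule ℝ (Chain X) :=
  Finsupp.supported ℝ ℝ {s | (s.1 : ℤ) = n}

/-- The map on chains induced by a continuous map. -/
def push (g : C(X, Y)) : Chain X →ₗ[ℝ] Chain Y :=
  Finsupp.lmapDomain ℝ ℝ fun s => ⟨s.1, g.comp s.2⟩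

/-- The boundary `∑ i, (-1)^i σ ∘ δ_i` of a singular simplex `σ`. -/
def simplexBoundary : SingularSimplex X → Chain X
  | ⟨0, _⟩ => 0
  | ⟨p + 1, σ⟩ => ∑ i : Fin (p + 2), Finsupp.single ⟨p, σ.comp (coface i)⟩ ((-1) ^ (i : ℕ))

/-- The singular boundary operator. -/
def boundary (X : Type*) [TopologicalSpace X] : Chain X →ₗ[ℝ] Chain X :=
  Finsupp.linearCombination ℝ simplexBoundary

/-- The augmentation `ε : S_0(X) → ℝ` (extended by zero to positive dimensions). -/
def augmentation (X : Type*) [TopologicalSpace X] : Chain X →ₗ[ℝ] ℝ :=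
  Finsupp.linearCombination ℝ fun s => if s.1 = 0 then 1 else 0

/-- The operator `c ↦ (-1)^p c` on chains of dimension `p`. -/
def parity (X : Type*) [TopologicalSpace X] : Chain X →ₗ[ℝ] Chain X :=
  Finsupp.linearCombination ℝ fun s => Finsupp.single s ((-1) ^ s.1)

/-- A `(p, q)`-shuffle, recorded by the set of the `p` coordinates among `p + q` which go to the
first factor. -/
abbrev Shuffle (p q : ℕ) : Type := {A : Finset (Fin (p + q)) // A.card = p}

/-- The embedding `Δ^{p+q} → Δ^p × Δ^q` of a shuffle `A`: the coordinates in `A`, in order, are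
the coordinates in `Δ^p`, the others those in `Δ^q`. These are the top-dimensional simplices of
the standard decomposition of `Δ^p × Δ^q`. -/
def shuffleMap {p q : ℕ} (A : Shuffle p q) : C(Simplex (p + q), Simplex p × Simplex q) :=
  (restrictCoords (A.1.orderEmbOfFin A.2)).prodMk
    (restrictCoords (A.1ᶜ.orderEmbOfFin (by rw [Finset.card_compl, A.2]; simp)))

/-- The sign of the shuffle `A`: minus one to the number of pairs `i < j` with `i ∉ A`,
`j ∈ A`. -/
def shuffleSign {p q : ℕ} (A : Shuffle p q) : ℝ :=
  (-1) ^ (Finset.univ.filter fun ij : Fin (p + q) × Fin (p + q) =>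
    ij.1 < ij.2 ∧ ij.1 ∉ A.1 ∧ ij.2 ∈ A.1).card

/-- The simplicial cross product of two singular simplices. -/
def simplexCross (s : SingularSimplex X) (s' : SingularSimplex Y) : Chain (X × Y) :=
  ∑ A : Shuffle s.1 s'.1,
    Finsupp.single ⟨s.1 + s'.1, (s.2.prodMap s'.2).comp (shuffleMap A)⟩ (shuffleSign A)

/-- The simplicial cross product `S_*(X) ⊗ S_*(Y) → S_*(X × Y)`. -/
def cross : Chain X →ₗ[ℝ] Chain Y →ₗ[ℝ] Chain (X × Y) :=
  Finsupp.linearCombination ℝ fun s => Finsupp.linearCombination ℝ fun s' => simplexCross s s'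

/-! ### The circle and the rotation operator -/

/-- The fundamental cycle `[S¹] : Δ^1 = [0, 1] → ℝ / ℤ = S¹`. -/
def fundCycle : Chain UnitAddCircle :=
  Finsupp.single ⟨1, ⟨fun t => ((t.1 0 : ℝ) : UnitAddCircle),
    (AddCircle.continuous_mk' 1).comp ((continuous_apply 0).comp continuous_subtype_val)⟩⟩ 1

/-- The rotation operator `J(a) = F_*([S¹] × a)` of a map `F : S¹ × X → X`. -/
def rotation (F : C(UnitAddCircle × X, X)) : Chain X →ₗ[ℝ] Chain X :=
  push F ∘ₗ cross fundCycle

end Chains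

/-! ### The cocyclic space `X × Δ^k` of a topological `S¹`-space and its mixed complex -/

section Circle

variable (X : Type*) [TopologicalSpace X] [AddAction UnitAddCircle X]
  [ContinuousVAdd UnitAddCircle X]

/-- The action map `F^X : S¹ × X → X`. -/
def action : C(UnitAddCircle × X, X) := ⟨fun z => z.1 +ᵥ z.2, by fun_prop⟩

/-- The action map of `X × Δ^k`, where `S¹` acts trivially on `Δ^k`. -/
def actionProd (k : ℕ) : C(UnitAddCircle × X × Simplex k, X × Simplex k) :=
  ⟨fun z => (z.1 +ᵥ z.2.1, z.2.2), by fun_prop⟩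

/-- The mixed complex `(S_*(X), ∂, J)`. -/
def singularMixed : MixedData (Chain X) where
  piece := chainPiece X
  b := boundary X
  B := rotation (action X)

/-- `τ_k (x, t) = (F^X([t_1], x), τ_k t)` on `X × Δ^k`. It is the identity for `k = 0`, since
then `coord t 1 = 1`. -/
def cycSpace (k : ℕ) : C(X × Simplex k, X × Simplex k) where
  toFun z := (((coord z.2 1 : ℝ) : UnitAddCircle) +ᵥ z.1, cyc k z.2)
  continuous_toFun := by
    have h : Continuous fun z : X × Simplex k => ((coord z.2 1 : ℝ) : UnitAddCircle) :=
      (AddCircle.continuous_mk' 1).comp ((continuous_coord 1).comp continuous_snd)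
    exact (h.vadd continuous_fst).prodMk ((cyc k).continuous.comp continuous_snd)

/-- `δ_i` on chains, `S_*(X × Δ^k) → S_*(X × Δ^{k+1})`. -/
def cofaceChain (X : Type*) [TopologicalSpace X] {k : ℕ} (i : Fin (k + 2)) :
    Chain (X × Simplex k) →ₗ[ℝ] Chain (X × Simplex (k + 1)) :=
  push ((ContinuousMap.id X).prodMap (coface i))

/-- `σ_i` on chains, `S_*(X × Δ^{k+1}) → S_*(X × Δ^k)`. -/
def codegenChain (X : Type*) [TopologicalSpace X] {k : ℕ} (i : Fin (k + 1)) :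
    Chain (X × Simplex (k + 1)) →ₗ[ℝ] Chain (X × Simplex k) :=
  push ((ContinuousMap.id X).prodMap (codegen i))

/-- `τ_k` on chains of `X × Δ^k`. -/
def cycChain (k : ℕ) : Chain (X × Simplex k) →ₗ[ℝ] Chain (X × Simplex k) :=
  push (cycSpace X k)

/-- Sequences `c = (c_k)` of chains `c_k` of `X × Δ^k`. -/
abbrev TotalChain (X : Type*) [TopologicalSpace X] : Type _ := ∀ k : ℕ, Chain (X × Simplex k)

/-- `S^{XΔ}_n = ∏_k S_{n+k}(X × Δ^k)`. -/
def totalPiece (X : Type*) [TopologicalSpace X] (n : ℤ) : Submodule ℝ (TotalChain X) :=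
  Submodule.pi Set.univ fun k => chainPiece (X × Simplex k) (n + k)

/-- The sequences all of whose components are normalized, i.e. killed by all `σ_i`. -/
def normalized (X : Type*) [TopologicalSpace X] : Submodule ℝ (TotalChain X) :=
  ⨅ (k : ℕ) (i : Fin (k + 1)), LinearMap.ker (codegenChain X i ∘ₗ LinearMap.proj (k + 1))

/-- `δ : S_p(X × Δ^k) → S_p(X × Δ^{k+1})`, `c ↦ (-1)^{p + k} ∑ i, (-1)^i δ_i c`. -/
def coboundary (X : Type*) [TopologicalSpace X] (k : ℕ) :
    Chain (X × Simplex k) →ₗ[ℝ] Chain (X × Simplex (k + 1)) :=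
  ((-1 : ℝ) ^ k) • ((∑ i : Fin (k + 2), ((-1 : ℝ) ^ (i : ℕ)) • cofaceChain X i) ∘ₗ
    parity (X × Simplex k))

/-- The components of `b = ∂ + δ`. -/
def totalBComponent (X : Type*) [TopologicalSpace X] :
    ∀ k : ℕ, TotalChain X →ₗ[ℝ] Chain (X × Simplex k)
  | 0 => boundary (X × Simplex 0) ∘ₗ LinearMap.proj 0
  | k + 1 => boundary (X × Simplex (k + 1)) ∘ₗ LinearMap.proj (k + 1) +
      coboundary X k ∘ₗ LinearMap.proj k

/-- The differential `b = ∂ + δ`. -/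
def totalB (X : Type*) [TopologicalSpace X] : TotalChain X →ₗ[ℝ] TotalChain X :=
  LinearMap.pi (totalBComponent X)

/-- `λ = (-1)^k τ_k` on the `k`-th factor. -/
def lam (k : ℕ) : Chain (X × Simplex k) →ₗ[ℝ] Chain (X × Simplex k) :=
  ((-1 : ℝ) ^ k) • cycChain X k

/-- `1 - λ`. -/
def oneSubLam : TotalChain X →ₗ[ℝ] TotalChain X :=
  LinearMap.pi fun k => (LinearMap.id - lam X k) ∘ₗ LinearMap.proj k

/-- `N = 1 + λ + … + λ^k` on the `k`-th factor. -/
def cyclicNorm : TotalChain X →ₗ[ℝ] TotalChain X :=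
  LinearMap.pi fun k => (∑ j ∈ Finset.range (k + 1), lam X k ^ j) ∘ₗ LinearMap.proj k

/-- `s(c) = (-1)^{|c| - 1} (σ_k τ_{k+1} c_{k+1})_k`. If `c_{k+1}` has dimension `p` then
`|c| = p - (k + 1)`, so that the sign is `(-1)^{p + k}`. -/
def extraDegen : TotalChain X →ₗ[ℝ] TotalChain X :=
  LinearMap.pi fun k => ((-1 : ℝ) ^ k) •
    (codegenChain X (Fin.last k) ∘ₗ cycChain X (k + 1) ∘ₗ parity (X × Simplex (k + 1)) ∘ₗ
      LinearMap.proj (k + 1))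

/-- Connes' operator `B = N s (1 - λ)`. -/
def connesB : TotalChain X →ₗ[ℝ] TotalChain X :=
  cyclicNorm X ∘ₗ extraDegen X ∘ₗ oneSubLam X

/-- The rotation operator `J`, componentwise on `∏_k S_*(X × Δ^k)`. -/
def totalJ : TotalChain X →ₗ[ℝ] TotalChain X :=
  LinearMap.pi fun k => rotation (actionProd X k) ∘ₗ LinearMap.proj k

/-- The normalized mixed complex `(S^{XΔ,nm}_*, b, B)`. -/
def cocyclicMixed : MixedData (TotalChain X) where
  piece n := totalPiece X n ⊓ normalized X
  b := totalB X
  B := connesB X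

/-- The sequences `ξ^n ∈ S^{S¹Δ,nm}_{2n}` with `ε(ξ^0_0) = 1`, `b ξ^0 = 0` and
`b ξ^n = (J - B) ξ^{n-1}` for `n ≥ 1`, where `S¹` acts on itself by rotation. -/
structure IsCircleSequence (ξ : ℕ → TotalChain UnitAddCircle) : Prop where
  mem : ∀ n : ℕ, ξ n ∈ (cocyclicMixed UnitAddCircle).piece (2 * n)
  aug : augmentation (UnitAddCircle × Simplex 0) (ξ 0 0) = 1
  zero : totalB UnitAddCircle (ξ 0) = 0
  succ : ∀ n : ℕ, totalB UnitAddCircle (ξ (n + 1)) =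
    totalJ UnitAddCircle (ξ n) - connesB UnitAddCircle (ξ n)

/-- The map `X × S¹ × Δ^k → X × Δ^k`, `(x, z, t) ↦ (F^X(z, x), t)`. -/
def mixMap (k : ℕ) : C(X × UnitAddCircle × Simplex k, X × Simplex k) :=
  ⟨fun w => (w.2.1 +ᵥ w.1, w.2.2), by fun_prop⟩

/-- The maps `f^ξ_n(a) = ((F^{X × Δ^k} ∘ (ν × id))_* (a × ξ^n_k))_k`. -/
def inftyMap (ξ : ℕ → TotalChain UnitAddCircle) (n : ℕ) : Chain X →ₗ[ℝ] TotalChain X :=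
  LinearMap.pi fun k => push (mixMap X k) ∘ₗ (cross (X := X)).flip (ξ n k)

end Circle

end CocyclicChains

end

/-! A chain η of the cocyclic space S¹ × Δ^k, k ≥ 0, acts on chains of X by a ↦ ((F_k)_*(a ×
η_k))_k, the bilinear map `mix`. The differential b obeys a Leibniz rule (`totalB_mix`), B passes to
η up to the sign (-1)^{|a|} (`connesB_mix`), and J on η becomes J on a (`mix_totalJ`). With bξ^n =
(J - B)ξ^{n-1} the Leibniz rule becomes the equation of an ∞-morphism. Likewise, if bη^0 = ξ^0 -
ξ'^0 and bη^n = ξ^n - ξ'^n + (J - B)η^{n-1}, then a ↦ (-1)^{|a|} mix(η^n, a) is an ∞-homotopy. Such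
η^n exist (`exists_homotopy_sequence`): J - B squares to zero and anticommutes with b, so the
right-hand side is a cycle, of degree 2n. It bounds for n = 0 because the augmentations agree, and
for n ≥ 1 because H_{2n}(S¹) = 0.

Homology is concentrated in the column k = 0. For k ≥ 1 the linear contraction of Δ^k to the origin
is compatible with the codegeneracies and ends in a map factoring through σ_0, so normalized chains
of X × Δ^k are acyclic. A normalized b-cycle therefore bounds as soon as its component at k = 0
bounds (`exists_totalB_eq`). In that column f_0 is the product with ξ^0_0, which is homologous to a
point, as S¹ is path connected and ε(ξ^0_0) = 1.

The mixed complex laws rest on two computations. J² = 0 because [S¹] × [S¹] is antisymmetric and S¹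
commutative. For Connes' operator, let δ' be the alternating coface sum without the last coface;
then (1 - λ)δ = δ'(1 - λ), δN = Nδ' and sδ' + δ's = 1.

The Leibniz rule, graded commutativity and associativity of the cross product are proved for lists
of vertices, whose shuffle product is defined by recursion on first letters. They pass to singular
chains through families of simplices compatible with affine maps (`SimplexFamily.cross_realize`). -/

noncomputable section

namespace CocyclicChains

/-! ### Chains of ordered lists and their shuffle product -/

section ListChains

variable {α β γ α' β' : Type*}

/-- Real linear combinations of lists. -/
abbrev ListChain (α : Type*) : Type _ := List α →₀ ℝ

/-- Prepending a letter to all lists. -/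
def consL (a : α) : ListChain α →ₗ[ℝ] ListChain α := Finsupp.lmapDomain ℝ ℝ (List.cons a)

@[simp] lemma consL_single (a : α) (l : List α) (r : ℝ) :
    consL a (Finsupp.single l r) = Finsupp.single (a :: l) r := by
  simp [consL]

/-- Applying a function to all letters. -/
def mapL (f : α → β) : ListChain α →ₗ[ℝ] ListChain β := Finsupp.lmapDomain ℝ ℝ (List.map f)

@[simp] lemma mapL_single (f : α → β) (l : List α) (r : ℝ) :
    mapL f (Finsupp.single l r) = Finsupp.single (l.map f) r := by
  simp [mapL]

lemma mapL_consL (f : α → β) (a : α) (x : ListChain α) :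
    mapL f (consL a x) = consL (f a) (mapL f x) := by
  induction x using Finsupp.induction_linear with
  | zero => simp
  | add x y hx hy => simp [hx, hy]
  | single l r => simp

/-- The sign operator: the length of a list. -/
def parL (α : Type*) : ListChain α →ₗ[ℝ] ListChain α :=
  Finsupp.linearCombination ℝ fun l => Finsupp.single l ((-1) ^ l.length)

@[simp] lemma parL_single (l : List α) (r : ℝ) :
    parL α (Finsupp.single l r) = (-1 : ℝ) ^ l.length • Finsupp.single l r := by
  simp [parL, mul_comm]

lemma parL_consL (a : α) (x : ListChain α) : parL α (consL a x) = - consL a (parL α x) := by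
  induction x using Finsupp.induction_linear with
  | zero => simp
  | add x y hx hy => simp [hx, hy]; abel
  | single l r =>
    rw [consL_single, parL_single, parL_single, map_smul, consL_single, List.length_cons, pow_succ,
      mul_neg_one, neg_smul]

lemma parL_cons (a : α) (l : List α) : parL α (Finsupp.single (a :: l) 1) =
    - ((-1 : ℝ) ^ l.length • Finsupp.single (a :: l) 1) := by
  rw [parL_single, List.length_cons, pow_succ, mul_neg_one, neg_smul]

/-- The augmented alternating sum of deletions of letters. -/
def listBd₀ : List α → ListChain α
  | [] => 0
  | a :: l => Finsupp.single l 1 - consL a (listBd₀ l)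

/-- The linear extension of `listBd₀`. -/
def listBd (α : Type*) : ListChain α →ₗ[ℝ] ListChain α := Finsupp.linearCombination ℝ listBd₀

@[simp] lemma listBd_nil : listBd α (Finsupp.single [] 1) = 0 := by
  simp [listBd, listBd₀]

lemma listBd_consL (a : α) (x : ListChain α) :
    listBd α (consL a x) = x - consL a (listBd α x) := by
  induction x using Finsupp.induction_linear with
  | zero => simp
  | add x y hx hy => simp only [map_add, hx, hy]; abel
  | single l r => simp [listBd, listBd₀, smul_sub]

lemma listBd_listBd (x : ListChain α) : listBd α (listBd α x) = 0 := by
  have key : ∀ l : List α, listBd α (listBd α (Finsupp.single l 1)) = 0 := by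
    intro l
    induction l with
    | nil => simp
    | cons a l ih =>
      rw [← consL_single, listBd_consL, map_sub, listBd_consL, ih]
      simp
  induction x using Finsupp.induction_linear with
  | zero => simp
  | add x y hx hy => simp [hx, hy]
  | single l r =>
    rw [← mul_one r, ← smul_eq_mul, ← Finsupp.smul_single, map_smul, map_smul, key, smul_zero]

lemma parL_listBd (x : ListChain α) : parL α (listBd α x) = - listBd α (parL α x) := by
  have key : ∀ l : List α, parL α (listBd α (Finsupp.single l 1)) =
      - listBd α (parL α (Finsupp.single l 1)) := by
    intro l
    induction l with
    | nil => simp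
    | cons a l ih =>
      rw [← consL_single, listBd_consL, map_sub, parL_consL, ih, parL_consL]
      simp only [map_neg, listBd_consL]
      abel
  induction x using Finsupp.induction_linear with
  | zero => simp
  | add x y hx hy => simp only [map_add, hx, hy]; abel
  | single l r =>
    rw [← mul_one r, ← smul_eq_mul, ← Finsupp.smul_single]
    simp only [map_smul, key, smul_neg]

/-- The bilinear form with values in the multiples of the empty list. -/
def nilPair (α β : Type*) : ListChain α →ₗ[ℝ] ListChain β →ₗ[ℝ] ListChain (α × β) :=
  LinearMap.mk₂ ℝ (fun x y => Finsupp.single [] (x [] * y []))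
    (fun x x' y => by rw [Finsupp.add_apply, add_mul, Finsupp.single_add])
    (fun c x y => by rw [Finsupp.smul_single, Finsupp.smul_apply, smul_eq_mul, smul_eq_mul,
      mul_assoc])
    (fun x y y' => by rw [Finsupp.add_apply, mul_add, Finsupp.single_add])
    (fun c x y => by rw [Finsupp.smul_single, Finsupp.smul_apply, smul_eq_mul, smul_eq_mul,
      mul_left_comm])

lemma nilPair_apply (x : ListChain α) (y : ListChain β) :
    nilPair α β x y = Finsupp.single [] (x [] * y []) := rfl

@[simp] lemma consL_apply_nil (a : α) (x : ListChain α) : consL a x [] = 0 := by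
  induction x using Finsupp.induction_linear with
  | zero => simp
  | add x y hx hy => simp [hx, hy]
  | single l r => simp

/-- The shuffle product of two lists: the alternating sum of all staircase paths from the pair of
first letters to the pair of last letters. -/
def shuffle₀ : List α → List β → ListChain (α × β)
  | [], _ => 0
  | _ :: _, [] => 0
  -- A path leaves (a, b) by a step in the first or in the second factor; the latter precedes all
  -- `l.length` steps of the first factor, hence the sign. The `nilPair` term is nonzero only for
  -- two empty tails and ends the path, products with an empty list being 0.
  | a :: l, b :: m => consL (a, b) (shuffle₀ l (b :: m) + (-1 : ℝ) ^ l.length • shuffle₀ (a :: l) m +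
      nilPair α β (Finsupp.single l 1) (Finsupp.single m 1))
termination_by l m => l.length + m.length

/-- The bilinear extension of `shuffle₀`. -/
def shuffleL (α β : Type*) : ListChain α →ₗ[ℝ] ListChain β →ₗ[ℝ] ListChain (α × β) :=
  Finsupp.linearCombination ℝ fun l => Finsupp.linearCombination ℝ fun m => shuffle₀ l m

lemma shuffleL_single (l : List α) (m : List β) :
    shuffleL α β (Finsupp.single l 1) (Finsupp.single m 1) = shuffle₀ l m := by
  simp [shuffleL]

@[simp] lemma shuffleL_nil_left (y : ListChain β) : shuffleL α β (Finsupp.single [] 1) y = 0 := by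
  induction y using Finsupp.induction_linear with
  | zero => simp
  | add x y hx hy => simp [hx, hy]
  | single l r => simp [shuffleL, shuffle₀]

@[simp] lemma shuffleL_nil_right (x : ListChain α) : shuffleL α β x (Finsupp.single [] 1) = 0 := by
  induction x using Finsupp.induction_linear with
  | zero => simp
  | add x y hx hy => simp [hx, hy]
  | single l r => cases l <;> simp [shuffleL, shuffle₀]

/-- Two linear maps out of list chains agreeing on lists agree. -/
@[elab_as_elim]
lemma listChain_induction {P : ListChain α → Prop} (zero : P 0)
    (add : ∀ x y, P x → P y → P (x + y)) (smul : ∀ (c : ℝ) x, P x → P (c • x))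
    (single : ∀ l, P (Finsupp.single l 1)) (x : ListChain α) : P x := by
  induction x using Finsupp.induction_linear with
  | zero => exact zero
  | add x y hx hy => exact add _ _ hx hy
  | single l r =>
    rw [← mul_one r, ← smul_eq_mul, ← Finsupp.smul_single]
    exact smul _ _ (single l)

/-- The recursion in bilinear form, needed because tails such as boundaries are not single lists;
the sign becomes `parL` on the first tail. -/
lemma shuffleL_consL (a : α) (b : β) (x : ListChain α) (y : ListChain β) :
    shuffleL α β (consL a x) (consL b y) = consL (a, b) (shuffleL α β x (consL b y) +
      shuffleL α β (consL a (parL α x)) y + nilPair α β x y) := by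
  induction x using listChain_induction with
  | zero => simp
  | add x x' hx hx' => simp only [map_add, LinearMap.add_apply, hx, hx']; abel
  | smul c x hx => simp only [map_smul, LinearMap.smul_apply, hx, ← smul_add]
  | single l =>
  induction y using listChain_induction with
  | zero => simp
  | add y y' hy hy' => simp only [map_add, hy, hy']; abel
  | smul c y hy => simp only [map_smul, hy, ← smul_add]
  | single m =>
  · simp only [consL_single, parL_single, map_smul, LinearMap.smul_apply, shuffleL_single]
    rw [shuffle₀]

lemma shuffleL_cons (a : α) (b : β) (l : List α) (m : List β) :
    shuffleL α β (Finsupp.single (a :: l) 1) (Finsupp.single (b :: m) 1) =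
      consL (a, b) (shuffleL α β (Finsupp.single l 1) (Finsupp.single (b :: m) 1) +
      (-1 : ℝ) ^ l.length • shuffleL α β (Finsupp.single (a :: l) 1) (Finsupp.single m 1) +
      nilPair α β (Finsupp.single l 1) (Finsupp.single m 1)) := by
  simp only [shuffleL_single]
  rw [shuffle₀]

lemma shuffleL_apply_nil (x : ListChain α) (y : ListChain β) : shuffleL α β x y [] = 0 := by
  induction x using listChain_induction with
  | zero => simp
  | add u v hu hv => simp [hu, hv]
  | smul c u hu => simp [hu]
  | single l =>
  induction y using listChain_induction with
  | zero => simp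
  | add u v hu hv => simp [hu, hv]
  | smul c u hu => simp [hu]
  | single m =>
  rcases l with _ | ⟨a, l⟩
  · simp
  rcases m with _ | ⟨b, m⟩
  · simp
  rw [shuffleL_cons, consL_apply_nil]

lemma neg_one_pow_mul_self (n : ℕ) : (-1 : ℝ) ^ n * (-1) ^ n = 1 := by
  rw [← mul_pow]; simp

/-- The correction term in the Leibniz rule for the augmented boundary. -/
def pointPair : List α → List β → ListChain (α × β)
  | _ :: l, _ :: m => nilPair α β (Finsupp.single l 1) (Finsupp.single m 1)
  | _, _ => 0

/-- The empty list occurs in the boundary only of a one-letter list. -/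
lemma nilPair_listBd_left (l : List α) (b : β) (m : List β) :
    nilPair α β (listBd α (Finsupp.single l 1)) (Finsupp.single m 1) = pointPair l (b :: m) := by
  rcases l with _ | ⟨a, l⟩
  · simp [pointPair]
  · rw [← consL_single, listBd_consL]
    simp [pointPair, nilPair_apply]

lemma nilPair_listBd_right (a : α) (l : List α) (m : List β) :
    nilPair α β (Finsupp.single l 1) (listBd β (Finsupp.single m 1)) = pointPair (a :: l) m := by
  rcases m with _ | ⟨b, m⟩
  · simp [pointPair]
  · rw [← consL_single, listBd_consL]
    simp [pointPair, nilPair_apply]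

/-- Induction on the total length, expanding at the first letters. The minus sign arises because
`parL` counts letters, one more than the dimension. The correction is nonzero only for two
one-letter lists: the augmented boundary of a product of points is the empty list, while products
with the empty list vanish. -/
lemma listBd_shuffleL_single (l : List α) (m : List β) :
    listBd _ (shuffleL α β (Finsupp.single l 1) (Finsupp.single m 1)) =
      shuffleL α β (listBd α (Finsupp.single l 1)) (Finsupp.single m 1) -
      shuffleL α β (parL α (Finsupp.single l 1)) (listBd β (Finsupp.single m 1)) +
      pointPair l m := by
  induction h : l.length + m.length using Nat.strong_induction_on generalizing l m with
  | _ n ih =>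
  subst h
  rcases l with _ | ⟨a, l⟩
  · simp [pointPair]
  rcases m with _ | ⟨b, m⟩
  · simp [pointPair]
  have h1 := ih _ (by simp) l (b :: m) rfl
  have h2 := ih _ (by simp) (a :: l) m rfl
  have hs := neg_one_pow_mul_self l.length
  rw [shuffleL_cons, listBd_consL]
  simp only [map_add (listBd _), map_smul (listBd _), h1, h2]
  have e1 : listBd α (Finsupp.single (a :: l) 1) =
      Finsupp.single l 1 - consL a (listBd α (Finsupp.single l 1)) := by
    rw [← consL_single, listBd_consL]
  have e2 : listBd β (Finsupp.single (b :: m) 1) =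
      Finsupp.single m 1 - consL b (listBd β (Finsupp.single m 1)) := by
    rw [← consL_single, listBd_consL]
  have e3 : listBd _ (nilPair α β (Finsupp.single l 1) (Finsupp.single m 1)) = 0 := by
    rw [nilPair_apply, ← mul_one (_ * _), ← smul_eq_mul, ← Finsupp.smul_single, map_smul,
      listBd_nil, smul_zero]
  have e4 := shuffleL_consL a b (listBd α (Finsupp.single l 1)) (Finsupp.single m 1)
  have e5 := shuffleL_consL a b (Finsupp.single l 1) (listBd β (Finsupp.single m 1))
  rw [nilPair_listBd_left l b, parL_listBd] at e4
  rw [nilPair_listBd_right a] at e5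
  simp only [consL_single, parL_single, map_smul, map_neg, LinearMap.smul_apply,
    LinearMap.neg_apply] at e4 e5
  rw [e1, e2, e3, parL_cons]
  simp only [map_sub, LinearMap.sub_apply, parL_single, map_smul, LinearMap.smul_apply,
    LinearMap.neg_apply, e4, e5, map_add, map_neg, smul_add, map_zero,
    smul_sub, smul_neg, smul_smul, hs, one_smul]
  rw [pointPair]
  abel

/-- The sign is now that of the dimension, and the correction is a multiple of the empty list, hence
invisible in singular chains. -/
lemma listBd_shuffleL_cons (a : α) (l : List α) (b : β) (m : List β) :
    listBd _ (shuffleL α β (Finsupp.single (a :: l) 1) (Finsupp.single (b :: m) 1)) =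
      shuffleL α β (listBd α (Finsupp.single (a :: l) 1)) (Finsupp.single (b :: m) 1) +
      (-1 : ℝ) ^ l.length •
        shuffleL α β (Finsupp.single (a :: l) 1) (listBd β (Finsupp.single (b :: m) 1)) +
      nilPair α β (Finsupp.single l 1) (Finsupp.single m 1) := by
  rw [listBd_shuffleL_single, parL_single, map_smul, LinearMap.smul_apply, List.length_cons,
    pow_succ, mul_neg_one, neg_smul, sub_neg_eq_add, pointPair]

/-- The swap exchanges the two kinds of first step. First letters are split off so that `l.length`
and `m.length` are the dimensions. -/
lemma mapL_shuffleL_swap (a : α) (l : List α) (b : β) (m : List β) :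
    mapL Prod.swap (shuffleL α β (Finsupp.single (a :: l) 1) (Finsupp.single (b :: m) 1)) =
      (-1 : ℝ) ^ (l.length * m.length) •
        shuffleL β α (Finsupp.single (b :: m) 1) (Finsupp.single (a :: l) 1) := by
  induction h : l.length + m.length using Nat.strong_induction_on generalizing a l b m with
  | _ n ih =>
  subst h
  have h3 : mapL Prod.swap (nilPair α β (Finsupp.single l 1) (Finsupp.single m 1)) =
      (-1 : ℝ) ^ (l.length * m.length) •
        nilPair β α (Finsupp.single m 1) (Finsupp.single l 1) := by
    rcases l with _ | ⟨a, l⟩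
    · simp [nilPair_apply]
    · simp [nilPair_apply]
  have h1 : mapL Prod.swap (shuffleL α β (Finsupp.single l 1) (Finsupp.single (b :: m) 1)) =
      ((-1 : ℝ) ^ (l.length * m.length) * (-1) ^ m.length) •
        shuffleL β α (Finsupp.single (b :: m) 1) (Finsupp.single l 1) := by
    rcases l with _ | ⟨a, l⟩
    · simp
    · rw [ih _ (by simp) a l b m rfl]
      congr 1
      rw [List.length_cons, add_mul, pow_add, one_mul, mul_assoc, neg_one_pow_mul_self, mul_one]
  have h2 : mapL Prod.swap (shuffleL α β (Finsupp.single (a :: l) 1) (Finsupp.single m 1)) =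
      ((-1 : ℝ) ^ (l.length * m.length) * (-1) ^ l.length) •
        shuffleL β α (Finsupp.single m 1) (Finsupp.single (a :: l) 1) := by
    rcases m with _ | ⟨b, m⟩
    · simp
    · rw [ih _ (by simp) a l b m rfl]
      congr 1
      rw [List.length_cons, mul_add, pow_add, mul_one, mul_assoc, neg_one_pow_mul_self, mul_one]
  rw [shuffleL_cons, shuffleL_cons, mapL_consL, ← map_smul (consL _)]
  simp only [map_add (mapL _), map_smul (mapL _), h1, h2, h3]
  simp only [smul_add, smul_smul, Prod.swap_prod_mk]
  rw [mul_left_comm, neg_one_pow_mul_self, mul_one]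
  congr 1
  abel

/-- The paths in a product have one letter fewer than the two lists together, whence the minus sign.
-/
lemma parL_shuffleL (x : ListChain α) (y : ListChain β) :
    parL _ (shuffleL α β x y) = - shuffleL α β (parL α x) (parL β y) := by
  induction x using listChain_induction with
  | zero => simp
  | add x x' hx hx' => simp only [map_add, LinearMap.add_apply, hx, hx']; abel
  | smul c x hx => simp only [map_smul, LinearMap.smul_apply, hx, smul_neg]
  | single l =>
  induction y using listChain_induction with
  | zero => simp
  | add y y' hy hy' => simp only [map_add, hy, hy']; abel
  | smul c y hy => simp only [map_smul, hy, smul_neg]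
  | single m =>
  induction h : l.length + m.length using Nat.strong_induction_on generalizing l m with
  | _ n ih =>
  subst h
  rcases l with _ | ⟨a, l⟩
  · simp
  rcases m with _ | ⟨b, m⟩
  · simp
  have h3 : parL _ (nilPair α β (Finsupp.single l 1) (Finsupp.single m 1)) =
      ((-1 : ℝ) ^ l.length * (-1 : ℝ) ^ m.length) •
      nilPair α β (Finsupp.single l 1) (Finsupp.single m 1) := by
    rcases l with _ | ⟨a, l⟩
    · rcases m with _ | ⟨b, m⟩
      · simp [nilPair_apply]
      · simp [nilPair_apply]
    · simp [nilPair_apply]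
  rw [shuffleL_cons, parL_consL]
  simp only [map_add (parL _), map_smul (parL _), ih _ (by simp) l (b :: m) rfl,
    ih _ (by simp) (a :: l) m rfl, h3]
  rw [parL_cons, parL_cons]
  simp only [parL_single, map_smul, LinearMap.smul_apply, LinearMap.neg_apply,
    shuffleL_cons, neg_neg, map_add, map_neg, smul_add, smul_neg, smul_smul]
  simp only [mul_assoc, mul_comm]

lemma nilPair_shuffleL_left (x : ListChain α) (y : ListChain β) (z : ListChain γ) :
    nilPair _ γ (shuffleL α β x y) z = 0 := by
  simp [nilPair_apply, shuffleL_apply_nil]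

lemma nilPair_shuffleL_right (x : ListChain α) (y : ListChain β) (z : ListChain γ) :
    nilPair α _ x (shuffleL β γ y z) = 0 := by
  simp [nilPair_apply, shuffleL_apply_nil]

lemma shuffleL_nilPair_left (x : ListChain α) (y : ListChain β) (z : ListChain γ) :
    shuffleL _ γ (nilPair α β x y) z = 0 := by
  rw [nilPair_apply, ← mul_one (_ * _), ← smul_eq_mul, ← Finsupp.smul_single, map_smul,
    LinearMap.smul_apply, shuffleL_nil_left, smul_zero]

lemma shuffleL_nilPair_right (x : ListChain α) (y : ListChain β) (z : ListChain γ) :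
    shuffleL α _ x (nilPair β γ y z) = 0 := by
  rw [nilPair_apply, ← mul_one (_ * _), ← smul_eq_mul, ← Finsupp.smul_single, map_smul,
    shuffleL_nil_right, smul_zero]

/-- Both sides satisfy the same recursion: a path of triples begins with a step in one of the three
factors. Induction on the total length then applies to each of the three terms. -/
lemma mapL_shuffleL_assoc (x : ListChain α) (y : ListChain β) (z : ListChain γ) :
    mapL (Equiv.prodAssoc α β γ) (shuffleL _ γ (shuffleL α β x y) z) =
      shuffleL α _ x (shuffleL β γ y z) := by
  induction x using listChain_induction with
  | zero => simp
  | add u v hu hv => simp [hu, hv]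
  | smul c u hu => simp [hu]
  | single l =>
  induction y using listChain_induction with
  | zero => simp
  | add u v hu hv => simp [hu, hv]
  | smul c u hu => simp [hu]
  | single m =>
  induction z using listChain_induction with
  | zero => simp
  | add u v hu hv => simp [hu, hv]
  | smul c u hu => simp [hu]
  | single n =>
  induction h : l.length + m.length + n.length using Nat.strong_induction_on
    generalizing l m n with
  | _ N ih =>
  subst h
  rcases l with _ | ⟨a, l⟩
  · simp
  rcases m with _ | ⟨b, m⟩
  · simp
  rcases n with _ | ⟨c, n⟩
  · simp
  have h1 := ih _ (by simp) l (b :: m) (c :: n) rfl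
  have h2 := ih _ (by simp) (a :: l) m (c :: n) rfl
  have h3 := ih _ (by simp) (a :: l) (b :: m) n rfl
  -- All lists in the inner product have equal length, so `parL` acts on its tail by a scalar, and
  -- the recursion applies to the outer product.
  have e1 : parL _ (shuffleL α β (Finsupp.single (a :: l) 1) (Finsupp.single (b :: m) 1)) =
      - ((-1 : ℝ) ^ l.length * (-1 : ℝ) ^ m.length) •
        shuffleL α β (Finsupp.single (a :: l) 1) (Finsupp.single (b :: m) 1) := by
    rw [parL_shuffleL]
    rw [parL_cons, parL_cons]
    simp only [map_neg, LinearMap.neg_apply, map_smul, LinearMap.smul_apply, smul_smul,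
      neg_neg, neg_smul, smul_neg]
    rw [mul_comm]
  rw [shuffleL_cons a b, parL_consL, neg_smul, neg_inj] at e1
  have e2 := shuffleL_consL (a, b) c (shuffleL α β (Finsupp.single l 1) (Finsupp.single (b :: m) 1) +
      (-1 : ℝ) ^ l.length • shuffleL α β (Finsupp.single (a :: l) 1) (Finsupp.single m 1) +
      nilPair α β (Finsupp.single l 1) (Finsupp.single m 1)) (Finsupp.single n 1)
  rw [e1, consL_single, ← shuffleL_cons] at e2
  have e3 := shuffleL_consL a (b, c) (Finsupp.single l 1)
    (shuffleL β γ (Finsupp.single m 1) (Finsupp.single (c :: n) 1) +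
      (-1 : ℝ) ^ m.length • shuffleL β γ (Finsupp.single (b :: m) 1) (Finsupp.single n 1) +
      nilPair β γ (Finsupp.single m 1) (Finsupp.single n 1))
  rw [consL_single, ← shuffleL_cons] at e3
  have e4 : mapL (Equiv.prodAssoc α β γ) (nilPair (α × β) γ
      (nilPair α β (Finsupp.single l 1) (Finsupp.single m 1)) (Finsupp.single n 1)) =
      nilPair α (β × γ) (Finsupp.single l 1)
        (nilPair β γ (Finsupp.single m 1) (Finsupp.single n 1)) := by
    cases l <;> cases m <;> cases n <;> simp [nilPair_apply]
  rw [e2, e3, mapL_consL]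
  simp only [map_add, LinearMap.add_apply, map_smul, LinearMap.smul_apply, nilPair_shuffleL_left,
    nilPair_shuffleL_right, shuffleL_nilPair_left, shuffleL_nilPair_right, parL_single,
    consL_single, h1, h2, h3, e4, smul_smul, smul_zero, add_zero, zero_add]
  rw [mul_comm ((-1 : ℝ) ^ m.length)]
  simp only [Equiv.prodAssoc_apply]
  abel

end ListChains

end CocyclicChains

end

noncomputable section

namespace CocyclicChains

/-! ### The shuffle product of lists as a sum over shuffles -/

section Words

variable {α β : Type*}

/-- The number of letters `true` of a binary word. -/
def wordNum {n : ℕ} (a : Fin n → Bool) : ℕ := ∑ i, if a i then 1 else 0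

/-- The number of letters `true` of a binary word before the position `j`. -/
def wordCount {n : ℕ} (a : Fin n → Bool) (j : ℕ) : ℕ := ∑ i, if a i ∧ (i : ℕ) < j then 1 else 0

/-- The sign of a binary word: the parity of the pairs `false` before `true`. -/
def wordSign {n : ℕ} (a : Fin n → Bool) : ℝ :=
  ∏ i, ∏ j, if i < j ∧ a i = false ∧ a j = true then -1 else 1

lemma wordNum_cons {n : ℕ} (b : Bool) (a : Fin n → Bool) :
    wordNum (Fin.cons b a : Fin (n + 1) → Bool) = (if b then 1 else 0) + wordNum a := by
  simp only [wordNum, Fin.sum_univ_succ, Fin.cons_zero, Fin.cons_succ]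

lemma wordNum_le {n : ℕ} (a : Fin n → Bool) : wordNum a ≤ n := by
  calc wordNum a ≤ ∑ _i : Fin n, 1 := Finset.sum_le_sum fun i _ => by split_ifs <;> simp
  _ = n := by simp

@[simp] lemma wordCount_zero {n : ℕ} (a : Fin n → Bool) : wordCount a 0 = 0 := by
  simp [wordCount]

lemma wordCount_cons_succ {n : ℕ} (b : Bool) (a : Fin n → Bool) (j : ℕ) :
    wordCount (Fin.cons b a : Fin (n + 1) → Bool) (j + 1) =
      (if b then 1 else 0) + wordCount a j := by
  simp only [wordCount, Fin.sum_univ_succ, Fin.cons_zero, Fin.cons_succ, Fin.val_zero,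
    Fin.val_succ, Nat.zero_lt_succ, and_true, add_lt_add_iff_right]

lemma wordSign_cons_true {n : ℕ} (a : Fin n → Bool) :
    wordSign (Fin.cons true a : Fin (n + 1) → Bool) = wordSign a := by
  simp [wordSign, Fin.prod_univ_succ, Fin.succ_lt_succ_iff]

/-- An initial `false` forms an inversion with every later `true`. -/
lemma wordSign_cons_false {n : ℕ} (a : Fin n → Bool) :
    wordSign (Fin.cons false a : Fin (n + 1) → Bool) = (-1) ^ wordNum a * wordSign a := by
  have h : ∏ j : Fin n, (if a j then (-1 : ℝ) else 1) = (-1) ^ wordNum a := by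
    rw [wordNum, ← Finset.prod_pow_eq_pow_sum]
    exact Finset.prod_congr rfl fun j _ => by split_ifs <;> simp
  simp [wordSign, Fin.prod_univ_succ, Fin.succ_lt_succ_iff, h]

lemma sum_word_succ {M : Type*} [AddCommMonoid M] {n : ℕ} (f : (Fin (n + 1) → Bool) → M) :
    ∑ a, f a = ∑ a : Fin n → Bool, f (Fin.cons true a) + ∑ a : Fin n → Bool, f (Fin.cons false a) := by
  rw [← (Fin.consEquiv fun _ : Fin (n + 1) => Bool).sum_comp, Fintype.sum_prod_type]
  simp [Fin.consEquiv]

/-- The staircase path of a binary word. -/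
def wordPath {n : ℕ} (a : Fin n → Bool) (v : ℕ → α) (w : ℕ → β) : List (α × β) :=
  List.ofFn fun j : Fin (n + 1) => (v (wordCount a j), w (wordCount (fun i => !a i) j))

lemma not_cons {n : ℕ} (b : Bool) (a : Fin n → Bool) :
    (fun i => !(Fin.cons b a : Fin (n + 1) → Bool) i) = Fin.cons (!b) fun i => !a i := by
  funext i
  cases i using Fin.cases <;> simp

lemma wordPath_cons_true {n : ℕ} (a : Fin n → Bool) (v : ℕ → α) (w : ℕ → β) :
    wordPath (Fin.cons true a : Fin (n + 1) → Bool) v w =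
      (v 0, w 0) :: wordPath a (fun i => v (i + 1)) w := by
  rw [wordPath, List.ofFn_succ]
  simp [wordPath, not_cons, wordCount_cons_succ, add_comm]

lemma wordPath_cons_false {n : ℕ} (a : Fin n → Bool) (v : ℕ → α) (w : ℕ → β) :
    wordPath (Fin.cons false a : Fin (n + 1) → Bool) v w =
      (v 0, w 0) :: wordPath a v (fun i => w (i + 1)) := by
  rw [wordPath, List.ofFn_succ]
  simp [wordPath, not_cons, wordCount_cons_succ, add_comm]

/-- Unrolls the recursion: `true` is a step in the first factor, and the sum is split by the first
letter of the word. Vertices are indexed by ℕ so that passing to a tail is a shift of the index. -/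
lemma shuffleL_ofFn (n p q : ℕ) (h : p + q = n) (v : ℕ → α) (w : ℕ → β) :
    shuffleL α β (Finsupp.single (List.ofFn fun i : Fin (p + 1) => v i) 1)
      (Finsupp.single (List.ofFn fun i : Fin (q + 1) => w i) 1) =
    ∑ a : Fin n → Bool, if wordNum a = p then wordSign a • Finsupp.single (wordPath a v w) 1
      else 0 := by
  induction n generalizing p q v w with
  | zero =>
    obtain ⟨rfl, rfl⟩ : p = 0 ∧ q = 0 := by omega
    rw [Fintype.sum_eq_single default (fun a ha => absurd (Subsingleton.elim _ _) ha)]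
    simp only [List.ofFn_succ, List.ofFn_zero, shuffleL_cons]
    simp [wordNum, wordSign, wordPath, nilPair_apply]
  | succ n ih =>
    rw [sum_word_succ]
    have h1 : ∑ a : Fin n → Bool, (if wordNum (Fin.cons true a : Fin (n + 1) → Bool) = p then
        wordSign (Fin.cons true a : Fin (n + 1) → Bool) •
          Finsupp.single (wordPath (Fin.cons true a : Fin (n + 1) → Bool) v w) (1 : ℝ) else 0) =
        consL (v 0, w 0) (shuffleL α β
          (Finsupp.single (List.ofFn fun i : Fin p => v (i + 1)) 1)
          (Finsupp.single (List.ofFn fun i : Fin (q + 1) => w i) 1)) := by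
      rcases p with _ | p
      · simp [wordNum_cons, add_comm]
      · rw [ih p q (by omega) (fun i => v (i + 1)) w, map_sum]
        refine Finset.sum_congr rfl fun a _ => ?_
        rw [wordNum_cons, wordSign_cons_true, wordPath_cons_true]
        simp only [if_true, add_comm 1, add_left_inj]
        split_ifs
        · rw [map_smul, consL_single]
        · simp
    have h2 : ∑ a : Fin n → Bool, (if wordNum (Fin.cons false a : Fin (n + 1) → Bool) = p then
        wordSign (Fin.cons false a : Fin (n + 1) → Bool) •
          Finsupp.single (wordPath (Fin.cons false a : Fin (n + 1) → Bool) v w) (1 : ℝ) else 0) =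
        consL (v 0, w 0) ((-1 : ℝ) ^ p • shuffleL α β
          (Finsupp.single (List.ofFn fun i : Fin (p + 1) => v i) 1)
          (Finsupp.single (List.ofFn fun i : Fin q => w (i + 1)) 1)) := by
      rcases q with _ | q
      -- For q = 0 one has p = n + 1, but a word starting with `false` has at most n letters `true`.
      · rw [Finset.sum_eq_zero fun a _ => ?_]
        · simp
        · rw [if_neg]
          have := wordNum_le a
          rw [wordNum_cons]
          simp only [Bool.false_eq_true, if_false]
          omega
      · rw [ih p q (by omega) v (fun i => w (i + 1)), map_smul, map_sum, Finset.smul_sum]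
        refine Finset.sum_congr rfl fun a _ => ?_
        rw [wordNum_cons, wordSign_cons_false, wordPath_cons_false]
        simp only [Bool.false_eq_true, if_false, zero_add]
        split_ifs with hp
        · rw [map_smul, consL_single, smul_smul, hp]
        · simp
    have h3 : nilPair α β (Finsupp.single (List.ofFn fun i : Fin p => v (i + 1)) 1)
        (Finsupp.single (List.ofFn fun i : Fin q => w (i + 1)) 1) = 0 := by
      rw [nilPair_apply]
      rcases p with _ | p
      · obtain rfl : q = n + 1 := by omega
        simp
      · simp
    rw [h1, h2]
    rw [List.ofFn_succ, List.ofFn_succ (n := q)]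
    simp only [Fin.val_zero, Fin.val_succ, shuffleL_cons, List.length_ofFn]
    rw [h3, add_zero, map_add, map_smul]

end Words

end CocyclicChains

end

noncomputable section

namespace CocyclicChains

/-! ### Affine maps between simplices -/

lemma coord_zero {k : ℕ} (t : Simplex k) : coord t 0 = 0 := by simp [coord]

lemma coord_succ {k : ℕ} (t : Simplex k) {j : ℕ} (h : j < k) : coord t (j + 1) = t.1 ⟨j, h⟩ := by
  simp [coord, h]

lemma coord_of_lt {k : ℕ} (t : Simplex k) {j : ℕ} (h : k < j) : coord t j = 1 := by
  have h1 : ¬ j - 1 < k := by omega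
  have h2 : j ≠ 0 := by omega
  simp [coord, h1, h2]

lemma simplex_ext {k : ℕ} {s t : Simplex k} (h : ∀ j < k, coord s (j + 1) = coord t (j + 1)) :
    s = t := by
  refine Subtype.ext (funext fun j => ?_)
  have := h j j.2
  rwa [coord_succ _ j.2, coord_succ _ j.2] at this

/-- The barycentric coordinates of a point of a simplex. -/
def bary {k : ℕ} (t : Simplex k) (j : ℕ) : ℝ := coord t (j + 1) - coord t j

lemma bary_nonneg {k : ℕ} (t : Simplex k) (j : ℕ) : 0 ≤ bary t j :=
  sub_nonneg.2 (coord_mono t (Nat.le_succ j))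

lemma sum_bary_lt {k : ℕ} (t : Simplex k) (N : ℕ) (hN : N ≤ k + 1) :
    ∑ j : Fin (k + 1), (if (j : ℕ) < N then bary t j else 0) = coord t N := by
  rw [Fin.sum_univ_eq_sum_range (fun j => if j < N then bary t j else 0) (k + 1),
    ← Finset.sum_filter]
  have : (Finset.range (k + 1)).filter (· < N) = Finset.range N := by
    ext j
    simp only [Finset.mem_filter, Finset.mem_range]
    omega
  rw [this]
  simp only [bary]
  rw [Finset.sum_range_sub, coord_zero, sub_zero]

lemma sum_bary {k : ℕ} (t : Simplex k) : ∑ j : Fin (k + 1), bary t j = 1 := by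
  have := sum_bary_lt t (k + 1) le_rfl
  simpa only [Fin.is_lt, if_true, coord_of_lt t (Nat.lt_succ_self k)] using this

/-- The affine map between simplices with given values on the vertices. -/
def aff {m n : ℕ} (k : Fin (m + 1) → Fin (n + 1)) : C(Simplex m, Simplex n) where
  -- The vertex j of a simplex has t_i = 0 for i ≤ j and t_i = 1 for i > j, so t_i is the total
  -- barycentric weight of the vertices of index less than i.
  toFun t := ⟨fun l => ∑ j, if (k j : ℕ) < l + 1 then bary t j else 0,
    fun a b hab => Finset.sum_le_sum fun j _ => by
      have hab' : (a : ℕ) ≤ b := hab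
      have := bary_nonneg t j
      split_ifs <;> first | omega | exact this | exact le_rfl,
    fun l => ⟨Finset.sum_nonneg fun j _ => by
        have := bary_nonneg t j
        split_ifs <;> simp [this], by
      rw [← sum_bary t]
      refine Finset.sum_le_sum fun j _ => ?_
      have := bary_nonneg t j
      split_ifs <;> simp [this]⟩⟩
  continuous_toFun := by
    refine Continuous.subtype_mk (continuous_pi fun l => continuous_finsetSum _ fun j _ => ?_) _
    split_ifs
    · exact (continuous_coord _).sub (continuous_coord _)
    · exact continuous_const

lemma coord_aff {m n : ℕ} (k : Fin (m + 1) → Fin (n + 1)) (t : Simplex m) (c : ℕ) :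
    coord (aff k t) c = ∑ j, if (k j : ℕ) < c then bary t j else 0 := by
  rcases c with _ | c
  · simp [coord_zero]
  by_cases hc : c < n
  · rw [coord_succ _ hc]
    rfl
  · rw [coord_of_lt _ (by omega), ← sum_bary t]
    refine Finset.sum_congr rfl fun j _ => ?_
    rw [if_pos (by have := (k j).2; omega)]

lemma bary_aff {m n : ℕ} (k : Fin (m + 1) → Fin (n + 1)) (t : Simplex m) (c : ℕ) :
    bary (aff k t) c = ∑ j, if (k j : ℕ) = c then bary t j else 0 := by
  rw [bary, coord_aff, coord_aff, ← Finset.sum_sub_distrib]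
  refine Finset.sum_congr rfl fun j _ => ?_
  split_ifs <;> first | omega | simp

lemma aff_comp {l m n : ℕ} (k : Fin (m + 1) → Fin (n + 1)) (k' : Fin (l + 1) → Fin (m + 1)) :
    aff (k ∘ k') = (aff k).comp (aff k') := by
  ext1 t
  refine simplex_ext fun c _ => ?_
  rw [ContinuousMap.comp_apply, coord_aff, coord_aff]
  simp only [bary_aff, Function.comp_apply]
  have : ∀ x : Fin (m + 1), (if (k x : ℕ) < c + 1 then
      ∑ j, (if (k' j : ℕ) = x then bary t j else 0) else 0) =
      ∑ j, if k' j = x then (if (k x : ℕ) < c + 1 then bary t j else 0) else 0 := by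
    intro x
    split_ifs
    · simp [Fin.ext_iff]
    · simp
  simp only [this]
  rw [Finset.sum_comm]
  refine Finset.sum_congr rfl fun j _ => ?_
  rw [Finset.sum_ite_eq]
  simp

/-- If the vertices sent below c are exactly the first N, the weights telescope to a single
coordinate. Cofaces and coordinate projections are recognized as affine maps in this way. -/
lemma coord_aff_of_lt_iff {m n : ℕ} (k : Fin (m + 1) → Fin (n + 1)) (t : Simplex m) (c N : ℕ)
    (hN : N ≤ m + 1) (h : ∀ j, (k j : ℕ) < c ↔ (j : ℕ) < N) :
    coord (aff k t) c = coord t N := by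
  rw [coord_aff, ← sum_bary_lt t N hN]
  simp only [h]

lemma aff_id (n : ℕ) : aff (id : Fin (n + 1) → Fin (n + 1)) = ContinuousMap.id _ := by
  ext1 t
  exact simplex_ext fun c hc => coord_aff_of_lt_iff _ _ _ _ (by omega) fun j => Iff.rfl

lemma coface_eq_aff {k : ℕ} (i : Fin (k + 2)) :
    coface i = aff (i.succAbove : Fin (k + 1) → Fin (k + 2)) := by
  ext1 t
  refine simplex_ext fun c hc => ?_
  rw [coord_succ _ hc]
  change coord t (if c + 1 ≤ (i : ℕ) then c + 1 else c) = _
  refine (coord_aff_of_lt_iff _ _ _ _ (by split_ifs <;> omega) fun j => ?_).symm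
  simp only [Fin.succAbove, Fin.lt_def, Fin.val_castSucc]
  by_cases h1 : (j : ℕ) < i <;> by_cases h2 : c + 1 ≤ (i : ℕ) <;>
    simp only [h1, h2, if_true, if_false, Fin.val_castSucc, Fin.val_succ] <;> omega

lemma restrictCoords_eq_aff {p n : ℕ} (e : Fin p ↪o Fin n) (k : Fin (n + 1) → Fin (p + 1))
    (h : ∀ j (l : Fin p), (k j : ℕ) ≤ l ↔ (j : ℕ) ≤ e l) : restrictCoords e = aff k := by
  ext1 t
  refine simplex_ext fun c hc => ?_
  rw [coord_succ _ hc]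
  change t.1 (e ⟨c, hc⟩) = _
  rw [coord_aff_of_lt_iff k t (c + 1) (e ⟨c, hc⟩ + 1) (by omega) fun j => ?_,
    coord_succ _ (e ⟨c, hc⟩).2]
  have := h j ⟨c, hc⟩
  dsimp only at this
  omega

/-- Links the two descriptions of a shuffle: the projection keeping the coordinates in A sends the
vertex j to the number of elements of A before j, which is the position reached by the staircase
path. -/
lemma restrictCoords_orderEmbOfFin {p n : ℕ} (A : Finset (Fin n)) (hA : A.card = p)
    (k : Fin (n + 1) → Fin (p + 1))
    (hk : ∀ j, (k j : ℕ) = wordCount (fun i => decide (i ∈ A)) j) :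
    restrictCoords (A.orderEmbOfFin hA) = aff k := by
  refine restrictCoords_eq_aff _ _ fun j l => ?_
  have hcard : (k j : ℕ) =
      (Finset.univ.filter fun x : Fin p => (A.orderEmbOfFin hA x : ℕ) < j).card := by
    rw [hk, wordCount, ← Finset.card_filter, ← Finset.card_map (A.orderEmbOfFin hA).toEmbedding]
    congr 1
    ext i
    simp only [Finset.mem_filter, Finset.mem_univ, true_and, decide_eq_true_eq, Finset.mem_map,
      RelEmbedding.coe_toEmbedding]
    constructor
    · rintro ⟨hi, hij⟩
      have : i ∈ Set.range (A.orderEmbOfFin hA) := by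
        rw [Finset.range_orderEmbOfFin]
        exact hi
      obtain ⟨x, rfl⟩ := this
      exact ⟨x, hij, rfl⟩
    · rintro ⟨x, hx, rfl⟩
      exact ⟨Finset.orderEmbOfFin_mem A hA x, hx⟩
  rw [hcard]
  constructor
  · intro h
    by_contra hc
    have : (Finset.Iic l).card ≤
        (Finset.univ.filter fun x : Fin p => (A.orderEmbOfFin hA x : ℕ) < j).card := by
      refine Finset.card_le_card fun x hx => ?_
      simp only [Finset.mem_filter, Finset.mem_univ, true_and]
      have := (A.orderEmbOfFin hA).monotone (Finset.mem_Iic.1 hx)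
      rw [Fin.le_def] at this
      omega
    rw [Fin.card_Iic] at this
    omega
  · intro h
    have : (Finset.univ.filter fun x : Fin p => (A.orderEmbOfFin hA x : ℕ) < j).card ≤
        (Finset.Iio l).card := by
      refine Finset.card_le_card fun x hx => ?_
      simp only [Finset.mem_filter, Finset.mem_univ, true_and] at hx
      rw [Finset.mem_Iio]
      by_contra hlx
      have := (A.orderEmbOfFin hA).monotone (not_lt.1 hlx)
      rw [Fin.le_def] at this
      omega
    rwa [Fin.card_Iio] at this

/-! ### Families of singular simplices indexed by their vertices -/

section Family

variable {α β γ X Y Z : Type*} [TopologicalSpace X] [TopologicalSpace Y] [TopologicalSpace Z]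

/-- A family of singular simplices of `X`, one for each finite sequence in `α`, compatible with
all affine maps between simplices. -/
structure SimplexFamily (α X : Type*) [TopologicalSpace X] where
  /-- The simplex with the given vertices. -/
  map : ∀ n : ℕ, (Fin (n + 1) → α) → C(Simplex n, X)
  map_comp : ∀ {m n : ℕ} (k : Fin (m + 1) → Fin (n + 1)) (v : Fin (n + 1) → α),
    map m (v ∘ k) = (map n v).comp (aff k)

namespace SimplexFamily

/-- The affine simplices in the image of a singular simplex. -/
def ofSimplex {p : ℕ} (σ : C(Simplex p, X)) : SimplexFamily (Fin (p + 1)) X where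
  map _ v := σ.comp (aff v)
  map_comp k v := by rw [aff_comp, ContinuousMap.comp_assoc]

/-- The product of two families. -/
def prod (r : SimplexFamily α X) (r' : SimplexFamily β Y) : SimplexFamily (α × β) (X × Y) where
  map n v := (r.map n fun i => (v i).1).prodMk (r'.map n fun i => (v i).2)
  map_comp k v := by
    have h1 := r.map_comp k fun i => (v i).1
    have h2 := r'.map_comp k fun i => (v i).2
    simp only [Function.comp_def] at h1 h2 ⊢
    rw [h1, h2]
    rfl

/-- The image of a family under a continuous map. -/
def push (g : C(X, Y)) (r : SimplexFamily α X) : SimplexFamily α Y where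
  map n v := g.comp (r.map n v)
  map_comp k v := by rw [r.map_comp, ContinuousMap.comp_assoc]

/-- Reindexing a family. -/
def comap (f : β → α) (r : SimplexFamily α X) : SimplexFamily β X where
  map n v := r.map n (f ∘ v)
  map_comp k v := by rw [← r.map_comp, Function.comp_assoc]

/-- The singular chain of a chain of lists. -/
def realize (r : SimplexFamily α X) : ListChain α →ₗ[ℝ] Chain X :=
  Finsupp.linearCombination ℝ fun
    | [] => 0
    | a :: l => Finsupp.single ⟨l.length, r.map l.length (a :: l).get⟩ 1

@[simp] lemma realize_nil (r : SimplexFamily α X) (c : ℝ) :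
    r.realize (Finsupp.single [] c) = 0 := by
  simp [realize]

lemma realize_single (r : SimplexFamily α X) {n : ℕ} (l : List α) (h : l.length = n + 1) :
    r.realize (Finsupp.single l 1) =
      Finsupp.single ⟨n, r.map n fun i => l.get (i.cast h.symm)⟩ 1 := by
  rcases l with _ | ⟨a, l⟩
  · simp at h
  · obtain rfl : l.length = n := by simpa using h
    rw [realize, Finsupp.linearCombination_single, one_smul]
    rfl

lemma realize_ofFn (r : SimplexFamily α X) {n : ℕ} (v : Fin (n + 1) → α) :
    r.realize (Finsupp.single (List.ofFn v) 1) = Finsupp.single ⟨n, r.map n v⟩ 1 := by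
  rw [r.realize_single (n := n) (List.ofFn v) (List.length_ofFn)]
  congr 3
  funext i
  rw [List.get_ofFn]
  rfl

lemma realize_ofSimplex {p : ℕ} (σ : C(Simplex p, X)) :
    (ofSimplex σ).realize (Finsupp.single (List.ofFn id) 1) = Finsupp.single ⟨p, σ⟩ 1 := by
  rw [realize_ofFn]
  simp [ofSimplex, aff_id]

lemma exists_ofFn (a : α) (l : List α) :
    ∃ v : Fin (l.length + 1) → α, a :: l = List.ofFn v :=
  ⟨(a :: l).get, (List.ofFn_get (a :: l)).symm⟩

lemma push_realize (g : C(X, Y)) (r : SimplexFamily α X) (x : ListChain α) :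
    CocyclicChains.push g (r.realize x) = (push g r).realize x := by
  induction x using listChain_induction with
  | zero => simp
  | add x y hx hy => simp [hx, hy]
  | smul c x hx => simp [hx]
  | single l =>
    rcases l with _ | ⟨a, l⟩
    · simp
    · obtain ⟨v, hv⟩ := exists_ofFn a l
      rw [hv, realize_ofFn, realize_ofFn]
      simp [CocyclicChains.push, push]

lemma realize_mapL (f : β → α) (r : SimplexFamily α X) (x : ListChain β) :
    r.realize (mapL f x) = (comap f r).realize x := by
  induction x using listChain_induction with
  | zero => simp
  | add x y hx hy => simp [hx, hy]
  | smul c x hx => simp only [map_smul, hx]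
  | single l =>
    rcases l with _ | ⟨a, l⟩
    · simp
    · obtain ⟨v, hv⟩ := exists_ofFn a l
      rw [hv, mapL_single, List.map_ofFn, realize_ofFn, realize_ofFn]
      rfl

lemma listBd_ofFn {n : ℕ} (v : Fin (n + 1) → α) :
    listBd α (Finsupp.single (List.ofFn v) 1) =
      ∑ i : Fin (n + 1), (-1 : ℝ) ^ (i : ℕ) • Finsupp.single (List.ofFn (v ∘ i.succAbove)) 1 := by
  induction n with
  | zero => simp [List.ofFn_succ, listBd, listBd₀]
  | succ n ih =>
    rw [List.ofFn_succ, ← consL_single, listBd_consL, ih, Fin.sum_univ_succ (n := n + 1), map_sum,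
      sub_eq_add_neg, ← Finset.sum_neg_distrib]
    congr 1
    · simp [Function.comp_def]
    · refine Finset.sum_congr rfl fun i _ => ?_
      rw [map_smul, consL_single, Fin.val_succ, pow_succ, mul_neg_one, neg_smul,
        List.ofFn_succ (f := v ∘ i.succ.succAbove)]
      simp [Function.comp_def]

/-- Cofaces are affine, so the faces of a member of the family are again members. The augmentation
part of `listBd` disappears because `realize` kills the empty list. -/
lemma boundary_realize (r : SimplexFamily α X) (x : ListChain α) :
    boundary X (r.realize x) = r.realize (listBd α x) := by
  induction x using listChain_induction with
  | zero => simp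
  | add x y hx hy => simp [hx, hy]
  | smul c x hx => simp [hx]
  | single l =>
    rcases l with _ | ⟨a, l⟩
    · simp
    · obtain ⟨v, hv⟩ := exists_ofFn a l
      rw [hv, realize_ofFn]
      generalize l.length = n at v
      rw [listBd_ofFn, boundary, Finsupp.linearCombination_single, one_smul, map_sum]
      rcases n with _ | n
      · simp [simplexBoundary]
      · rw [simplexBoundary]
        refine Finset.sum_congr rfl fun i _ => ?_
        rw [map_smul, realize_ofFn, r.map_comp, coface_eq_aff]
        simp

lemma realize_word (r : SimplexFamily α X) (r' : SimplexFamily β Y) {p q : ℕ}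
    (v : ℕ → α) (w : ℕ → β) (A : Shuffle p q) :
    (r.prod r').realize
      (Finsupp.single (wordPath (fun i => decide (i ∈ A.1)) v w) 1) =
    Finsupp.single ⟨p + q, ((r.map p fun i => v i).prodMap (r'.map q fun i => w i)).comp
      (shuffleMap A)⟩ 1 := by
  have hA : A.1.card = p := A.2
  have hA' : A.1ᶜ.card = q := by rw [Finset.card_compl, A.2]; simp
  have bound : ∀ (B : Finset (Fin (p + q))) (j : ℕ),
      wordCount (fun i => decide (i ∈ B)) j < B.card + 1 := by
    intro B j
    rw [wordCount, ← Finset.card_filter, Nat.lt_succ_iff]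
    refine Finset.card_le_card fun i hi => ?_
    simp only [Finset.mem_filter, Finset.mem_univ, true_and, decide_eq_true_eq] at hi
    exact hi.1
  have hnot : (fun i => !(decide (i ∈ A.1))) = fun i => decide (i ∈ A.1ᶜ) := by
    funext i
    simp
  let k : Fin (p + q + 1) → Fin (p + 1) := fun j =>
    ⟨wordCount (fun i => decide (i ∈ A.1)) j, by have := bound A.1 j; omega⟩
  let k' : Fin (p + q + 1) → Fin (q + 1) := fun j =>
    ⟨wordCount (fun i => decide (i ∈ A.1ᶜ)) j, by have := bound A.1ᶜ j; omega⟩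
  rw [wordPath, realize_ofFn]
  congr 2
  have h1 := r.map_comp k fun i => v i
  have h2 := r'.map_comp k' fun i => w i
  rw [← restrictCoords_orderEmbOfFin A.1 hA k fun j => rfl] at h1
  rw [← restrictCoords_orderEmbOfFin A.1ᶜ hA' k' fun j => rfl] at h2
  simp only [prod, hnot]
  change ContinuousMap.prodMk (r.map _ ((fun i : Fin (p + 1) => v i) ∘ k))
    (r'.map _ ((fun i : Fin (q + 1) => w i) ∘ k')) = _
  rw [h1, h2]
  rfl

lemma wordNum_mem {n : ℕ} (A : Finset (Fin n)) : wordNum (fun i => decide (i ∈ A)) = A.card := by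
  simp [wordNum]

lemma wordSign_mem {n : ℕ} (A : Finset (Fin n)) :
    wordSign (fun i => decide (i ∈ A)) =
      (-1) ^ (Finset.univ.filter fun ij : Fin n × Fin n =>
        ij.1 < ij.2 ∧ ij.1 ∉ A ∧ ij.2 ∈ A).card := by
  rw [wordSign, Finset.card_filter, ← Finset.prod_pow_eq_pow_sum, Fintype.prod_prod_type]
  refine Finset.prod_congr rfl fun i _ => Finset.prod_congr rfl fun j _ => ?_
  simp only [decide_eq_false_iff_not, decide_eq_true_eq]
  split_ifs <;> simp

lemma sum_words {M : Type*} [AddCommMonoid M] (p q : ℕ) (f : (Fin (p + q) → Bool) → M) :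
    (∑ a, if wordNum a = p then f a else 0) =
      ∑ A : Shuffle p q, f fun i => decide (i ∈ A.1) := by
  rw [← Finset.sum_filter]
  symm
  refine Finset.sum_bij (fun A _ i => decide (i ∈ A.1)) (fun A _ => ?_) (fun A _ B _ h => ?_)
    (fun a ha => ?_) fun A _ => rfl
  · rw [Finset.mem_filter, wordNum_mem]
    exact ⟨Finset.mem_univ _, A.2⟩
  · ext i
    simpa using congrFun h i
  · rw [Finset.mem_filter] at ha
    have h : (fun i => decide (i ∈ Finset.univ.filter fun i => a i = true)) = a := by
      funext i
      simp
    refine ⟨⟨Finset.univ.filter fun i => a i = true, ?_⟩, Finset.mem_univ _, h⟩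
    rw [← wordNum_mem, h]
    exact ha.2

/-- The bridge from lists to singular chains: words with p letters `true` are shuffles, with the
same sign, and their paths give the two projections of `shuffleMap`. -/
lemma cross_realize (r : SimplexFamily α X) (r' : SimplexFamily β Y) (x : ListChain α)
    (y : ListChain β) :
    cross (r.realize x) (r'.realize y) = (r.prod r').realize (shuffleL α β x y) := by
  induction x using listChain_induction with
  | zero => simp
  | add x y hx hy => simp [hx, hy]
  | smul c x hx => simp [hx]
  | single l =>
  induction y using listChain_induction with
  | zero => simp
  | add x y hx hy => simp [hx, hy]
  | smul c x hx => simp [hx]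
  | single m =>
  rcases l with _ | ⟨a, l⟩
  · simp
  rcases m with _ | ⟨b, m⟩
  · simp
  obtain ⟨v, hv⟩ := exists_ofFn a l
  obtain ⟨w, hw⟩ := exists_ofFn b m
  -- The extension of the vertices to all of ℕ is arbitrary; only the values on `Fin` enter.
  obtain ⟨v', rfl⟩ : ∃ v' : ℕ → α, v = fun i : Fin _ => v' i :=
    ⟨fun j => v (Fin.ofNat (l.length + 1) j), by funext i; simp⟩
  obtain ⟨w', rfl⟩ : ∃ w' : ℕ → β, w = fun i : Fin _ => w' i :=
    ⟨fun j => w (Fin.ofNat (m.length + 1) j), by funext i; simp⟩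
  rw [hv, hw]
  rw [shuffleL_ofFn _ _ _ rfl, sum_words, realize_ofFn, realize_ofFn, map_sum]
  simp only [cross, Finsupp.linearCombination_single, one_smul, simplexCross]
  refine Finset.sum_congr rfl fun A _ => ?_
  rw [map_smul, realize_word, wordSign_mem, Finsupp.smul_single, smul_eq_mul, mul_one]
  rfl

end SimplexFamily

end Family

end CocyclicChains

end

noncomputable section

namespace CocyclicChains

/-! ### Properties of the cross product -/

section CrossProduct

variable {X Y Z X' Y' : Type*} [TopologicalSpace X] [TopologicalSpace Y] [TopologicalSpace Z]
  [TopologicalSpace X'] [TopologicalSpace Y']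

@[elab_as_elim]
lemma chain_induction {P : Chain X → Prop} (zero : P 0)
    (add : ∀ x y, P x → P y → P (x + y)) (smul : ∀ (c : ℝ) x, P x → P (c • x))
    (single : ∀ (p : ℕ) (σ : C(Simplex p, X)), P (Finsupp.single ⟨p, σ⟩ 1)) (x : Chain X) :
    P x := by
  induction x using Finsupp.induction_linear with
  | zero => exact zero
  | add x y hx hy => exact add _ _ hx hy
  | single s r =>
    rw [← mul_one r, ← smul_eq_mul, ← Finsupp.smul_single]
    exact smul _ _ (single s.1 s.2)

@[simp] lemma push_single (g : C(X, Y)) (p : ℕ) (σ : C(Simplex p, X)) (c : ℝ) :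
    push g (Finsupp.single ⟨p, σ⟩ c) = Finsupp.single ⟨p, g.comp σ⟩ c := by
  simp [push]

lemma push_push (g : C(Y, Z)) (f : C(X, Y)) (a : Chain X) :
    push g (push f a) = push (g.comp f) a := by
  induction a using chain_induction with
  | zero => simp
  | add x y hx hy => simp [hx, hy]
  | smul c x hx => simp [hx]
  | single p σ => simp [ContinuousMap.comp_assoc]

@[simp] lemma push_id (a : Chain X) : push (ContinuousMap.id X) a = a := by
  induction a using chain_induction with
  | zero => simp
  | add x y hx hy => simp [hx, hy]
  | smul c x hx => simp [hx]
  | single p σ => simp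

lemma parity_single (p : ℕ) (σ : C(Simplex p, X)) :
    parity X (Finsupp.single ⟨p, σ⟩ 1) = (-1 : ℝ) ^ p • Finsupp.single ⟨p, σ⟩ 1 := by
  rw [parity, Finsupp.linearCombination_single, one_smul, Finsupp.smul_single, smul_eq_mul, mul_one]

@[simp] lemma parity_parity (a : Chain X) : parity X (parity X a) = a := by
  induction a using chain_induction with
  | zero => simp
  | add x y hx hy => simp [hx, hy]
  | smul c x hx => simp only [map_smul, hx]
  | single p σ => rw [parity_single, map_smul, parity_single, smul_smul, neg_one_pow_mul_self,
      one_smul]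

lemma parity_push (g : C(X, Y)) (a : Chain X) : parity Y (push g a) = push g (parity X a) := by
  induction a using chain_induction with
  | zero => simp
  | add x y hx hy => simp [hx, hy]
  | smul c x hx => simp only [map_smul, hx]
  | single p σ => rw [parity_single, map_smul, push_single, parity_single]

lemma boundary_single_zero (σ : C(Simplex 0, X)) (c : ℝ) :
    boundary X (Finsupp.single ⟨0, σ⟩ c) = 0 := by
  simp [boundary, simplexBoundary]

lemma boundary_single_succ (p : ℕ) (σ : C(Simplex (p + 1), X)) :
    boundary X (Finsupp.single ⟨p + 1, σ⟩ 1) =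
      ∑ i : Fin (p + 2), (-1 : ℝ) ^ (i : ℕ) • Finsupp.single ⟨p, σ.comp (coface i)⟩ 1 := by
  simp [boundary, simplexBoundary]

lemma boundary_push (g : C(X, Y)) (a : Chain X) :
    boundary Y (push g a) = push g (boundary X a) := by
  induction a using chain_induction with
  | zero => simp
  | add x y hx hy => simp [hx, hy]
  | smul c x hx => simp only [map_smul, hx]
  | single p σ =>
    rcases p with _ | p
    · simp [boundary_single_zero]
    · rw [push_single, boundary_single_succ, boundary_single_succ, map_sum]
      simp only [map_smul, push_single, ContinuousMap.comp_assoc]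

lemma boundary_parity (a : Chain X) : boundary X (parity X a) = - parity X (boundary X a) := by
  induction a using chain_induction with
  | zero => simp
  | add x y hx hy => simp only [map_add, hx, hy]; abel
  | smul c x hx => simp only [map_smul, hx, smul_neg]
  | single p σ =>
    rw [parity_single, map_smul]
    rcases p with _ | p
    · simp [boundary_single_zero]
    · simp only [boundary_single_succ, map_sum, map_smul, parity_single, Finset.smul_sum, smul_smul,
        ← Finset.sum_neg_distrib, ← neg_smul]
      refine Finset.sum_congr rfl fun i _ => ?_
      congr 1
      ring

lemma boundary_boundary (a : Chain X) : boundary X (boundary X a) = 0 := by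
  induction a using chain_induction with
  | zero => simp
  | add x y hx hy => simp [hx, hy]
  | smul c x hx => simp [hx]
  | single p σ =>
    rw [← SimplexFamily.realize_ofSimplex, SimplexFamily.boundary_realize,
      SimplexFamily.boundary_realize, listBd_listBd, map_zero]

lemma cross_push (f : C(X, X')) (g : C(Y, Y')) (a : Chain X) (b : Chain Y) :
    cross (push f a) (push g b) = push (f.prodMap g) (cross a b) := by
  induction a using chain_induction with
  | zero => simp
  | add x y hx hy => simp [hx, hy]
  | smul c x hx => simp [hx]
  | single p σ =>
  induction b using chain_induction with
  | zero => simp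
  | add x y hx hy => simp only [map_add, hx, hy]
  | smul c x hx => simp only [map_smul, hx]
  | single q τ =>
    simp only [push_single, cross, Finsupp.linearCombination_single, one_smul, simplexCross,
      map_sum]
    refine Finset.sum_congr rfl fun A _ => ?_
    rfl

lemma cross_push_left (f : C(X, X')) (a : Chain X) (b : Chain Y) :
    cross (push f a) b = push (f.prodMap (ContinuousMap.id Y)) (cross a b) := by
  rw [← cross_push, push_id]

lemma cross_push_right (g : C(Y, Y')) (a : Chain X) (b : Chain Y) :
    cross a (push g b) = push ((ContinuousMap.id X).prodMap g) (cross a b) := by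
  rw [← cross_push, push_id]

lemma parity_cross (a : Chain X) (b : Chain Y) :
    parity _ (cross a b) = cross (parity X a) (parity Y b) := by
  induction a using chain_induction with
  | zero => simp
  | add x y hx hy => simp [hx, hy]
  | smul c x hx => simp only [map_smul, LinearMap.smul_apply, hx]
  | single p σ =>
  induction b using chain_induction with
  | zero => simp
  | add x y hx hy => simp [hx, hy]
  | smul c x hx => simp only [map_smul, hx]
  | single q τ =>
    rw [parity_single, parity_single, map_smul, map_smul, LinearMap.smul_apply]
    simp only [cross, Finsupp.linearCombination_single, one_smul, simplexCross, map_sum,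
      Finset.smul_sum]
    refine Finset.sum_congr rfl fun A _ => ?_
    rw [← mul_one (shuffleSign A), ← smul_eq_mul, ← Finsupp.smul_single, map_smul, parity_single,
      pow_add, smul_smul, smul_smul, smul_smul]
    congr 1
    ring

lemma length_ofFn_succ {α : Type*} {p : ℕ} (v : Fin (p + 1) → α) :
    ∃ a l, List.ofFn v = a :: l ∧ l.length = p :=
  ⟨v 0, List.ofFn fun i => v i.succ, List.ofFn_succ, by simp⟩

/-- The Leibniz rule for the simplicial cross product. -/
lemma boundary_cross (a : Chain X) (b : Chain Y) :
    boundary _ (cross a b) = cross (boundary X a) b + cross (parity X a) (boundary Y b) := by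
  induction a using chain_induction with
  | zero => simp
  | add x y hx hy => simp only [map_add, LinearMap.add_apply, hx, hy]; abel
  | smul c x hx => simp only [map_smul, LinearMap.smul_apply, hx, smul_add]
  | single p σ =>
  induction b using chain_induction with
  | zero => simp
  | add x y hx hy => simp only [map_add, hx, hy]; abel
  | smul c x hx => simp only [map_smul, hx, smul_add]
  | single q τ =>
    rw [parity_single, ← SimplexFamily.realize_ofSimplex σ, ← SimplexFamily.realize_ofSimplex τ,
      map_smul, LinearMap.smul_apply]
    simp only [SimplexFamily.boundary_realize, SimplexFamily.cross_realize]
    obtain ⟨a, l, h1, hl⟩ := length_ofFn_succ (id : Fin (p + 1) → _)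
    obtain ⟨b, m, h2, hm⟩ := length_ofFn_succ (id : Fin (q + 1) → _)
    rw [h1, h2, listBd_shuffleL_cons, hl, map_add, map_add, map_smul, nilPair_apply,
      SimplexFamily.realize_nil, add_zero]

/-- The associativity homeomorphism of products. -/
def prodAssocMap (X Y Z : Type*) [TopologicalSpace X] [TopologicalSpace Y] [TopologicalSpace Z] :
    C((X × Y) × Z, X × Y × Z) :=
  ⟨fun w => (w.1.1, w.1.2, w.2), by fun_prop⟩

/-- A singular simplex realizes the list of all its vertices, so associativity of the list product
carries over. -/
lemma cross_assoc (a : Chain X) (b : Chain Y) (c : Chain Z) :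
    push (prodAssocMap X Y Z) (cross (cross a b) c) =
      cross a (cross b c) := by
  induction a using chain_induction with
  | zero => simp
  | add x y hx hy => simp [hx, hy]
  | smul c x hx => simp only [map_smul, LinearMap.smul_apply, hx]
  | single p σ =>
  induction b using chain_induction with
  | zero => simp
  | add x y hx hy => simp [hx, hy]
  | smul c x hx => simp only [map_smul, LinearMap.smul_apply, hx]
  | single q τ =>
  induction c using chain_induction with
  | zero => simp
  | add x y hx hy => simp [hx, hy]
  | smul c x hx => simp only [map_smul, hx]
  | single r ρ =>
    rw [← SimplexFamily.realize_ofSimplex σ, ← SimplexFamily.realize_ofSimplex τ,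
      ← SimplexFamily.realize_ofSimplex ρ]
    simp only [SimplexFamily.cross_realize, SimplexFamily.push_realize]
    rw [← mapL_shuffleL_assoc, SimplexFamily.realize_mapL]
    rfl

lemma cross_comm_single (p : ℕ) (σ : C(Simplex p, X)) (q : ℕ) (τ : C(Simplex q, Y)) :
    push ContinuousMap.prodSwap
      (cross (Finsupp.single ⟨p, σ⟩ 1) (Finsupp.single ⟨q, τ⟩ 1)) =
      (-1 : ℝ) ^ (p * q) • cross (Finsupp.single ⟨q, τ⟩ 1) (Finsupp.single ⟨p, σ⟩ 1) := by
  rw [← SimplexFamily.realize_ofSimplex σ, ← SimplexFamily.realize_ofSimplex τ]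
  simp only [SimplexFamily.cross_realize, SimplexFamily.push_realize]
  obtain ⟨a, l, h1, hl⟩ := length_ofFn_succ (id : Fin (p + 1) → _)
  obtain ⟨b, m, h2, hm⟩ := length_ofFn_succ (id : Fin (q + 1) → _)
  have h := mapL_shuffleL_swap a l b m
  rw [hl, hm] at h
  rw [h1, h2, ← map_smul, ← h, SimplexFamily.realize_mapL]
  rfl

lemma cross_fundCycle_comm (a : Chain X) :
    push ContinuousMap.prodSwap (cross fundCycle a) = cross (parity X a) fundCycle := by
  induction a using chain_induction with
  | zero => simp
  | add x y hx hy => simp [hx, hy]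
  | smul c x hx => simp only [map_smul, LinearMap.smul_apply, hx]
  | single p σ =>
    rw [fundCycle, cross_comm_single, parity_single, one_mul, map_smul, LinearMap.smul_apply]

/-! ### Products with points and the prism operator -/

/-- The point of `Δ^0`. -/
def simplexPoint : Simplex 0 := ⟨fun i => i.elim0, fun i => i.elim0, fun i => i.elim0⟩

instance : Subsingleton (Simplex 0) := ⟨fun _ _ => Subtype.ext (funext fun i => i.elim0)⟩

/-- The inclusion of a slice `X × {y}`. -/
def slice (X : Type*) [TopologicalSpace X] (y : Y) : C(X, X × Y) :=
  (ContinuousMap.id X).prodMk (ContinuousMap.const X y)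

/-- With a one-letter second list there are only steps in the first factor, hence a single path. -/
lemma mapL_fst_shuffleL {α β : Type*} (b : β) (x : List α) :
    mapL Prod.fst (shuffleL α β (Finsupp.single x 1) (Finsupp.single [b] 1)) =
      if x = [] then 0 else Finsupp.single x 1 := by
  induction x with
  | nil => simp
  | cons a l ih =>
    rw [shuffleL_cons, mapL_consL]
    simp only [map_add (mapL _), ih, nilPair_apply]
    cases l <;> simp

lemma cross_point (a : Chain X) (τ : C(Simplex 0, Y)) :
    cross a (Finsupp.single ⟨0, τ⟩ 1) = push (slice X (τ simplexPoint)) a := by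
  induction a using chain_induction with
  | zero => simp
  | add x y hx hy => simp [hx, hy]
  | smul c x hx => simp only [map_smul, LinearMap.smul_apply, hx]
  | single p σ =>
    rw [← SimplexFamily.realize_ofSimplex σ, ← SimplexFamily.realize_ofSimplex τ,
      SimplexFamily.cross_realize, SimplexFamily.push_realize]
    have h : (SimplexFamily.ofSimplex σ).prod (SimplexFamily.ofSimplex τ) =
        SimplexFamily.comap Prod.fst
          (SimplexFamily.push (slice X (τ simplexPoint)) (SimplexFamily.ofSimplex σ)) := by
      simp only [SimplexFamily.prod, SimplexFamily.comap, SimplexFamily.push,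
        SimplexFamily.ofSimplex, SimplexFamily.mk.injEq]
      funext n v
      ext1 t
      refine Prod.ext rfl ?_
      change τ _ = τ _
      exact congrArg τ (Subsingleton.elim _ _)
    rw [h, ← SimplexFamily.realize_mapL, List.ofFn_succ (n := 0), List.ofFn_zero,
      mapL_fst_shuffleL, if_neg (by simp)]

/-- The fundamental chain of the interval `Δ^1`. -/
def intervalChain : Chain (Simplex 1) := Finsupp.single ⟨1, ContinuousMap.id _⟩ 1

/-- The end points of `Δ^1`. -/
def endpoint (i : Fin 2) : Simplex 1 := coface i simplexPoint

lemma boundary_intervalChain : boundary _ intervalChain =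
    Finsupp.single ⟨0, coface 0⟩ 1 - Finsupp.single ⟨0, coface 1⟩ 1 := by
  rw [intervalChain, boundary_single_succ]
  simp [Fin.sum_univ_succ, sub_eq_add_neg]

/-- The chain homotopy induced by a homotopy. -/
def prism (H : C(X × Simplex 1, Y)) : Chain X →ₗ[ℝ] Chain Y :=
  push H ∘ₗ cross.flip intervalChain ∘ₗ parity X

lemma prism_apply (H : C(X × Simplex 1, Y)) (a : Chain X) :
    prism H a = push H (cross (parity X a) intervalChain) := rfl

/-- The parity in `prism` makes the two terms containing the boundary of `a` cancel. In this model
δ_0 gives the end 0 and δ_1 the end 1, so the boundary of the interval is end 0 minus end 1. -/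
lemma boundary_prism (H : C(X × Simplex 1, Y)) (a : Chain X) :
    boundary Y (prism H a) + prism H (boundary X a) =
      push (H.comp (slice X (endpoint 0))) a - push (H.comp (slice X (endpoint 1))) a := by
  rw [prism_apply, prism_apply, boundary_push, boundary_cross, boundary_parity, parity_parity,
    boundary_intervalChain, map_sub, cross_point, cross_point, ← push_push, ← push_push]
  simp only [map_add, map_neg, map_sub, LinearMap.neg_apply, endpoint]
  abel

end CrossProduct

/-! ### Degrees -/

section Degrees

variable {X Y Z : Type*} [TopologicalSpace X] [TopologicalSpace Y] [TopologicalSpace Z]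

lemma single_mem_chainPiece {n : ℤ} {p : ℕ} (σ : C(Simplex p, X)) (h : (p : ℤ) = n) (c : ℝ) :
    Finsupp.single ⟨p, σ⟩ c ∈ chainPiece X n :=
  Finsupp.single_mem_supported ℝ c h

lemma map_mem_of_mem_chainPiece {M : Type*} [AddCommGroup M] [Module ℝ M] {n : ℤ}
    (f : Chain X →ₗ[ℝ] M) (P : Submodule ℝ M)
    (h : ∀ (p : ℕ) (σ : C(Simplex p, X)), (p : ℤ) = n → f (Finsupp.single ⟨p, σ⟩ 1) ∈ P)
    {a : Chain X} (ha : a ∈ chainPiece X n) : f a ∈ P := by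
  have : chainPiece X n ≤ P.comap f := by
    rw [chainPiece, Finsupp.supported_eq_span_single, Submodule.span_le]
    rintro _ ⟨⟨p, σ⟩, hp, rfl⟩
    exact h p σ hp
  exact this ha

lemma push_mem_chainPiece (g : C(X, Y)) {n : ℤ} {a : Chain X} (ha : a ∈ chainPiece X n) :
    push g a ∈ chainPiece Y n :=
  map_mem_of_mem_chainPiece _ _ (fun p σ hp => by
    rw [push_single]; exact single_mem_chainPiece _ hp _) ha

lemma parity_mem_chainPiece {n : ℤ} {a : Chain X} (ha : a ∈ chainPiece X n) :
    parity X a ∈ chainPiece X n :=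
  map_mem_of_mem_chainPiece _ _ (fun p σ hp => by
    rw [parity_single]; exact Submodule.smul_mem _ _ (single_mem_chainPiece _ hp _)) ha

lemma boundary_mem_chainPiece {n : ℤ} {a : Chain X} (ha : a ∈ chainPiece X n) :
    boundary X a ∈ chainPiece X (n - 1) :=
  map_mem_of_mem_chainPiece _ _ (fun p σ hp => by
    rcases p with _ | p
    · rw [boundary_single_zero]; exact Submodule.zero_mem _
    · rw [boundary_single_succ]
      refine Submodule.sum_mem _ fun i _ => Submodule.smul_mem _ _ (single_mem_chainPiece _ ?_ _)
      rw [← hp]; push_cast; ring) ha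

lemma cross_mem_chainPiece {m n : ℤ} {a : Chain X} {b : Chain Y} (ha : a ∈ chainPiece X m)
    (hb : b ∈ chainPiece Y n) : cross a b ∈ chainPiece (X × Y) (m + n) := by
  refine map_mem_of_mem_chainPiece (cross.flip b) _ (fun p σ hp => ?_) ha
  refine map_mem_of_mem_chainPiece (cross (Finsupp.single ⟨p, σ⟩ 1)) _ (fun q τ hq => ?_) hb
  simp only [cross, Finsupp.linearCombination_single, one_smul, simplexCross]
  refine Submodule.sum_mem _ fun A _ => single_mem_chainPiece _ ?_ _
  push_cast
  rw [hp, hq]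

lemma intervalChain_mem : intervalChain ∈ chainPiece (Simplex 1) 1 :=
  single_mem_chainPiece _ (by simp) _

lemma prism_mem_chainPiece (H : C(X × Simplex 1, Y)) {n : ℤ} {a : Chain X}
    (ha : a ∈ chainPiece X n) : prism H a ∈ chainPiece Y (n + 1) :=
  push_mem_chainPiece _ (cross_mem_chainPiece (parity_mem_chainPiece ha) intervalChain_mem)

lemma fundCycle_mem : fundCycle ∈ chainPiece UnitAddCircle 1 :=
  single_mem_chainPiece _ (by simp) _

/-- The ends 0 and 1 of the interval coincide in ℝ/ℤ. -/
lemma boundary_fundCycle : boundary _ fundCycle = 0 := by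
  rw [fundCycle, boundary_single_succ]
  have h : ∀ f g : C(Simplex 0, UnitAddCircle), f simplexPoint = g simplexPoint → f = g :=
    fun f g h => ContinuousMap.ext fun t => by
      rw [Subsingleton.elim t simplexPoint]; exact h
  simp only [Fin.sum_univ_succ, Fin.val_zero, pow_zero, one_smul, Fin.val_succ, zero_add, pow_one,
    neg_smul, Finset.univ_eq_empty, Finset.sum_empty, add_zero]
  rw [add_neg_eq_zero]
  congr 2
  refine h _ _ ?_
  change (((coface 0 simplexPoint).1 0 : ℝ) : UnitAddCircle) =
    (((coface 1 simplexPoint).1 0 : ℝ) : UnitAddCircle)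
  simpa [coface, coord] using (AddCircle.coe_period (1 : ℝ)).symm

end Degrees

end CocyclicChains

end

noncomputable section

namespace CocyclicChains

/-! ### The cocyclic identities -/

section Coordinates

lemma coord_coface {k : ℕ} (i : Fin (k + 2)) (t : Simplex k) (c : ℕ) :
    coord (coface i t) c = coord t (if c ≤ i then c else c - 1) := by
  rcases c with _ | c
  · simp [coord_zero]
  by_cases hc : c < k + 1
  · rw [coord_succ _ hc]
    rfl
  · rw [coord_of_lt _ (by omega), if_neg (by omega), coord_of_lt _ (by omega)]

lemma coord_codegen {k : ℕ} (i : Fin (k + 1)) (t : Simplex (k + 1)) (c : ℕ) :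
    coord (codegen i t) c = coord t (if c ≤ i then c else c + 1) := by
  rcases c with _ | c
  · simp [coord_zero]
  by_cases hc : c < k
  · rw [coord_succ _ hc]
    change t.1 (i.succAbove ⟨c, hc⟩) = _
    by_cases h : c + 1 ≤ (i : ℕ)
    · rw [if_pos h, coord_succ _ (by omega), Fin.succAbove_of_castSucc_lt i ⟨c, hc⟩ (Fin.lt_def.2 h)]
      rfl
    · rw [if_neg h, coord_succ _ (by omega), Fin.succAbove_of_le_castSucc i ⟨c, hc⟩
        (Fin.le_def.2 (by simpa using h))]
      rfl
  · rw [coord_of_lt _ (by omega), coord_of_lt _ (by split_ifs <;> omega)]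

lemma coord_cyc {k : ℕ} (t : Simplex k) {c : ℕ} (hc : c ≤ k) :
    coord (cyc k t) c = coord t (c + 1) - coord t 1 := by
  rcases c with _ | c
  · simp [coord_zero]
  · rw [coord_succ _ hc]
    rfl

/-- The coordinates of a point of a simplex, extended so that shifting the index by `k + 1` adds
`1`. -/
def extCoord {k : ℕ} (t : Simplex k) (m : ℕ) : ℝ := coord t (m % (k + 1)) + (m / (k + 1) : ℕ)

lemma extCoord_of_le {k : ℕ} (t : Simplex k) {m : ℕ} (h : m ≤ k + 1) :
    extCoord t m = coord t m := by
  rcases h.lt_or_eq with h | rfl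
  · rw [extCoord, Nat.mod_eq_of_lt h, Nat.div_eq_of_lt h]
    simp
  · rw [extCoord, Nat.mod_self, Nat.div_self (Nat.succ_pos _), coord_zero,
      coord_of_lt _ (Nat.lt_succ_self _)]
    simp

lemma extCoord_add {k : ℕ} (t : Simplex k) (m : ℕ) :
    extCoord t (m + (k + 1)) = extCoord t m + 1 := by
  rw [extCoord, extCoord, Nat.add_mod_right, Nat.add_div_right _ (Nat.succ_pos _)]
  push_cast
  ring

/-- In these coordinates τ_k is a shift of the index followed by subtraction of t_1, with no
exceptional last coordinate, so that iterates are easy to compute. -/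
lemma extCoord_cyc {k : ℕ} (t : Simplex k) (m : ℕ) :
    extCoord (cyc k t) m = extCoord t (m + 1) - extCoord t 1 := by
  have key : ∀ r q : ℕ, r < k + 1 → extCoord (cyc k t) (r + q * (k + 1)) =
      extCoord t (r + q * (k + 1) + 1) - extCoord t 1 := by
    intro r q hr
    induction q with
    | zero =>
      rw [zero_mul, add_zero, extCoord_of_le _ hr.le, extCoord_of_le _ (by omega),
        extCoord_of_le _ (by omega), coord_cyc _ (by omega)]
    | succ q ih =>
      rw [add_mul, one_mul, ← add_assoc, extCoord_add, ih, add_right_comm _ (k + 1) 1,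
        extCoord_add]
      ring
  have := key (m % (k + 1)) (m / (k + 1)) (Nat.mod_lt _ (Nat.succ_pos _))
  rwa [mul_comm, Nat.mod_add_div] at this

end Coordinates

/-! ### Cocyclic identities for the maps of X × Δ^k -/

section Spaces

variable {X : Type*} [TopologicalSpace X]

/-- The coface on `X × Δ^k`. -/
abbrev cofaceMap (X : Type*) [TopologicalSpace X] {k : ℕ} (i : Fin (k + 2)) :
    C(X × Simplex k, X × Simplex (k + 1)) :=
  (ContinuousMap.id X).prodMap (coface i)

/-- The codegeneracy on `X × Δ^{k+1}`. -/
abbrev codegenMap (X : Type*) [TopologicalSpace X] {k : ℕ} (i : Fin (k + 1)) :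
    C(X × Simplex (k + 1), X × Simplex k) :=
  (ContinuousMap.id X).prodMap (codegen i)

lemma space_ext {A : Type*} [TopologicalSpace A] {k : ℕ} {f g : C(A, X × Simplex k)}
    (h₁ : ∀ a, (f a).1 = (g a).1)
    (h₂ : ∀ a, ∀ j < k, coord (f a).2 (j + 1) = coord (g a).2 (j + 1)) : f = g :=
  ContinuousMap.ext fun a => Prod.ext (h₁ a) (simplex_ext (h₂ a))

lemma codegen_coface_of_lt {k : ℕ} (j : Fin (k + 2)) (i : Fin (k + 3)) (h : (i : ℕ) < j) :
    (codegenMap X j).comp (cofaceMap X i) =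
      (cofaceMap X (⟨i, by omega⟩ : Fin (k + 2))).comp
        (codegenMap X (⟨j - 1, by omega⟩ : Fin (k + 1))) := by
  refine space_ext (fun a => rfl) fun a c hc => ?_
  change coord (codegen j (coface i a.2)) _ = coord (coface _ (codegen _ a.2)) _
  rw [coord_codegen, coord_coface, coord_coface, coord_codegen]
  congr 1
  simp only
  split_ifs <;> omega

lemma codegen_coface_of_gt {k : ℕ} (j : Fin (k + 2)) (i : Fin (k + 3)) (h : (j : ℕ) + 1 < i) :
    (codegenMap X j).comp (cofaceMap X i) =
      (cofaceMap X (⟨i - 1, by omega⟩ : Fin (k + 2))).comp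
        (codegenMap X (⟨j, by omega⟩ : Fin (k + 1))) := by
  refine space_ext (fun a => rfl) fun a c hc => ?_
  change coord (codegen j (coface i a.2)) _ = coord (coface _ (codegen _ a.2)) _
  rw [coord_codegen, coord_coface, coord_coface, coord_codegen]
  congr 1
  simp only
  split_ifs <;> omega

lemma codegen_coface_self {k : ℕ} (j : Fin (k + 1)) (i : Fin (k + 2))
    (h : (i : ℕ) = j ∨ (i : ℕ) = j + 1) :
    (codegenMap X j).comp (cofaceMap X i) = ContinuousMap.id _ := by
  refine space_ext (fun a => rfl) fun a c hc => ?_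
  change coord (codegen j (coface i a.2)) _ = coord a.2 _
  rw [coord_codegen, coord_coface]
  congr 1
  split_ifs <;> omega

variable [AddAction UnitAddCircle X] [ContinuousVAdd UnitAddCircle X]

/-- The extra codegeneracy `σ_k τ_{k+1}`, forgetting the base point. -/
def extraMap (X : Type*) [TopologicalSpace X] [AddAction UnitAddCircle X]
    [ContinuousVAdd UnitAddCircle X] (k : ℕ) : C(X × Simplex (k + 1), X × Simplex k) :=
  (codegenMap X (Fin.last k)).comp (cycSpace X (k + 1))

lemma cycSpace_fst {k : ℕ} (z : X × Simplex k) :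
    (cycSpace X k z).1 = ((coord z.2 1 : ℝ) : UnitAddCircle) +ᵥ z.1 := rfl

lemma cycSpace_snd {k : ℕ} (z : X × Simplex k) : (cycSpace X k z).2 = cyc k z.2 := rfl

lemma coord_extraMap {k : ℕ} (z : X × Simplex (k + 1)) {c : ℕ} (hc : c ≤ k) :
    coord (extraMap X k z).2 c = coord z.2 (c + 1) - coord z.2 1 := by
  change coord (codegen (Fin.last k) (cyc (k + 1) z.2)) c = _
  rw [coord_codegen, if_pos (by simpa using hc), coord_cyc _ (by omega)]

lemma cyc_coface_zero (k : ℕ) :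
    (cycSpace X (k + 1)).comp (cofaceMap X (0 : Fin (k + 2))) = cofaceMap X (Fin.last (k + 1)) := by
  refine space_ext (fun a => ?_) fun a c hc => ?_
  · change ((coord (coface 0 a.2) 1 : ℝ) : UnitAddCircle) +ᵥ a.1 = a.1
    rw [coord_coface]
    simp [coord_zero]
  · change coord (cyc (k + 1) (coface 0 a.2)) _ = coord (coface _ a.2) _
    rw [coord_cyc _ (by omega)]
    simp only [coord_coface]
    rw [if_neg (by simp), if_neg (by simp), if_pos (by simp; omega)]
    simp [coord_zero]

lemma cyc_coface_succ (k : ℕ) (i : Fin (k + 1)) :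
    (cycSpace X (k + 1)).comp (cofaceMap X i.succ) =
      (cofaceMap X i.castSucc).comp (cycSpace X k) := by
  refine space_ext (fun a => ?_) fun a c hc => ?_
  · change ((coord (coface i.succ a.2) 1 : ℝ) : UnitAddCircle) +ᵥ a.1 =
      ((coord a.2 1 : ℝ) : UnitAddCircle) +ᵥ a.1
    rw [coord_coface, if_pos (by simp)]
  · change coord (cyc (k + 1) (coface i.succ a.2)) _ = coord (coface _ (cyc k a.2)) _
    rw [coord_cyc _ (by omega)]
    simp only [coord_coface, Fin.val_succ, Fin.val_castSucc]
    rw [coord_cyc _ (by split_ifs <;> omega)]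
    congr 2
    split_ifs <;> omega

/-- This and the next identity make the extra codegeneracy a contraction of the complex of cofaces
without the last one. -/
lemma extra_coface_zero (k : ℕ) :
    (extraMap X k).comp (cofaceMap X (0 : Fin (k + 2))) = ContinuousMap.id _ := by
  rw [extraMap, ContinuousMap.comp_assoc, cyc_coface_zero]
  exact codegen_coface_self _ _ (by simp)

lemma extra_coface_succ (k : ℕ) (i : Fin (k + 1)) :
    (extraMap X (k + 1)).comp (cofaceMap X i.succ.castSucc) =
      (cofaceMap X i.castSucc).comp (extraMap X k) := by
  refine space_ext (fun a => ?_) fun a c hc => ?_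
  · change ((coord (coface i.succ.castSucc a.2) 1 : ℝ) : UnitAddCircle) +ᵥ a.1 =
      ((coord a.2 1 : ℝ) : UnitAddCircle) +ᵥ a.1
    rw [coord_coface, if_pos (by simp)]
  · rw [ContinuousMap.comp_apply, coord_extraMap _ (by omega)]
    change coord (coface _ a.2) _ - coord (coface _ a.2) _ = coord (coface _ (extraMap X k a).2) _
    simp only [coord_coface, Fin.val_succ, Fin.val_castSucc]
    rw [coord_extraMap _ (by split_ifs <;> omega)]
    congr 2
    split_ifs <;> omega

/-- Both sides rotate by t_1 + (t_2 - t_1) = t_2. As σ_0 appears on the right, sλ vanishes on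
normalized chains. -/
lemma extra_cyc (k : ℕ) :
    (extraMap X k).comp (cycSpace X (k + 1)) =
      (cycSpace X k).comp (codegenMap X (0 : Fin (k + 1))) := by
  refine space_ext (fun a => ?_) fun a c hc => ?_
  · change ((coord (cyc _ a.2) 1 : ℝ) : UnitAddCircle) +ᵥ (((coord a.2 1 : ℝ) : UnitAddCircle) +ᵥ a.1)
      = ((coord (codegen 0 a.2) 1 : ℝ) : UnitAddCircle) +ᵥ a.1
    rw [vadd_vadd, ← AddCircle.coe_add, coord_cyc _ (by omega), coord_codegen]
    simp
  · rw [ContinuousMap.comp_apply, coord_extraMap _ (by omega)]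
    change coord (cyc _ a.2) _ - coord (cyc _ a.2) _ = coord (cyc _ (codegen 0 a.2)) _
    rw [coord_cyc _ (by omega), coord_cyc _ (by omega), coord_cyc _ (by omega), coord_codegen,
      coord_codegen]
    simp

lemma codegen_cyc (k : ℕ) (i : Fin k) :
    (codegenMap X i.castSucc).comp (cycSpace X (k + 1)) =
      (cycSpace X k).comp (codegenMap X i.succ) := by
  refine space_ext (fun a => ?_) fun a c hc => ?_
  · change ((coord a.2 1 : ℝ) : UnitAddCircle) +ᵥ a.1 =
      ((coord (codegen i.succ a.2) 1 : ℝ) : UnitAddCircle) +ᵥ a.1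
    rw [coord_codegen, if_pos (by simp)]
  · change coord (codegen _ (cyc _ a.2)) _ = coord (cyc _ (codegen _ a.2)) _
    rw [coord_cyc _ (by omega)]
    simp only [coord_codegen, Fin.val_succ, Fin.val_castSucc]
    rw [coord_cyc _ (by split_ifs <;> omega)]
    congr 2
    split_ifs <;> omega

lemma codegen_extra (k : ℕ) (i : Fin (k + 1)) :
    (codegenMap X i).comp (extraMap X (k + 1)) = (extraMap X k).comp (codegenMap X i.succ) := by
  refine space_ext (fun a => ?_) fun a c hc => ?_
  · change ((coord a.2 1 : ℝ) : UnitAddCircle) +ᵥ a.1 =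
      ((coord (codegen i.succ a.2) 1 : ℝ) : UnitAddCircle) +ᵥ a.1
    rw [coord_codegen, if_pos (by simp)]
  · change coord (codegen _ (extraMap X (k + 1) a).2) _ = coord (extraMap X k (codegenMap X _ a)).2 _
    rw [coord_codegen, coord_extraMap _ (by split_ifs <;> omega), coord_extraMap _ (by omega)]
    change _ = coord (codegen _ a.2) _ - coord (codegen _ a.2) _
    simp only [coord_codegen, Fin.val_succ]
    congr 2
    split_ifs <;> omega

lemma extra_extra (k : ℕ) :
    (extraMap X k).comp (extraMap X (k + 1)) =
      (extraMap X k).comp (codegenMap X (0 : Fin (k + 2))) := by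
  refine space_ext (fun a => ?_) fun a c hc => ?_
  · change ((coord (extraMap X (k + 1) a).2 1 : ℝ) : UnitAddCircle) +ᵥ
        (((coord a.2 1 : ℝ) : UnitAddCircle) +ᵥ a.1)
      = ((coord (codegen 0 a.2) 1 : ℝ) : UnitAddCircle) +ᵥ a.1
    rw [vadd_vadd, ← AddCircle.coe_add, coord_extraMap _ (by omega), coord_codegen]
    simp
  · rw [ContinuousMap.comp_apply, ContinuousMap.comp_apply, coord_extraMap _ (by omega),
      coord_extraMap _ (by omega), coord_extraMap _ (by omega), coord_extraMap _ (by omega)]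
    change _ = coord (codegen 0 a.2) _ - coord (codegen 0 a.2) _
    rw [coord_codegen, coord_codegen]
    simp

/-- The successive rotations add up to the extended coordinate of index j. For j = k + 1 this is 1,
which is trivial in ℝ/ℤ. -/
lemma iterate_cycSpace (k j : ℕ) (z : X × Simplex k) :
    ((cycSpace X k)^[j] z).1 = ((extCoord z.2 j : ℝ) : UnitAddCircle) +ᵥ z.1 ∧
    ∀ m, extCoord ((cycSpace X k)^[j] z).2 m = extCoord z.2 (m + j) - extCoord z.2 j := by
  induction j with
  | zero => simp [extCoord_of_le, coord_zero]
  | succ j ih =>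
    rw [Function.iterate_succ_apply', cycSpace_fst, cycSpace_snd]
    refine ⟨?_, fun m => ?_⟩
    · rw [ih.1, vadd_vadd, ← AddCircle.coe_add, ← extCoord_of_le _ (by omega), ih.2, add_comm 1 j]
      simp
    · rw [extCoord_cyc, ih.2, ih.2, add_comm 1 j, add_assoc, add_comm 1 j]
      ring

lemma iterate_cycSpace_self (k : ℕ) (z : X × Simplex k) : (cycSpace X k)^[k + 1] z = z := by
  obtain ⟨h1, h2⟩ := iterate_cycSpace k (k + 1) z
  have h3 : extCoord z.2 (k + 1) = 1 := by
    rw [extCoord_of_le _ le_rfl, coord_of_lt _ (Nat.lt_succ_self _)]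
  refine Prod.ext ?_ (simplex_ext fun c hc => ?_)
  · rw [h1, h3]
    have : ((1 : ℝ) : UnitAddCircle) = 0 := AddCircle.coe_period (1 : ℝ)
    rw [this, zero_vadd]
  · have := h2 (c + 1)
    rwa [extCoord_add, h3, add_sub_cancel_right, extCoord_of_le _ (by omega),
      extCoord_of_le _ (by omega)] at this

end Spaces

end CocyclicChains

end

noncomputable section

namespace CocyclicChains

/-! ### The cocyclic operators on chains -/

section Operators

variable {X : Type*} [TopologicalSpace X]

/-- The universal relation behind the vanishing of squared alternating sums: it is the image of
`listBd_listBd`, for the list of all vertices, under the linear map given by φ. -/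
lemma sum_sum_succAbove {M : Type*} [AddCommGroup M] [Module ℝ M] (k : ℕ)
    (φ : (Fin (k + 1) → Fin (k + 3)) → M) :
    ∑ i : Fin (k + 3), (-1 : ℝ) ^ (i : ℕ) • ∑ j : Fin (k + 2), (-1 : ℝ) ^ (j : ℕ) •
      φ (i.succAbove ∘ j.succAbove) = 0 := by
  have h := listBd_listBd (Finsupp.single (List.ofFn (id : Fin (k + 3) → Fin (k + 3))) 1)
  rw [SimplexFamily.listBd_ofFn, map_sum] at h
  simp only [map_smul, SimplexFamily.listBd_ofFn, Function.id_comp] at h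
  -- Only lists of length k + 1 occur, so the value 0 elsewhere is immaterial.
  let ψ : ListChain (Fin (k + 3)) →ₗ[ℝ] M := Finsupp.linearCombination ℝ fun l =>
    if hl : l.length = k + 1 then φ fun i => l.get (i.cast hl.symm) else 0
  have hψ : ∀ v : Fin (k + 1) → Fin (k + 3), ψ (Finsupp.single (List.ofFn v) 1) = φ v := by
    intro v
    simp only [ψ, Finsupp.linearCombination_single, one_smul, List.length_ofFn, dif_pos]
    congr 1
    funext i
    rw [List.get_ofFn]
    rfl
  have := congrArg ψ h
  simpa only [map_sum, map_smul, hψ, map_zero] using this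

/-- The alternating sum of all cofaces. -/
def cofaceSum (X : Type*) [TopologicalSpace X] (k : ℕ) :
    Chain (X × Simplex k) →ₗ[ℝ] Chain (X × Simplex (k + 1)) :=
  ∑ i : Fin (k + 2), ((-1 : ℝ) ^ (i : ℕ)) • cofaceChain X i

/-- The alternating sum of all cofaces but the last. -/
def cofaceSumInit (X : Type*) [TopologicalSpace X] (k : ℕ) :
    Chain (X × Simplex k) →ₗ[ℝ] Chain (X × Simplex (k + 1)) :=
  ∑ i : Fin (k + 1), ((-1 : ℝ) ^ (i : ℕ)) • cofaceChain X i.castSucc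

lemma cofaceSum_apply (k : ℕ) (c : Chain (X × Simplex k)) :
    cofaceSum X k c = ∑ i : Fin (k + 2), (-1 : ℝ) ^ (i : ℕ) • cofaceChain X i c := by
  simp [cofaceSum]

lemma cofaceSumInit_apply (k : ℕ) (c : Chain (X × Simplex k)) :
    cofaceSumInit X k c = ∑ i : Fin (k + 1), (-1 : ℝ) ^ (i : ℕ) • cofaceChain X i.castSucc c := by
  simp [cofaceSumInit]

lemma cofaceSum_cofaceSum (k : ℕ) (c : Chain (X × Simplex k)) :
    cofaceSum X (k + 1) (cofaceSum X k c) = 0 := by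
  have := sum_sum_succAbove k fun v => push ((ContinuousMap.id X).prodMap (aff v)) c
  rw [cofaceSum_apply, ← this]
  refine Finset.sum_congr rfl fun i _ => ?_
  rw [cofaceSum_apply, map_sum]
  congr 1
  refine Finset.sum_congr rfl fun j _ => ?_
  rw [map_smul, cofaceChain, cofaceChain, push_push, aff_comp, ← coface_eq_aff, ← coface_eq_aff]
  rfl

lemma cofaceSum_boundary (k : ℕ) (c : Chain (X × Simplex k)) :
    boundary _ (cofaceSum X k c) = cofaceSum X k (boundary _ c) := by
  simp only [cofaceSum_apply, map_sum, map_smul, cofaceChain, boundary_push]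

lemma cofaceSum_parity (k : ℕ) (c : Chain (X × Simplex k)) :
    parity _ (cofaceSum X k c) = cofaceSum X k (parity _ c) := by
  simp only [cofaceSum_apply, map_sum, map_smul, cofaceChain, parity_push]

lemma cofaceSum_mem {k : ℕ} {n : ℤ} {c : Chain (X × Simplex k)} (hc : c ∈ chainPiece _ n) :
    cofaceSum X k c ∈ chainPiece _ n := by
  rw [cofaceSum_apply]
  exact Submodule.sum_mem _ fun i _ => Submodule.smul_mem _ _ (push_mem_chainPiece _ hc)

/-! ### Stability of normalized chains -/

/-- Normalized chains of `X × Δ^k`. -/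
def IsNormalized (X : Type*) [TopologicalSpace X] :
    ∀ k : ℕ, Chain (X × Simplex k) → Prop
  | 0, _ => True
  | k + 1, c => ∀ i : Fin (k + 1), codegenChain X i c = 0

lemma mem_normalized {c : TotalChain X} :
    c ∈ normalized X ↔ ∀ k, IsNormalized X k (c k) := by
  simp only [normalized, Submodule.mem_iInf, LinearMap.mem_ker, LinearMap.comp_apply,
    LinearMap.proj_apply]
  constructor
  · intro h k
    rcases k with _ | k
    · trivial
    · exact h k
  · exact fun h k => h (k + 1)

/-- Under σ_j the terms δ_j and δ_{j+1} both return c, with opposite signs; in every other term a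
codegeneracy moves past the coface and kills c. -/
lemma IsNormalized.cofaceSum {k : ℕ} {c : Chain (X × Simplex k)} (hc : IsNormalized X k c) :
    IsNormalized X (k + 1) (cofaceSum X k c) := by
  intro j
  have key : ∀ i : Fin (k + 2), i ≠ j.castSucc → i ≠ j.succ →
      codegenChain X j (cofaceChain X i c) = 0 := by
    intro i h1 h2
    rw [codegenChain, cofaceChain, push_push]
    simp only [ne_eq, Fin.ext_iff, Fin.val_castSucc, Fin.val_succ] at h1 h2
    rcases k with _ | k
    · omega
    rcases lt_or_gt_of_ne h1 with h | h
    · have := congrArg (fun f => push f c) (codegen_coface_of_lt (X := X) j i h)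
      rw [this, ← push_push]
      have h0 := hc ⟨j - 1, by omega⟩
      rw [codegenChain] at h0
      rw [h0, map_zero]
    · have := congrArg (fun f => push f c) (codegen_coface_of_gt (X := X) j i (by omega))
      rw [this, ← push_push]
      have h0 := hc ⟨j, by omega⟩
      rw [codegenChain] at h0
      rw [h0, map_zero]
  have self : ∀ i : Fin (k + 2), ((i : ℕ) = j ∨ (i : ℕ) = j + 1) →
      codegenChain X j (cofaceChain X i c) = c := by
    intro i h
    rw [codegenChain, cofaceChain, push_push]
    have := congrArg (fun f => push f c) (codegen_coface_self (X := X) j i h)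
    simp only [push_id] at this
    exact this
  rw [cofaceSum_apply, map_sum, ← Finset.sum_subset (Finset.subset_univ {j.castSucc, j.succ})]
  · rw [Finset.sum_pair (by simp [Fin.ext_iff]), map_smul, map_smul, self _ (by simp),
      self _ (by simp)]
    simp [pow_succ]
  · intro i _ hi
    simp only [Finset.mem_insert, Finset.mem_singleton, not_or] at hi
    rw [map_smul, key i hi.1 hi.2, smul_zero]

lemma IsNormalized.boundary {k : ℕ} {c : Chain (X × Simplex k)} (hc : IsNormalized X k c) :
    IsNormalized X k (boundary _ c) := by
  rcases k with _ | k
  · trivial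
  · intro i
    rw [codegenChain, ← boundary_push]
    have := hc i
    rw [codegenChain] at this
    rw [this, map_zero]

lemma IsNormalized.parity {k : ℕ} {c : Chain (X × Simplex k)} (hc : IsNormalized X k c) :
    IsNormalized X k (parity _ c) := by
  rcases k with _ | k
  · trivial
  · intro i
    rw [codegenChain, ← parity_push]
    have := hc i
    rw [codegenChain] at this
    rw [this, map_zero]

lemma IsNormalized.add {k : ℕ} {c c' : Chain (X × Simplex k)} (hc : IsNormalized X k c)
    (hc' : IsNormalized X k c') : IsNormalized X k (c + c') := by
  rcases k with _ | k
  · trivial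
  · intro i
    rw [map_add, hc i, hc' i, add_zero]

lemma IsNormalized.smul {k : ℕ} {c : Chain (X × Simplex k)} (hc : IsNormalized X k c) (r : ℝ) :
    IsNormalized X k (r • c) := by
  rcases k with _ | k
  · trivial
  · intro i
    rw [map_smul, hc i, smul_zero]

/-! ### The operators λ, N and s on chains -/

variable [AddAction UnitAddCircle X] [ContinuousVAdd UnitAddCircle X]

/-- The extra codegeneracy on chains. -/
def extraChain (X : Type*) [TopologicalSpace X] [AddAction UnitAddCircle X]
    [ContinuousVAdd UnitAddCircle X] (k : ℕ) :
    Chain (X × Simplex (k + 1)) →ₗ[ℝ] Chain (X × Simplex k) :=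
  push (extraMap X k)

/-- The norm operator of the cyclic action. -/
def normChain (X : Type*) [TopologicalSpace X] [AddAction UnitAddCircle X]
    [ContinuousVAdd UnitAddCircle X] (k : ℕ) : Chain (X × Simplex k) →ₗ[ℝ] Chain (X × Simplex k) :=
  ∑ j ∈ Finset.range (k + 1), lam X k ^ j

lemma lam_apply (k : ℕ) (c : Chain (X × Simplex k)) :
    lam X k c = (-1 : ℝ) ^ k • push (cycSpace X k) c := rfl

lemma push_pow {Y : Type*} [TopologicalSpace Y] (f : C(Y, Y)) (j : ℕ) :
    ∃ g : C(Y, Y), (∀ y, g y = f^[j] y) ∧ (push f : Module.End ℝ (Chain Y)) ^ j = push g := by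
  induction j with
  | zero => exact ⟨ContinuousMap.id _, fun y => rfl, LinearMap.ext fun a => by simp⟩
  | succ j ih =>
    obtain ⟨g, h1, h2⟩ := ih
    refine ⟨f.comp g, fun y => ?_, ?_⟩
    · rw [Function.iterate_succ_apply', ← h1]
      rfl
    · rw [pow_succ', h2]
      exact LinearMap.ext fun a => push_push f g a

/-- The geometric map has order dividing k + 1, and the sign (-1)^{k(k+1)} is 1. -/
lemma lam_pow_self (k : ℕ) : lam X k ^ (k + 1) = 1 := by
  obtain ⟨g, h1, h2⟩ := push_pow (cycSpace X k) (k + 1)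
  have hg : g = ContinuousMap.id _ := ContinuousMap.ext fun z => by
    rw [h1, iterate_cycSpace_self]
    rfl
  rw [lam, smul_pow, cycChain, h2, hg, ← pow_mul]
  rw [Even.neg_one_pow (Nat.even_mul_succ_self k), one_smul]
  exact LinearMap.ext fun a => push_id a

lemma normChain_lam (k : ℕ) (c : Chain (X × Simplex k)) :
    normChain X k (lam X k c) = normChain X k c := by
  have h := geom_sum_mul_neg (lam X k) (k + 1)
  rw [lam_pow_self, sub_self] at h
  have := LinearMap.congr_fun h c
  simp only [Module.End.mul_apply, LinearMap.sub_apply, Module.End.one_apply, map_sub,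
    LinearMap.zero_apply, sub_eq_zero] at this
  exact this.symm

lemma lam_normChain (k : ℕ) (c : Chain (X × Simplex k)) :
    lam X k (normChain X k c) = normChain X k c := by
  have h := mul_neg_geom_sum (lam X k) (k + 1)
  rw [lam_pow_self, sub_self] at h
  have := LinearMap.congr_fun h c
  simp only [Module.End.mul_apply, LinearMap.sub_apply, Module.End.one_apply,
    LinearMap.zero_apply, sub_eq_zero] at this
  exact this.symm

lemma normChain_of_lam_eq {k : ℕ} {c : Chain (X × Simplex k)} (h : lam X k c = c) :
    normChain X k c = ((k : ℝ) + 1) • c := by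
  have hp : ∀ j : ℕ, (lam X k ^ j) c = c := by
    intro j
    induction j with
    | zero => rfl
    | succ j ih => rw [pow_succ, Module.End.mul_apply, h, ih]
  rw [normChain, LinearMap.sum_apply]
  simp only [hp, Finset.sum_const, Finset.card_range]
  rw [← Nat.cast_smul_eq_nsmul ℝ]
  push_cast
  rfl

lemma map_normChain_of_lam_eq {M : Type*} [AddCommGroup M] [Module ℝ M] {k : ℕ}
    (f : Chain (X × Simplex k) →ₗ[ℝ] M) (h : ∀ c, f (lam X k c) = f c)
    (c : Chain (X × Simplex k)) : f (normChain X k c) = ((k : ℝ) + 1) • f c := by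
  have hp : ∀ (j : ℕ) c, f ((lam X k ^ j) c) = f c := by
    intro j
    induction j with
    | zero => exact fun c => rfl
    | succ j ih => exact fun c => by rw [pow_succ, Module.End.mul_apply, ih, h]
  rw [normChain, LinearMap.sum_apply, map_sum]
  simp only [hp, Finset.sum_const, Finset.card_range]
  rw [← Nat.cast_smul_eq_nsmul ℝ]
  push_cast
  rfl

lemma lam_coface_zero (k : ℕ) (c : Chain (X × Simplex k)) :
    lam X (k + 1) (cofaceChain X 0 c) = (-1 : ℝ) ^ (k + 1) • cofaceChain X (Fin.last (k + 1)) c := by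
  rw [lam_apply, cofaceChain, cofaceChain, push_push]
  exact congrArg (fun f => _ • push f c) (cyc_coface_zero k)

lemma lam_coface_succ (k : ℕ) (i : Fin (k + 1)) (c : Chain (X × Simplex k)) :
    lam X (k + 1) (cofaceChain X i.succ c) = - cofaceChain X i.castSucc (lam X k c) := by
  rw [lam_apply, lam_apply, cofaceChain, cofaceChain, push_push, map_smul, push_push, pow_succ,
    mul_neg_one, neg_smul]
  exact congrArg (fun f => - (_ • push f c)) (cyc_coface_succ k i)

/-- λδ_0 is the last term of the alternating sum, and λδ_{i+1} = -δ_iλ shifts the other terms down;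
hence the last coface cancels in (1 - λ)δ. -/
lemma lam_cofaceSum (k : ℕ) (c : Chain (X × Simplex k)) :
    cofaceSum X k c - lam X (k + 1) (cofaceSum X k c) = cofaceSumInit X k (c - lam X k c) := by
  have h1 : cofaceSum X k c = cofaceSumInit X k c +
      (-1 : ℝ) ^ (k + 1) • cofaceChain X (Fin.last (k + 1)) c := by
    rw [cofaceSum_apply, cofaceSumInit_apply, Fin.sum_univ_castSucc]
    simp
  have h2 : lam X (k + 1) (cofaceSum X k c) =
      (-1 : ℝ) ^ (k + 1) • cofaceChain X (Fin.last (k + 1)) c + cofaceSumInit X k (lam X k c) := by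
    rw [cofaceSum_apply, cofaceSumInit_apply, Fin.sum_univ_succ, map_add, map_smul,
      lam_coface_zero, map_sum]
    simp only [map_smul, lam_coface_succ, Fin.val_zero, pow_zero, one_smul, Fin.val_succ, pow_succ,
      mul_neg_one, neg_smul, map_neg, smul_neg, neg_neg]
  rw [h2, map_sub]
  nth_rewrite 1 [h1]
  abel

/-- The norm intertwines the two alternating sums of cofaces. -/
lemma cofaceSum_normChain (k : ℕ) (c : Chain (X × Simplex k)) :
    cofaceSum X k (normChain X k c) = normChain X (k + 1) (cofaceSumInit X k c) := by
  -- Write δ' for `cofaceSumInit`. Since Nλ = N, λN = N and λδ_{i+1} = -δ_iλ, every term (-1)^i N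
  -- δ_i N c equals P, so NδNc = (k + 2)P and Nδ'Nc = (k + 1)P. But δNc is λ-invariant and Nδ'λ =
  -- Nδ', so the left sides are also (k + 2)δNc and (k + 1)Nδ'c. Division by the two integers gives
  -- δNc = P = Nδ'c.
  set P := normChain X (k + 1) (cofaceChain X 0 (normChain X k c)) with hP
  have hterm : ∀ i : Fin (k + 2), (-1 : ℝ) ^ (i : ℕ) •
      normChain X (k + 1) (cofaceChain X i (normChain X k c)) = P := by
    intro i
    induction i using Fin.induction with
    | zero => simp [hP]
    | succ i ih =>
      rw [← ih, ← normChain_lam (k + 1) (cofaceChain X i.succ _), lam_coface_succ, lam_normChain,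
        map_neg, Fin.val_succ, pow_succ, mul_neg_one, smul_neg, neg_smul, neg_neg]
      rfl
  have h1 : normChain X (k + 1) (cofaceSum X k (normChain X k c)) = ((k : ℝ) + 2) • P := by
    rw [cofaceSum_apply, map_sum]
    simp only [map_smul, hterm, Finset.sum_const, Finset.card_univ, Fintype.card_fin]
    rw [← Nat.cast_smul_eq_nsmul ℝ]
    push_cast
    rfl
  have h2 : normChain X (k + 1) (cofaceSumInit X k (normChain X k c)) = ((k : ℝ) + 1) • P := by
    have hterm' : ∀ i : Fin (k + 1), (-1 : ℝ) ^ (i : ℕ) •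
        normChain X (k + 1) (cofaceChain X i.castSucc (normChain X k c)) = P :=
      fun i => hterm i.castSucc
    rw [cofaceSumInit_apply, map_sum]
    simp only [map_smul, hterm', Finset.sum_const, Finset.card_univ, Fintype.card_fin]
    rw [← Nat.cast_smul_eq_nsmul ℝ]
    push_cast
    rfl
  have h3 : lam X (k + 1) (cofaceSum X k (normChain X k c)) = cofaceSum X k (normChain X k c) := by
    have := lam_cofaceSum k (normChain X k c)
    rw [lam_normChain, sub_self, map_zero, sub_eq_zero] at this
    exact this.symm
  have h4 : ∀ c, normChain X (k + 1) (cofaceSumInit X k (lam X k c)) =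
      normChain X (k + 1) (cofaceSumInit X k c) := by
    intro c
    have := congrArg (normChain X (k + 1)) (lam_cofaceSum k c)
    rw [map_sub, normChain_lam, sub_self, map_sub, map_sub] at this
    exact (sub_eq_zero.1 this.symm).symm
  rw [normChain_of_lam_eq h3] at h1
  have h5 := map_normChain_of_lam_eq (normChain X (k + 1) ∘ₗ cofaceSumInit X k) h4 c
  rw [LinearMap.comp_apply, h2, LinearMap.comp_apply] at h5
  have e1 : cofaceSum X k (normChain X k c) = P := by
    have : ((k : ℝ) + 2) ≠ 0 := by positivity
    refine smul_right_injective _ this ?_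
    simp only
    rw [← h1]
    push_cast
    ring_nf
  have e2 : P = normChain X (k + 1) (cofaceSumInit X k c) := by
    have : ((k : ℝ) + 1) ≠ 0 := by positivity
    exact smul_right_injective _ this h5
  rw [e1, e2]

lemma extra_cofaceSumInit_zero (c : Chain (X × Simplex 0)) :
    extraChain X 0 (cofaceSumInit X 0 c) = c := by
  rw [cofaceSumInit_apply]
  have := congrArg (fun f => push f c) (extra_coface_zero (X := X) 0)
  simp only [push_id] at this
  rw [Fin.sum_univ_succ, Finset.univ_eq_empty, Finset.sum_empty, add_zero, Fin.val_zero, pow_zero,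
    one_smul, extraChain, cofaceChain, push_push]
  exact this

/-- s undoes δ_0, and sδ_{i+1} = δ_i s makes all remaining terms cancel. -/
lemma extra_cofaceSumInit_succ (k : ℕ) (c : Chain (X × Simplex (k + 1))) :
    extraChain X (k + 1) (cofaceSumInit X (k + 1) c) + cofaceSumInit X k (extraChain X k c) = c := by
  have h0 := congrArg (fun f => push f c) (extra_coface_zero (X := X) (k + 1))
  simp only [push_id] at h0
  have hs : ∀ i : Fin (k + 1), extraChain X (k + 1) (cofaceChain X i.succ.castSucc c) =
      cofaceChain X i.castSucc (extraChain X k c) := by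
    intro i
    rw [extraChain, extraChain, cofaceChain, cofaceChain, push_push, push_push]
    exact congrArg (fun f => push f c) (extra_coface_succ (X := X) k i)
  have h0' : extraChain X (k + 1) (cofaceChain X (Fin.castSucc 0) c) = c := by
    rw [extraChain, cofaceChain, push_push]
    exact h0
  rw [cofaceSumInit_apply, cofaceSumInit_apply, Fin.sum_univ_succ, map_add, map_smul, h0', map_sum]
  simp only [map_smul, hs, Fin.val_zero, pow_zero, one_smul, Fin.val_succ, pow_succ,
      mul_neg_one, neg_smul, map_neg, Finset.sum_neg_distrib]
  abel

/-! ### Connes' operator -/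

/-- Connes' operator without signs. -/
def connesChain (X : Type*) [TopologicalSpace X] [AddAction UnitAddCircle X]
    [ContinuousVAdd UnitAddCircle X] (k : ℕ) :
    Chain (X × Simplex (k + 1)) →ₗ[ℝ] Chain (X × Simplex k) :=
  normChain X k ∘ₗ extraChain X k ∘ₗ (LinearMap.id - lam X (k + 1))

lemma connesChain_apply (k : ℕ) (c : Chain (X × Simplex (k + 1))) :
    connesChain X k c = normChain X k (extraChain X k (c - lam X (k + 1) c)) := rfl

lemma connesChain_connesChain (k : ℕ) (c : Chain (X × Simplex (k + 2))) :
    connesChain X k (connesChain X (k + 1) c) = 0 := by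
  rw [connesChain_apply, connesChain_apply, lam_normChain, sub_self, map_zero, map_zero]

/-- With δ' for the sum without the last coface, δNs(1 - λ) + Ns(1 - λ)δ = N(δ's + sδ')(1 - λ) = N(1
- λ) = 0. -/
lemma cofaceSum_connesChain (k : ℕ) (c : Chain (X × Simplex (k + 1))) :
    cofaceSum X k (connesChain X k c) + connesChain X (k + 1) (cofaceSum X (k + 1) c) = 0 := by
  rw [connesChain_apply, connesChain_apply, cofaceSum_normChain, lam_cofaceSum, ← map_add,
    add_comm (cofaceSumInit X k _), extra_cofaceSumInit_succ, map_sub, normChain_lam, sub_self]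

lemma connesChain_cofaceSum_zero (c : Chain (X × Simplex 0)) :
    connesChain X 0 (cofaceSum X 0 c) = 0 := by
  rw [connesChain_apply, lam_cofaceSum, extra_cofaceSumInit_zero, map_sub, normChain_lam, sub_self]

lemma map_normChain {Y : Type*} [TopologicalSpace Y] [AddAction UnitAddCircle Y]
    [ContinuousVAdd UnitAddCircle Y] {k : ℕ}
    (f : Chain (X × Simplex k) →ₗ[ℝ] Chain (Y × Simplex k))
    (h : ∀ c, f (lam X k c) = lam Y k (f c)) (c : Chain (X × Simplex k)) :
    f (normChain X k c) = normChain Y k (f c) := by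
  have hp : ∀ (j : ℕ) c, f ((lam X k ^ j) c) = (lam Y k ^ j) (f c) := by
    intro j
    induction j with
    | zero => exact fun c => rfl
    | succ j ih => exact fun c => by rw [pow_succ, pow_succ, Module.End.mul_apply, ih, h]; rfl
  rw [normChain, normChain, LinearMap.sum_apply, LinearMap.sum_apply, map_sum]
  simp only [hp]

/-- Reduces compatibility with B to compatibility with λ and s. It serves for the boundary, the
parity, the rotation and the product with a fixed chain. -/
lemma map_connesChain {Y : Type*} [TopologicalSpace Y] [AddAction UnitAddCircle Y]
    [ContinuousVAdd UnitAddCircle Y]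
    (f : ∀ k, Chain (X × Simplex k) →ₗ[ℝ] Chain (Y × Simplex k))
    (h : ∀ k c, f k (lam X k c) = lam Y k (f k c))
    (he : ∀ k c, f k (extraChain X k c) = extraChain Y k (f (k + 1) c))
    (k : ℕ) (c : Chain (X × Simplex (k + 1))) :
    f k (connesChain X k c) = connesChain Y k (f (k + 1) c) := by
  rw [connesChain_apply, connesChain_apply, map_normChain (f k) (h k), he, map_sub, h]

lemma lam_boundary (k : ℕ) (c : Chain (X × Simplex k)) :
    boundary _ (lam X k c) = lam X k (boundary _ c) := by
  rw [lam_apply, lam_apply, map_smul, boundary_push]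

lemma lam_parity (k : ℕ) (c : Chain (X × Simplex k)) :
    parity _ (lam X k c) = lam X k (parity _ c) := by
  rw [lam_apply, lam_apply, map_smul, parity_push]

lemma connesChain_boundary (k : ℕ) (c : Chain (X × Simplex (k + 1))) :
    boundary _ (connesChain X k c) = connesChain X k (boundary _ c) :=
  map_connesChain (fun _ => boundary _) lam_boundary (fun _ _ => boundary_push _ _) k c

lemma connesChain_parity (k : ℕ) (c : Chain (X × Simplex (k + 1))) :
    parity _ (connesChain X k c) = connesChain X k (parity _ c) :=
  map_connesChain (fun _ => parity _) lam_parity (fun _ _ => parity_push _ _) k c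

lemma lam_pow_mem {k : ℕ} {n : ℤ} {c : Chain (X × Simplex k)} (hc : c ∈ chainPiece _ n) (j : ℕ) :
    (lam X k ^ j) c ∈ chainPiece _ n := by
  induction j with
  | zero => exact hc
  | succ j ih =>
    rw [pow_succ', Module.End.mul_apply, lam_apply]
    exact Submodule.smul_mem _ _ (push_mem_chainPiece _ ih)

lemma connesChain_mem {k : ℕ} {n : ℤ} {c : Chain (X × Simplex (k + 1))}
    (hc : c ∈ chainPiece _ n) : connesChain X k c ∈ chainPiece _ n := by
  rw [connesChain_apply, normChain, LinearMap.sum_apply]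
  refine Submodule.sum_mem _ fun j _ => lam_pow_mem (push_mem_chainPiece _ ?_) j
  exact Submodule.sub_mem _ hc (by simpa using lam_pow_mem hc 1)

lemma extra_lam (k : ℕ) {c : Chain (X × Simplex (k + 1))} :
    extraChain X k (lam X (k + 1) c) = - lam X k (codegenChain X (0 : Fin (k + 1)) c) := by
  rw [lam_apply, lam_apply, map_smul, extraChain, codegenChain, push_push, push_push, pow_succ,
    mul_neg_one, neg_smul]
  exact congrArg (fun f => - (_ • push f c)) (extra_cyc k)

lemma codegen_castSucc_lam (k : ℕ) (i : Fin k) (c : Chain (X × Simplex (k + 1))) :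
    codegenChain X i.castSucc (lam X (k + 1) c) = - lam X k (codegenChain X i.succ c) := by
  rw [lam_apply, lam_apply, map_smul, codegenChain, codegenChain, push_push, push_push, pow_succ,
    mul_neg_one, neg_smul]
  exact congrArg (fun f => - (_ • push f c)) (codegen_cyc k i)

lemma codegen_last_lam (k : ℕ) (c : Chain (X × Simplex (k + 1))) :
    codegenChain X (Fin.last k) (lam X (k + 1) c) = (-1 : ℝ) ^ (k + 1) • extraChain X k c := by
  rw [lam_apply, map_smul, codegenChain, push_push]
  rfl

/-- The two properties need each other: the last codegeneracy of λx is ± sx, while sλx = -λσ_0 x.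
The others follow from σ_iλ = -λσ_{i+1}. -/
lemma isNormalized_lam_pow_extraChain {k : ℕ} {c : Chain (X × Simplex (k + 2))}
    (hc : IsNormalized X (k + 2) c) (j : ℕ) :
    IsNormalized X (k + 1) ((lam X (k + 1) ^ j) (extraChain X (k + 1) c)) ∧
      extraChain X k ((lam X (k + 1) ^ j) (extraChain X (k + 1) c)) = 0 := by
  induction j with
  | zero =>
    refine ⟨fun i => ?_, ?_⟩
    · have h := hc i.succ
      rw [pow_zero, Module.End.one_apply, codegenChain, extraChain, push_push]
      have := congrArg (fun f => push f c) (codegen_extra (X := X) k i)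
      rw [codegenChain] at h
      rw [this, ← push_push, h, map_zero]
    · have h := hc 0
      rw [pow_zero, Module.End.one_apply, extraChain, extraChain, push_push]
      have := congrArg (fun f => push f c) (extra_extra (X := X) k)
      rw [codegenChain] at h
      rw [this, ← push_push, h, map_zero]
  | succ j ih =>
    rw [pow_succ', Module.End.mul_apply]
    refine ⟨fun i => ?_, ?_⟩
    · induction i using Fin.lastCases with
      | last => rw [codegen_last_lam, ih.2, smul_zero]
      | cast i => rw [codegen_castSucc_lam, ih.1 i.succ, map_zero, neg_zero]
    · rw [extra_lam, ih.1 0, map_zero, neg_zero]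

lemma IsNormalized.connesChain {k : ℕ} {c : Chain (X × Simplex (k + 1))}
    (hc : IsNormalized X (k + 1) c) : IsNormalized X k (connesChain X k c) := by
  rcases k with _ | k
  · trivial
  -- On normalized chains B thus reduces to Ns.
  have h : extraChain X (k + 1) (lam X (k + 2) c) = 0 := by
    rw [extra_lam, hc 0, map_zero, neg_zero]
  rw [connesChain_apply, map_sub, h, sub_zero, normChain, LinearMap.sum_apply]
  intro i
  rw [map_sum]
  exact Finset.sum_eq_zero fun j _ => (isNormalized_lam_pow_extraChain hc j).1 i

end Operators

end CocyclicChains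

end

noncomputable section

namespace CocyclicChains

/-! ### The rotation operator -/

section Rotation

variable {X Y Z : Type*} [TopologicalSpace X] [TopologicalSpace Y] [TopologicalSpace Z]

lemma rotation_apply (F : C(UnitAddCircle × X, X)) (a : Chain X) :
    rotation F a = push F (cross fundCycle a) := rfl

lemma parity_fundCycle : parity _ fundCycle = - fundCycle := by
  rw [fundCycle, parity_single, pow_one, neg_one_smul]

lemma boundary_rotation (F : C(UnitAddCircle × X, X)) (a : Chain X) :
    boundary _ (rotation F a) = - rotation F (boundary _ a) := by
  rw [rotation_apply, rotation_apply, boundary_push, boundary_cross, boundary_fundCycle,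
    parity_fundCycle]
  simp

lemma parity_rotation (F : C(UnitAddCircle × X, X)) (a : Chain X) :
    parity _ (rotation F a) = - rotation F (parity _ a) := by
  rw [rotation_apply, rotation_apply, parity_push, parity_cross, parity_fundCycle]
  simp

lemma push_rotation (F : C(UnitAddCircle × X, X)) (F' : C(UnitAddCircle × Y, Y)) (g : C(X, Y))
    (h : ∀ z x, g (F (z, x)) = F' (z, g x)) (a : Chain X) :
    push g (rotation F a) = rotation F' (push g a) := by
  rw [rotation_apply, rotation_apply, cross_push_right, push_push, push_push]
  exact congrArg (fun f => push f _) (ContinuousMap.ext fun w => h w.1 w.2)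

/-- Swapping the circle factors changes the sign of [S¹] × [S¹] but not the iterated action, S¹
being commutative. So J² equals its own negative, and it is zero over ℝ. -/
lemma rotation_rotation (F : C(UnitAddCircle × X, X))
    (h : ∀ z w x, F (z, F (w, x)) = F (z + w, x)) (a : Chain X) :
    rotation F (rotation F a) = 0 := by
  let G : C((UnitAddCircle × UnitAddCircle) × X, X) :=
    F.comp (((ContinuousMap.id _).prodMap F).comp (prodAssocMap _ _ _))
  have hG : G.comp (ContinuousMap.prodSwap.prodMap (ContinuousMap.id _)) = G := by
    refine ContinuousMap.ext fun w => ?_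
    change F (w.1.2, F (w.1.1, w.2)) = F (w.1.1, F (w.1.2, w.2))
    rw [h, h, add_comm]
  have h1 : rotation F (rotation F a) = push G (cross (cross fundCycle fundCycle) a) := by
    rw [rotation_apply, rotation_apply, cross_push_right, ← cross_assoc, push_push, push_push]
    rfl
  have h2 : push G (cross (cross fundCycle fundCycle) a) =
      - push G (cross (cross fundCycle fundCycle) a) := by
    nth_rewrite 1 [← hG]
    rw [← push_push, ← cross_push_left, cross_fundCycle_comm, parity_fundCycle]
    simp
  rw [h1]
  exact self_eq_neg.1 h2

lemma rotation_mem (F : C(UnitAddCircle × X, X)) {n : ℤ} {a : Chain X} (ha : a ∈ chainPiece X n) :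
    rotation F a ∈ chainPiece X (n + 1) := by
  rw [add_comm]
  exact push_mem_chainPiece _ (cross_mem_chainPiece fundCycle_mem ha)

variable [AddAction UnitAddCircle X] [ContinuousVAdd UnitAddCircle X]

lemma singularMixed_isMixedComplex (X : Type*) [TopologicalSpace X] [AddAction UnitAddCircle X]
    [ContinuousVAdd UnitAddCircle X] : (singularMixed X).IsMixedComplex where
  b_mem _ _ hx := boundary_mem_chainPiece hx
  B_mem _ _ hx := rotation_mem _ hx
  b_b _ _ _ := boundary_boundary _
  B_B _ _ _ := rotation_rotation _ (fun _ _ _ => vadd_vadd _ _ _) _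
  b_B _ x _ := by
    change boundary X (rotation _ x) + rotation _ (boundary X x) = 0
    rw [boundary_rotation, neg_add_cancel]

end Rotation

/-! ### The mixed complex of a cocyclic space -/

section Total

variable {X : Type*} [TopologicalSpace X]

lemma mem_totalPiece {n : ℤ} {c : TotalChain X} :
    c ∈ totalPiece X n ↔ ∀ k : ℕ, c k ∈ chainPiece (X × Simplex k) (n + k) := by
  simp [totalPiece, Submodule.mem_pi]

lemma totalB_zero (c : TotalChain X) : totalB X c 0 = boundary _ (c 0) := rfl

lemma totalB_succ (c : TotalChain X) (k : ℕ) :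
    totalB X c (k + 1) =
      boundary _ (c (k + 1)) + (-1 : ℝ) ^ k • cofaceSum X k (parity _ (c k)) := rfl

lemma totalB_mem {n : ℤ} {c : TotalChain X} (hc : c ∈ totalPiece X n) :
    totalB X c ∈ totalPiece X (n - 1) := by
  rw [mem_totalPiece] at hc ⊢
  intro k
  rcases k with _ | k
  · rw [totalB_zero]
    have := boundary_mem_chainPiece (hc 0)
    rwa [add_sub_right_comm] at this
  · rw [totalB_succ]
    refine Submodule.add_mem _ ?_ (Submodule.smul_mem _ _ (cofaceSum_mem ?_))
    · have := boundary_mem_chainPiece (hc (k + 1))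
      rwa [add_sub_right_comm] at this
    · have := parity_mem_chainPiece (hc k)
      have e : n - 1 + ((k + 1 : ℕ) : ℤ) = n + k := by push_cast; ring
      rwa [e]

lemma totalB_normalized {c : TotalChain X} (hc : c ∈ normalized X) :
    totalB X c ∈ normalized X := by
  rw [mem_normalized] at hc ⊢
  intro k
  rcases k with _ | k
  · trivial
  · rw [totalB_succ]
    exact (hc (k + 1)).boundary.add ((hc k).parity.cofaceSum.smul _)

/-- The cross terms ∂δ and δ∂ cancel because ∂ anticommutes with the parity contained in δ. -/
lemma totalB_totalB (c : TotalChain X) : totalB X (totalB X c) = 0 := by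
  funext k
  rcases k with _ | k
  · rw [totalB_zero, totalB_zero, boundary_boundary]
    rfl
  · rw [totalB_succ, totalB_succ, map_add, boundary_boundary, map_smul, cofaceSum_boundary,
      boundary_parity]
    rcases k with _ | k
    · rw [totalB_zero]
      simp
    · rw [totalB_succ]
      simp only [map_add, map_smul, cofaceSum_parity, parity_parity, cofaceSum_cofaceSum, map_neg]
      simp

variable [AddAction UnitAddCircle X] [ContinuousVAdd UnitAddCircle X]

lemma connesB_apply (c : TotalChain X) (k : ℕ) :
    connesB X c k = (-1 : ℝ) ^ k • connesChain X k (parity _ (c (k + 1))) := by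
  rw [connesChain_apply, ← lam_parity, ← map_sub]
  change normChain X k ((-1 : ℝ) ^ k • codegenChain X (Fin.last k)
    (cycChain X (k + 1) (parity _ (c (k + 1) - lam X (k + 1) (c (k + 1)))))) = _
  rw [codegenChain, cycChain, push_push, map_smul]
  rfl

lemma connesB_mem {n : ℤ} {c : TotalChain X} (hc : c ∈ totalPiece X n) :
    connesB X c ∈ totalPiece X (n + 1) := by
  rw [mem_totalPiece] at hc ⊢
  intro k
  rw [connesB_apply]
  refine Submodule.smul_mem _ _ (connesChain_mem (parity_mem_chainPiece ?_))
  have := hc (k + 1)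
  have e : n + 1 + (k : ℤ) = n + ((k + 1 : ℕ) : ℤ) := by push_cast; ring
  rwa [e]

lemma connesB_normalized {c : TotalChain X} (hc : c ∈ normalized X) :
    connesB X c ∈ normalized X := by
  rw [mem_normalized] at hc ⊢
  intro k
  rw [connesB_apply]
  exact ((hc (k + 1)).parity.connesChain).smul _

lemma connesB_connesB (c : TotalChain X) : connesB X (connesB X c) = 0 := by
  funext k
  rw [connesB_apply, connesB_apply]
  simp only [map_smul, connesChain_parity, connesChain_connesChain, smul_zero]
  rfl

/-- ∂ and B anticommute through the parity contained in B, and the coface parts cancel by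
`cofaceSum_connesChain`. At k = 0 there is no term δB, and Bδ vanishes by itself. -/
lemma totalB_connesB (c : TotalChain X) :
    totalB X (connesB X c) + connesB X (totalB X c) = 0 := by
  funext k
  have hs := neg_one_pow_mul_self k
  have h1 : boundary _ (connesB X c k) +
      (-1 : ℝ) ^ k • connesChain X k (parity _ (boundary _ (c (k + 1)))) = 0 := by
    rw [connesB_apply, map_smul, connesChain_boundary, boundary_parity, map_neg, smul_neg,
      neg_add_cancel]
  rw [Pi.add_apply, connesB_apply (totalB X c), totalB_succ, map_add, map_add, smul_add]
  rcases k with _ | k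
  · rw [totalB_zero, ← add_assoc, h1]
    simp [cofaceSum_parity, connesChain_cofaceSum_zero]
  · have h2 := cofaceSum_connesChain k (c (k + 1))
    rw [totalB_succ, add_add_add_comm, h1, connesB_apply, zero_add]
    simp only [map_smul, connesChain_parity, parity_parity, cofaceSum_parity, smul_smul, hs,
      neg_one_pow_mul_self, one_smul]
    rw [h2]
    rfl

lemma cocyclicMixed_isMixedComplex (X : Type*) [TopologicalSpace X] [AddAction UnitAddCircle X]
    [ContinuousVAdd UnitAddCircle X] : (cocyclicMixed X).IsMixedComplex where
  b_mem _ _ hx := ⟨totalB_mem hx.1, totalB_normalized hx.2⟩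
  B_mem _ _ hx := ⟨connesB_mem hx.1, connesB_normalized hx.2⟩
  b_b _ _ _ := totalB_totalB _
  B_B _ _ _ := connesB_connesB _
  b_B _ _ _ := totalB_connesB _

/-! ### The rotation operator on the total complex -/

lemma totalJ_apply (c : TotalChain X) (k : ℕ) :
    totalJ X c k = rotation (actionProd X k) (c k) := rfl

lemma cofaceSum_rotation (k : ℕ) (c : Chain (X × Simplex k)) :
    cofaceSum X k (rotation (actionProd X k) c) =
      rotation (actionProd X (k + 1)) (cofaceSum X k c) := by
  simp only [cofaceSum_apply, map_sum, map_smul]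
  refine Finset.sum_congr rfl fun i _ => congrArg _ ?_
  exact push_rotation _ _ _ (fun z x => rfl) c

/-- λ and s move points of X by rotations only, and these commute with the action since S¹ is
commutative. -/
lemma connesChain_rotation (k : ℕ) (c : Chain (X × Simplex (k + 1))) :
    rotation (actionProd X k) (connesChain X k c) =
      connesChain X k (rotation (actionProd X (k + 1)) c) := by
  refine map_connesChain (fun k => rotation (actionProd X k)) (fun k c => ?_) (fun k c => ?_) k c
  · rw [lam_apply, lam_apply, map_smul,
      push_rotation _ (actionProd X k) _ (fun z x => Prod.ext ?_ rfl) c]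
    change ((coord x.2 1 : ℝ) : UnitAddCircle) +ᵥ (z +ᵥ x.1) =
      z +ᵥ (((coord x.2 1 : ℝ) : UnitAddCircle) +ᵥ x.1)
    rw [vadd_vadd, vadd_vadd, add_comm]
  · rw [extraChain, push_rotation _ (actionProd X k) _ (fun z x => Prod.ext ?_ rfl) c]
    change ((coord x.2 1 : ℝ) : UnitAddCircle) +ᵥ (z +ᵥ x.1) =
      z +ᵥ (((coord x.2 1 : ℝ) : UnitAddCircle) +ᵥ x.1)
    rw [vadd_vadd, vadd_vadd, add_comm]

lemma totalJ_mem {n : ℤ} {c : TotalChain X} (hc : c ∈ totalPiece X n) :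
    totalJ X c ∈ totalPiece X (n + 1) := by
  rw [mem_totalPiece] at hc ⊢
  intro k
  rw [add_right_comm]
  exact rotation_mem _ (hc k)

lemma totalJ_normalized {c : TotalChain X} (hc : c ∈ normalized X) :
    totalJ X c ∈ normalized X := by
  rw [mem_normalized] at hc ⊢
  intro k
  rcases k with _ | k
  · trivial
  · intro i
    have := hc (k + 1) i
    rw [codegenChain] at this
    rw [totalJ_apply, codegenChain,
      push_rotation _ (actionProd X k) _ (fun z x => rfl), this, map_zero]

lemma totalJ_totalJ (c : TotalChain X) : totalJ X (totalJ X c) = 0 := by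
  funext k
  rw [totalJ_apply, totalJ_apply]
  exact rotation_rotation _ (fun z w x => Prod.ext (vadd_vadd _ _ _) rfl) _

lemma totalB_totalJ (c : TotalChain X) : totalB X (totalJ X c) = - totalJ X (totalB X c) := by
  funext k
  rw [Pi.neg_apply]
  rcases k with _ | k
  · rw [totalB_zero, totalJ_apply, totalJ_apply, totalB_zero, boundary_rotation]
  · rw [totalB_succ, totalJ_apply, totalJ_apply, totalJ_apply, totalB_succ, boundary_rotation,
      parity_rotation, map_neg, cofaceSum_rotation, map_add, map_smul, smul_neg, neg_add]

lemma connesB_totalJ (c : TotalChain X) : connesB X (totalJ X c) = - totalJ X (connesB X c) := by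
  funext k
  rw [Pi.neg_apply, connesB_apply, totalJ_apply, totalJ_apply, connesB_apply, parity_rotation,
    map_neg, map_smul, smul_neg, connesChain_rotation]

end Total

/-! ### The cross product with chains of the cocyclic circle -/

section Mix

variable {X : Type*} [TopologicalSpace X] [AddAction UnitAddCircle X]
  [ContinuousVAdd UnitAddCircle X]

/-- The map `a ↦ ((F_k)_* (a × η_k))_k`. -/
def mix (X : Type*) [TopologicalSpace X] [AddAction UnitAddCircle X]
    [ContinuousVAdd UnitAddCircle X] : TotalChain UnitAddCircle →ₗ[ℝ] Chain X →ₗ[ℝ] TotalChain X :=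
  LinearMap.mk₂ ℝ (fun η a k => push (mixMap X k) (cross a (η k)))
    (fun η η' a => funext fun k => by simp) (fun r η a => funext fun k => by simp)
    (fun η a a' => funext fun k => by simp) (fun r η a => funext fun k => by simp)

lemma mix_apply (η : TotalChain UnitAddCircle) (a : Chain X) (k : ℕ) :
    mix X η a k = push (mixMap X k) (cross a (η k)) := rfl

/-- A map of the cocyclic circle that the F_k intertwine with a map of the cocyclic space passes
through the product. Cofaces, codegeneracies and τ_k are of this kind. -/
lemma mix_push (a : Chain X) {k l : ℕ} (f : C(UnitAddCircle × Simplex k, UnitAddCircle × Simplex l))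
    (g : C(X × Simplex k, X × Simplex l)) (h : ∀ x z, mixMap X l (x, f z) = g (mixMap X k (x, z)))
    (c : Chain (UnitAddCircle × Simplex k)) :
    push (mixMap X l) (cross a (push f c)) = push g (push (mixMap X k) (cross a c)) := by
  rw [cross_push_right, push_push, push_push]
  exact congrArg (fun f => push f _) (ContinuousMap.ext fun w => h w.1 w.2)

lemma mix_mem {m n : ℤ} {η : TotalChain UnitAddCircle} (hη : η ∈ totalPiece _ n) {a : Chain X}
    (ha : a ∈ chainPiece X m) : mix X η a ∈ totalPiece X (m + n) := by
  rw [mem_totalPiece] at hη ⊢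
  intro k
  rw [add_assoc]
  exact push_mem_chainPiece _ (cross_mem_chainPiece ha (hη k))

lemma mix_normalized {η : TotalChain UnitAddCircle} (hη : η ∈ normalized _) (a : Chain X) :
    mix X η a ∈ normalized X := by
  rw [mem_normalized] at hη ⊢
  intro k
  rcases k with _ | k
  · trivial
  · intro i
    have := hη (k + 1) i
    rw [codegenChain] at this
    rw [mix_apply, codegenChain, ← mix_push a (codegenMap UnitAddCircle i) _ (fun x z => rfl), this,
      map_zero, map_zero]

lemma cofaceSum_mix (k : ℕ) (a : Chain X) (c : Chain (UnitAddCircle × Simplex k)) :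
    cofaceSum X k (push (mixMap X k) (cross a c)) =
      push (mixMap X (k + 1)) (cross a (cofaceSum UnitAddCircle k c)) := by
  simp only [cofaceSum_apply, map_sum, map_smul]
  refine Finset.sum_congr rfl fun i _ => congrArg _ ?_
  exact (mix_push a (cofaceMap UnitAddCircle i) _ (fun x z => rfl) c).symm

lemma connesChain_mix (k : ℕ) (a : Chain X) (c : Chain (UnitAddCircle × Simplex (k + 1))) :
    push (mixMap X k) (cross a (connesChain UnitAddCircle k c)) =
      connesChain X k (push (mixMap X (k + 1)) (cross a c)) := by
  refine map_connesChain (fun k => push (mixMap X k) ∘ₗ cross a) (fun k c => ?_) (fun k c => ?_) k c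
  · simp only [lam_apply, map_smul, LinearMap.comp_apply]
    rw [mix_push a _ (cycSpace X k) (fun x z => Prod.ext ?_ rfl) c]
    exact (vadd_vadd _ _ _).symm
  · simp only [extraChain, LinearMap.comp_apply]
    rw [mix_push a _ (extraMap X k) (fun x z => Prod.ext ?_ rfl) c]
    exact (vadd_vadd _ _ _).symm

lemma totalB_mix (η : TotalChain UnitAddCircle) (a : Chain X) :
    totalB X (mix X η a) = mix X η (boundary X a) + mix X (totalB _ η) (parity X a) := by
  funext k
  rw [Pi.add_apply]
  rcases k with _ | k
  · rw [totalB_zero, mix_apply, mix_apply, mix_apply, totalB_zero, boundary_push, boundary_cross,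
      map_add]
  · rw [totalB_succ, mix_apply, mix_apply, mix_apply, mix_apply, totalB_succ, boundary_push,
      boundary_cross, parity_push, parity_cross, cofaceSum_mix]
    simp only [map_add, map_smul]
    rw [add_assoc]

lemma connesB_mix (η : TotalChain UnitAddCircle) (a : Chain X) :
    connesB X (mix X η a) = mix X (connesB _ η) (parity X a) := by
  funext k
  rw [connesB_apply, mix_apply, mix_apply, connesB_apply, parity_push, parity_cross, map_smul,
    map_smul, connesChain_mix]

/-- Moving [S¹] past a costs (-1)^{|a|}, which `parity` supplies; afterwards the order of the two
rotations of x is immaterial. -/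
lemma mix_totalJ (η : TotalChain UnitAddCircle) (a : Chain X) :
    mix X (totalJ _ η) (parity X a) = mix X η (rotation (action X) a) := by
  funext k
  rw [mix_apply, mix_apply, totalJ_apply, rotation_apply, rotation_apply, cross_push_right,
    ← cross_assoc, ← cross_fundCycle_comm, cross_push_left, cross_push_left, push_push, push_push,
    push_push, push_push]
  refine congrArg (fun f => push f _) (ContinuousMap.ext fun w => Prod.ext ?_ rfl)
  change (w.1.1 +ᵥ w.2.1) +ᵥ w.1.2 = w.2.1 +ᵥ (w.1.1 +ᵥ w.1.2)
  rw [vadd_vadd, add_comm]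
  rfl

lemma inftyMap_isInftyMorphism {ξ : ℕ → TotalChain UnitAddCircle} (hξ : IsCircleSequence ξ) :
    MixedData.IsInftyMorphism (singularMixed X) (cocyclicMixed X) (inftyMap X ξ) where
  mem i _ x hx := ⟨mix_mem (hξ.mem i).1 hx, mix_normalized (hξ.mem i).2 x⟩
  zero _ x _ := by
    change totalB X (mix X _ x) = mix X _ (boundary X x)
    rw [totalB_mix, hξ.zero]
    simp
  succ i _ x _ := by
    change connesB X (mix X _ x) + totalB X (mix X _ x) =
      mix X _ (rotation (action X) x) + mix X _ (boundary X x)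
    -- The terms with Bξ^i cancel, and the remaining part Jξ^i of bξ^{i+1} becomes f_i(Ja).
    rw [totalB_mix, connesB_mix, hξ.succ, map_sub, LinearMap.sub_apply, mix_totalJ]
    abel

end Mix

end CocyclicChains

end

noncomputable section

namespace CocyclicChains

/-! ### Acyclicity of the normalized columns -/

section Columns

variable {X Y Z : Type*} [TopologicalSpace X] [TopologicalSpace Y] [TopologicalSpace Z]

lemma push_prism {X' Y' : Type*} [TopologicalSpace X'] [TopologicalSpace Y']
    (H : C(X × Simplex 1, Y)) (H' : C(X' × Simplex 1, Y')) (f : C(X, X')) (g : C(Y, Y'))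
    (h : ∀ x s, g (H (x, s)) = H' (f x, s)) (a : Chain X) :
    push g (prism H a) = prism H' (push f a) := by
  rw [prism_apply, prism_apply, parity_push, cross_push_left, push_push, push_push]
  exact congrArg (fun f => push f _) (ContinuousMap.ext fun w => h w.1 w.2)

lemma endpoint_zero_val : (endpoint 0).1 0 = 0 := by
  simp [endpoint, coface, coord]

lemma endpoint_one_val : (endpoint 1).1 0 = 1 := by
  simp [endpoint, coface, coord]

/-- The linear contraction of `Δ^k` to the point `(0, …, 0)`. -/
def contraction (X : Type*) [TopologicalSpace X] (k : ℕ) :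
    C((X × Simplex k) × Simplex 1, X × Simplex k) where
  toFun w := (w.1.1, ⟨fun j => w.2.1 0 * w.1.2.1 j,
    fun _ _ h => mul_le_mul_of_nonneg_left (w.1.2.2.1 h) (w.2.2.2 0).1,
    fun j => ⟨mul_nonneg (w.2.2.2 0).1 (w.1.2.2.2 j).1,
      mul_le_one₀ (w.2.2.2 0).2 (w.1.2.2.2 j).1 (w.1.2.2.2 j).2⟩⟩)
  continuous_toFun := by
    refine (continuous_fst.comp continuous_fst).prodMk
      (Continuous.subtype_mk (continuous_pi fun j => ?_) _)
    exact ((continuous_apply 0).comp (continuous_subtype_val.comp continuous_snd)).mul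
      ((continuous_apply j).comp
        (continuous_subtype_val.comp (continuous_snd.comp continuous_fst)))

lemma contraction_endpoint_one (k : ℕ) :
    (contraction X k).comp (slice _ (endpoint 1)) = ContinuousMap.id _ := by
  refine ContinuousMap.ext fun w => Prod.ext rfl (Subtype.ext (funext fun j => ?_))
  change (endpoint 1).1 0 * w.2.1 j = w.2.1 j
  rw [endpoint_one_val, one_mul]

/-- The contraction ends in a map constant on the simplex, which factors through σ_0; this requires
a simplex of positive dimension. -/
lemma push_contraction_endpoint_zero {k : ℕ} {c : Chain (X × Simplex (k + 1))}
    (hc : IsNormalized X (k + 1) c) :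
    push ((contraction X (k + 1)).comp (slice _ (endpoint 0))) c = 0 := by
  let z : C(X × Simplex k, X × Simplex (k + 1)) :=
    (ContinuousMap.id X).prodMap (ContinuousMap.const _ ⟨fun _ => 0, fun _ _ _ => le_rfl,
      fun _ => ⟨le_rfl, zero_le_one⟩⟩)
  have h : (contraction X (k + 1)).comp (slice _ (endpoint 0)) = z.comp (codegenMap X 0) := by
    refine ContinuousMap.ext fun w => Prod.ext rfl (Subtype.ext (funext fun j => ?_))
    change (endpoint 0).1 0 * w.2.1 j = 0
    rw [endpoint_zero_val, zero_mul]
  have h0 := hc 0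
  rw [codegenChain] at h0
  rw [h, ← push_push, h0, map_zero]

lemma boundary_prism_contraction {k : ℕ} {c : Chain (X × Simplex (k + 1))}
    (hc : IsNormalized X (k + 1) c) (hb : boundary _ c = 0) :
    boundary _ (-prism (contraction X (k + 1)) c) = c := by
  have := boundary_prism (contraction X (k + 1)) c
  rw [hb, map_zero, add_zero, push_contraction_endpoint_zero hc, contraction_endpoint_one,
    push_id, zero_sub] at this
  rw [map_neg, this, neg_neg]

/-- Scaling all coordinates commutes with forgetting one of them. -/
lemma IsNormalized.prism {k : ℕ} {c : Chain (X × Simplex (k + 1))}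
    (hc : IsNormalized X (k + 1) c) :
    IsNormalized X (k + 1) (prism (contraction X (k + 1)) c) := by
  intro i
  have h0 := hc i
  rw [codegenChain] at h0
  rw [codegenChain, push_prism _ (contraction X k) (codegenMap X i) _ (fun w s => rfl), h0, map_zero]

/-- The recursively defined primitive of a cycle whose zeroth component is a boundary. -/
def primitive (y : TotalChain X) (e : Chain (X × Simplex 0)) : TotalChain X
  | 0 => e
  | k + 1 => - prism (contraction X (k + 1))
      (y (k + 1) - (-1 : ℝ) ^ k • cofaceSum X k (parity _ (primitive y e k)))

/-- Solves ∂w_{k+1} = y_{k+1} - δw_k one column at a time, starting from w_0 = e. Each right-hand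
side is a normalized ∂-cycle, so the contraction gives an explicit solution. Infinitely many nonzero
components are allowed, since the complex is a product. -/
lemma exists_totalB_eq {n : ℤ} {y : TotalChain X} (hy : y ∈ totalPiece X n)
    (hn : y ∈ normalized X) (hb : totalB X y = 0) {e : Chain (X × Simplex 0)}
    (he : e ∈ chainPiece (X × Simplex 0) (n + 1)) (hey : boundary _ e = y 0) :
    ∃ w ∈ totalPiece X (n + 1) ⊓ normalized X, totalB X w = y := by
  rw [mem_totalPiece] at hy
  rw [mem_normalized] at hn
  set w := primitive y e with hw
  have key : ∀ k, w k ∈ chainPiece (X × Simplex k) (n + 1 + k) ∧ IsNormalized X k (w k) ∧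
      totalB X w k = y k := by
    intro k
    induction k with
    | zero => exact ⟨by simpa [hw, primitive] using he, trivial, hey⟩
    | succ k ih =>
      obtain ⟨h1, h2, h3⟩ := ih
      set r := y (k + 1) - (-1 : ℝ) ^ k • cofaceSum X k (parity _ (w k)) with hr
      have hw' : w (k + 1) = - prism (contraction X (k + 1)) r := rfl
      have hrn : IsNormalized X (k + 1) r := by
        rw [hr, sub_eq_add_neg, ← neg_smul]
        exact (hn (k + 1)).add ((h2.parity.cofaceSum).smul _)
      have hrm : r ∈ chainPiece (X × Simplex (k + 1)) (n + (k + 1 : ℕ)) := by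
        refine Submodule.sub_mem _ (hy (k + 1)) (Submodule.smul_mem _ _ (cofaceSum_mem ?_))
        have := parity_mem_chainPiece h1
        have e : n + ((k + 1 : ℕ) : ℤ) = n + 1 + k := by push_cast; ring
        rwa [e]
      have hrb : boundary _ r = 0 := by
        have hyk := congrFun hb (k + 1)
        rw [totalB_succ, Pi.zero_apply] at hyk
        -- The component y_k is ∂w_k plus a coface term from w_{k-1}, which δ kills because the
        -- coface sum squares to zero.
        have hdp : cofaceSum X k (parity _ (boundary _ (w k))) =
            cofaceSum X k (parity _ (y k)) := by
          rcases k with _ | k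
          · rw [← h3, totalB_zero]
          · rw [← h3, totalB_succ, map_add, map_add, map_smul, cofaceSum_parity, map_smul,
              cofaceSum_cofaceSum, smul_zero, add_zero]
        rw [hr, map_sub, map_smul, cofaceSum_boundary, boundary_parity, map_neg, hdp, smul_neg,
          sub_neg_eq_add, hyk]
      refine ⟨?_, ?_, ?_⟩
      · rw [hw']
        have := prism_mem_chainPiece (contraction X (k + 1)) hrm
        rw [add_right_comm] at this
        exact Submodule.neg_mem _ this
      · rw [hw', ← neg_one_smul ℝ]
        exact hrn.prism.smul _
      · rw [totalB_succ, hw', boundary_prism_contraction hrn hrb, hr, sub_add_cancel]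
  exact ⟨w, ⟨mem_totalPiece.2 fun k => (key k).1, mem_normalized.2 fun k => (key k).2.1⟩,
    funext fun k => (key k).2.2⟩

end Columns

/-! ### Zero-chains of the circle -/

/-- The base point of `S¹ × Δ^0` as a zero-simplex. -/
def basePoint : Chain (UnitAddCircle × Simplex 0) :=
  Finsupp.single ⟨0, ContinuousMap.const _ (0, simplexPoint)⟩ 1

lemma exists_boundary_eq_of_zero_chain {ζ : Chain (UnitAddCircle × Simplex 0)}
    (hζ : ζ ∈ chainPiece (UnitAddCircle × Simplex 0) 0) :
    ∃ γ ∈ chainPiece (UnitAddCircle × Simplex 0) 1,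
      boundary _ γ = ζ - augmentation _ ζ • basePoint := by
  have h := map_mem_of_mem_chainPiece
    (LinearMap.id - (augmentation (UnitAddCircle × Simplex 0)).smulRight basePoint)
    ((chainPiece (UnitAddCircle × Simplex 0) 1).map (boundary _)) (fun p τ hp => ?_) hζ
  · exact h
  obtain rfl : p = 0 := by exact_mod_cast hp
  obtain ⟨r, hr⟩ := QuotientAddGroup.mk_surjective (τ simplexPoint).1
  let σ : C(Simplex 1, UnitAddCircle × Simplex 0) :=
    ⟨fun t => (((t.1 0 * r : ℝ) : UnitAddCircle), simplexPoint),
      ((AddCircle.continuous_mk' 1).comp (((continuous_apply 0).comp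
        continuous_subtype_val).mul continuous_const)).prodMk continuous_const⟩
  -- The boundary of σ, the image of the segment from 0 to r, is its starting point minus its end
  -- point, hence the minus sign.
  refine ⟨- Finsupp.single ⟨1, σ⟩ 1, Submodule.neg_mem _ (single_mem_chainPiece _ (by simp) _), ?_⟩
  have h0 : σ.comp (coface 0) = ContinuousMap.const _ (0, simplexPoint) := by
    refine ContinuousMap.ext fun t => Prod.ext ?_ (Subsingleton.elim _ _)
    rw [Subsingleton.elim t simplexPoint]
    change (((endpoint 0).1 0 * r : ℝ) : UnitAddCircle) = 0
    rw [endpoint_zero_val, zero_mul]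
    rfl
  have h1 : σ.comp (coface 1) = τ := by
    refine ContinuousMap.ext fun t => Prod.ext ?_ (Subsingleton.elim _ _)
    rw [Subsingleton.elim t simplexPoint]
    change (((endpoint 1).1 0 * r : ℝ) : UnitAddCircle) = (τ simplexPoint).1
    rw [endpoint_one_val, one_mul]
    exact hr
  rw [map_neg, boundary_single_succ]
  simp only [Fin.sum_univ_succ, Fin.val_zero, pow_zero, one_smul, Fin.val_succ, zero_add, pow_one,
    neg_smul, Finset.univ_eq_empty, Finset.sum_empty, add_zero]
  change -((Finsupp.single ⟨0, σ.comp (coface 0)⟩ 1 : Chain (UnitAddCircle × Simplex 0)) +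
    -(Finsupp.single ⟨0, σ.comp (coface 1)⟩ 1 : Chain (UnitAddCircle × Simplex 0))) = _
  rw [h0, h1]
  simp only [LinearMap.sub_apply, LinearMap.id_apply, LinearMap.smulRight_apply, augmentation,
    Finsupp.linearCombination_single, basePoint, if_true, smul_eq_mul, mul_one, one_smul]
  abel

/-! ### Quasi-isomorphisms -/

namespace MixedData

variable {V W : Type*} [AddCommGroup V] [Module ℝ V] [AddCommGroup W] [Module ℝ W]

lemma isQuasiIso_of_cycles {C : MixedData V} {D : MixedData W} {g : V →ₗ[ℝ] W}
    (hg : IsChainMap C D g)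
    (inj : ∀ n : ℤ, ∀ x ∈ C.piece n, C.b x = 0 → ∀ y ∈ D.piece (n + 1), D.b y = g x →
      ∃ w ∈ C.piece (n + 1), C.b w = x)
    (surj : ∀ n : ℤ, ∀ y ∈ D.piece n, D.b y = 0 → ∃ x ∈ C.piece n, C.b x = 0 ∧
      ∃ w ∈ D.piece (n + 1), D.b w = g x - y) : IsQuasiIso C D g := by
  refine ⟨hg, fun n => ?_⟩
  constructor
  · rw [injective_iff_map_eq_zero]
    intro x
    obtain ⟨x, rfl⟩ := Submodule.Quotient.mk_surjective _ x
    obtain ⟨x, hx, hbx⟩ := x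
    intro h
    have h' : g x ∈ D.boundaries n := by
      have := (Submodule.Quotient.mk_eq_zero _).1 h
      exact this
    obtain ⟨y, hy, hyx⟩ := h'
    obtain ⟨w, hw, hwx⟩ := inj n x hx hbx y hy hyx
    exact (Submodule.Quotient.mk_eq_zero _).2 ⟨w, hw, hwx⟩
  · intro y
    obtain ⟨y, rfl⟩ := Submodule.Quotient.mk_surjective _ y
    obtain ⟨y, hy, hby⟩ := y
    obtain ⟨x, hx, hbx, w, hw, hwy⟩ := surj n y hy hby
    refine ⟨Submodule.Quotient.mk ⟨x, hx, hbx⟩, ?_⟩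
    exact (Submodule.Quotient.eq _).2 ⟨w, hw, hwy⟩

end MixedData

section QuasiIso

variable {X : Type*} [TopologicalSpace X]

lemma push_fst_slice {Y : Type*} [TopologicalSpace Y] (y : Y) (a : Chain X) :
    push ContinuousMap.fst (push (slice X y) a) = a := by
  rw [push_push]
  exact push_id a

lemma push_slice_fst (c : Chain (X × Simplex 0)) :
    push (slice X simplexPoint) (push ContinuousMap.fst c) = c := by
  rw [push_push]
  have : (slice X simplexPoint).comp ContinuousMap.fst = ContinuousMap.id (X × Simplex 0) :=
    ContinuousMap.ext fun w => Prod.ext rfl (Subsingleton.elim _ _)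
  rw [this, push_id]

variable [AddAction UnitAddCircle X] [ContinuousVAdd UnitAddCircle X]

/-- The product with a cycle depends on ζ only up to homology, and for the base point it is the
inclusion of X, because 0 acts trivially. -/
lemma mix_cross_boundary (γ : Chain (UnitAddCircle × Simplex 0))
    {ζ : Chain (UnitAddCircle × Simplex 0)} (hγ : boundary _ γ = ζ - basePoint) {a : Chain X}
    (ha : boundary X a = 0) :
    push (mixMap X 0) (cross a ζ) =
      push (slice X simplexPoint) a + boundary _ (push (mixMap X 0) (cross (parity X a) γ)) := by
  have h0 : (mixMap X 0).comp (slice X (0, simplexPoint)) = slice X simplexPoint :=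
    ContinuousMap.ext fun x => Prod.ext (zero_vadd _ _) rfl
  rw [boundary_push, boundary_cross, boundary_parity, ha, parity_parity, hγ, map_sub, basePoint,
    cross_point, map_zero, neg_zero, map_zero, LinearMap.zero_apply, zero_add, map_sub, push_push,
    ContinuousMap.const_apply, h0]
  abel

lemma inftyMap_zero_isQuasiIso {ξ : ℕ → TotalChain UnitAddCircle} (hξ : IsCircleSequence ξ) :
    MixedData.IsQuasiIso (singularMixed X) (cocyclicMixed X) (inftyMap X ξ 0) := by
  have hinf := inftyMap_isInftyMorphism (X := X) hξ
  have hζ : ξ 0 0 ∈ chainPiece (UnitAddCircle × Simplex 0) 0 := by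
    simpa using mem_totalPiece.1 (hξ.mem 0).1 0
  obtain ⟨γ, hγ, hγb⟩ := exists_boundary_eq_of_zero_chain hζ
  rw [hξ.aug, one_smul] at hγb
  refine MixedData.isQuasiIso_of_cycles
    ⟨fun n x hx => by simpa using hinf.mem 0 n x hx, hinf.zero⟩ ?_ ?_
  · intro n a ha hb c hc hca
    change boundary X a = 0 at hb
    have h0 : boundary _ (c 0) = push (mixMap X 0) (cross a (ξ 0 0)) := congrFun hca 0
    rw [mix_cross_boundary γ hγb hb] at h0
    -- Only the column k = 0 matters: there a is the boundary of c_0 minus the correction replacing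
    -- ξ^0_0 by the base point.
    refine ⟨push ContinuousMap.fst (c 0 - push (mixMap X 0) (cross (parity X a) γ)),
      push_mem_chainPiece _ (Submodule.sub_mem _ ?_ (push_mem_chainPiece _
        (cross_mem_chainPiece (parity_mem_chainPiece ha) hγ))), ?_⟩
    · simpa using mem_totalPiece.1 hc.1 0
    · change boundary X _ = a
      rw [boundary_push, map_sub, h0, add_sub_cancel_right, push_fst_slice]
  · intro n c hc hb
    have hc0 : c 0 ∈ chainPiece (X × Simplex 0) n := by simpa using mem_totalPiece.1 hc.1 0
    have hb0 : boundary _ (c 0) = 0 := congrFun hb 0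
    have ha := push_mem_chainPiece (ContinuousMap.fst : C(X × Simplex 0, X)) hc0
    have hba : boundary X (push (ContinuousMap.fst : C(X × Simplex 0, X)) (c 0)) = 0 := by
      rw [boundary_push, hb0, map_zero]
    refine ⟨push ContinuousMap.fst (c 0), ha, hba, ?_⟩
    set a := push (ContinuousMap.fst : C(X × Simplex 0, X)) (c 0) with ha_def
    have hfa : inftyMap X ξ 0 a ∈ (cocyclicMixed X).piece n := by
      simpa using hinf.mem 0 n a ha
    -- The class is represented by the projection a of c_0: f_0(a) and c are cycles whose components
    -- at k = 0 differ by a boundary, so they are homologous.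
    refine exists_totalB_eq (Submodule.sub_mem _ hfa.1 hc.1) (Submodule.sub_mem _ hfa.2 hc.2) ?_
      (e := push (mixMap X 0) (cross (parity X a) γ))
      (push_mem_chainPiece _ (cross_mem_chainPiece (parity_mem_chainPiece ha) hγ)) ?_
    · have h1 : totalB X (inftyMap X ξ 0 a) = inftyMap X ξ 0 (boundary X a) := hinf.zero n a ha
      have h2 : totalB X c = 0 := hb
      rw [map_sub, h1, hba, map_zero, h2, sub_zero]
    · change _ = push (mixMap X 0) (cross a (ξ 0 0)) - c 0
      rw [mix_cross_boundary γ hγb hba, ha_def, push_slice_fst, add_sub_cancel_left]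

lemma inftyMap_isInftyQuasiIso {ξ : ℕ → TotalChain UnitAddCircle} (hξ : IsCircleSequence ξ) :
    MixedData.IsInftyQuasiIso (singularMixed X) (cocyclicMixed X) (inftyMap X ξ) :=
  ⟨inftyMap_isInftyMorphism hξ, inftyMap_zero_isQuasiIso hξ⟩

end QuasiIso

end CocyclicChains

end

noncomputable section

namespace CocyclicChains

/-! ### Acyclicity of the real line -/

section Contractible

variable {X : Type*} [TopologicalSpace X]

/-- The unique singular simplex of dimension `m` of a point. -/
def pointSimplex (m : ℕ) : Chain (Simplex 0) :=
  Finsupp.single ⟨m, ContinuousMap.const _ simplexPoint⟩ 1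

lemma pointSimplex_mem (m : ℕ) : pointSimplex m ∈ chainPiece (Simplex 0) m :=
  single_mem_chainPiece _ rfl _

/-- All m + 2 faces coincide, so the alternating sum is 0 or 1 according to parity. -/
lemma boundary_pointSimplex (m : ℕ) :
    boundary _ (pointSimplex (m + 1)) = if Even m then 0 else pointSimplex m := by
  rw [pointSimplex, boundary_single_succ]
  have h : ∀ i : Fin (m + 2), (ContinuousMap.const (Simplex (m + 1)) simplexPoint).comp (coface i) =
      ContinuousMap.const _ simplexPoint := fun i => rfl
  simp only [h]
  rw [← Finset.sum_smul, Fin.sum_univ_eq_sum_range (fun i => (-1 : ℝ) ^ i), neg_one_geom_sum]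
  simp only [Nat.even_add, even_two, iff_true]
  split_ifs
  · rw [zero_smul]
  · rw [one_smul, pointSimplex]

lemma exists_eq_smul_pointSimplex {m : ℕ} {a : Chain (Simplex 0)}
    (ha : a ∈ chainPiece (Simplex 0) m) : ∃ c : ℝ, c • pointSimplex m = a := by
  have := map_mem_of_mem_chainPiece LinearMap.id (Submodule.span ℝ {pointSimplex m})
    (fun p σ hp => ?_) ha
  · exact Submodule.mem_span_singleton.1 this
  · obtain rfl : p = m := by exact_mod_cast hp
    refine Submodule.mem_span_singleton.2 ⟨1, ?_⟩
    have : σ = ContinuousMap.const _ simplexPoint :=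
      ContinuousMap.ext fun t => Subsingleton.elim _ _
    rw [one_smul, this]
    rfl

lemma exists_boundary_eq_of_point {m : ℕ} {a : Chain (Simplex 0)}
    (ha : a ∈ chainPiece (Simplex 0) (m + 1)) (hb : boundary _ a = 0) :
    ∃ v ∈ chainPiece (Simplex 0) (m + 1 + 1), boundary _ v = a := by
  obtain ⟨c, rfl⟩ := exists_eq_smul_pointSimplex (m := m + 1) (by exact_mod_cast ha)
  by_cases hm : Even m
  · have hm' : ¬ Even (m + 1) := by rwa [Nat.even_add_one, not_not]
    refine ⟨c • pointSimplex (m + 1 + 1),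
      Submodule.smul_mem _ _ (by exact_mod_cast pointSimplex_mem (m + 1 + 1)), ?_⟩
    rw [map_smul, boundary_pointSimplex, if_neg hm']
  · rw [map_smul, boundary_pointSimplex, if_neg hm] at hb
    have hc : c = 0 := by
      simpa [pointSimplex] using hb
    exact ⟨0, Submodule.zero_mem _, by rw [hc, zero_smul, map_zero]⟩

/-- The prism compares a with its image at x₀, which comes from a point. The degree must be
positive, since H_0 of a point is not zero. -/
lemma exists_boundary_eq_of_contraction (H : C(X × Simplex 1, X)) (x₀ : X)
    (h0 : ∀ x, H (x, endpoint 0) = x₀) (h1 : ∀ x, H (x, endpoint 1) = x) {m : ℕ} {a : Chain X}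
    (ha : a ∈ chainPiece X (m + 1)) (hb : boundary _ a = 0) :
    ∃ v ∈ chainPiece X (m + 1 + 1), boundary _ v = a := by
  let q : C(X, Simplex 0) := ContinuousMap.const _ simplexPoint
  let j : C(Simplex 0, X) := ContinuousMap.const _ x₀
  obtain ⟨v, hv, hvb⟩ := exists_boundary_eq_of_point (push_mem_chainPiece q ha)
    (by rw [boundary_push, hb, map_zero])
  refine ⟨push j v - prism H a, Submodule.sub_mem _ (push_mem_chainPiece j hv)
    (prism_mem_chainPiece H ha), ?_⟩
  have e0 : H.comp (slice X (endpoint 0)) = j.comp q := ContinuousMap.ext h0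
  have e1 : H.comp (slice X (endpoint 1)) = ContinuousMap.id X := ContinuousMap.ext h1
  have := boundary_prism H a
  rw [hb, map_zero, add_zero, e0, e1, push_id, ← push_push] at this
  rw [map_sub, this, boundary_push, hvb, sub_sub_cancel]

lemma exists_boundary_eq_real {m : ℕ} {a : Chain ℝ} (ha : a ∈ chainPiece ℝ (m + 1))
    (hb : boundary _ a = 0) : ∃ v ∈ chainPiece ℝ (m + 1 + 1), boundary _ v = a := by
  refine exists_boundary_eq_of_contraction ⟨fun w => w.2.1 0 * w.1,
    Continuous.mul ((continuous_apply 0).comp (continuous_subtype_val.comp continuous_snd))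
      continuous_fst⟩ 0
    (fun x => ?_) (fun x => ?_) ha hb
  · change (endpoint 0).1 0 * x = 0
    rw [endpoint_zero_val, zero_mul]
  · change (endpoint 1).1 0 * x = x
    rw [endpoint_one_val, one_mul]

end Contractible

/-! ### Singular chains of the universal covering of the circle -/

section Covering

/-- The universal covering `ℝ → S¹`. -/
def coverMap : C(ℝ, UnitAddCircle) := ⟨fun x => (x : UnitAddCircle), AddCircle.continuous_mk' 1⟩

lemma isCoveringMap_coverMap : IsCoveringMap coverMap := AddCircle.isCoveringMap_coe (1 : ℝ)

/-- Translation by `r`. -/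
def shift (r : ℝ) : C(ℝ, ℝ) := ⟨fun x => x + r, by fun_prop⟩

lemma coverMap_comp_shift_int (n : ℤ) : coverMap.comp (shift n) = coverMap := by
  refine ContinuousMap.ext fun x => ?_
  change ((x + n : ℝ) : UnitAddCircle) = x
  have : ((n : ℝ) : UnitAddCircle) = 0 := (AddCircle.coe_eq_zero_iff 1).2 ⟨n, by simp⟩
  rw [AddCircle.coe_add, this, add_zero]

lemma coverMap_eq_iff {x y : ℝ} (h : coverMap x = coverMap y) : ∃ n : ℤ, x + n = y := by
  have h' : ((y - x : ℝ) : UnitAddCircle) = 0 := by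
    rw [AddCircle.coe_sub]
    exact sub_eq_zero.2 h.symm
  obtain ⟨n, hn⟩ := (AddCircle.coe_eq_zero_iff 1).1 h'
  refine ⟨n, ?_⟩
  rw [zsmul_eq_mul, mul_one] at hn
  rw [hn, add_sub_cancel]

instance preconnectedSpace_simplex (m : ℕ) : PreconnectedSpace (Simplex m) := by
  refine Subtype.preconnectedSpace (Convex.isPreconnected ?_)
  rintro x ⟨hx, hx'⟩ y ⟨hy, hy'⟩ a b ha hb hab
  refine ⟨(hx.const_mul ha).add (hy.const_mul hb), fun i => convex_Icc (0 : ℝ) 1 (hx' i) (hy' i)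
    ha hb hab⟩

/-- The vertex `(0, …, 0)` of `Δ^m`. -/
def originVertex (m : ℕ) : Simplex m :=
  ⟨fun _ => 0, fun _ _ _ => le_rfl, fun _ => ⟨le_rfl, zero_le_one⟩⟩

/-- The linear contraction of `Δ^m`, parametrized by the unit interval. -/
def scaling (m : ℕ) : C(unitInterval × Simplex m, Simplex m) where
  toFun w := ⟨fun j => w.1 * w.2.1 j,
    fun _ _ h => mul_le_mul_of_nonneg_left (w.2.2.1 h) w.1.2.1,
    fun j => ⟨mul_nonneg w.1.2.1 (w.2.2.2 j).1, mul_le_one₀ w.1.2.2 (w.2.2.2 j).1 (w.2.2.2 j).2⟩⟩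
  continuous_toFun := by
    refine Continuous.subtype_mk (continuous_pi fun j => ?_) _
    exact (continuous_subtype_val.comp continuous_fst).mul
      ((continuous_apply j).comp (continuous_subtype_val.comp continuous_snd))

/-- Scaling Δ^m makes σ the end of a homotopy that starts at a constant map. The constant lifts,
hence so does the homotopy, and its value at time 1 lifts σ. -/
lemma exists_lift {m : ℕ} (σ : C(Simplex m, UnitAddCircle)) :
    ∃ τ : C(Simplex m, ℝ), coverMap.comp τ = σ := by
  obtain ⟨r, hr⟩ := QuotientAddGroup.mk_surjective (σ (originVertex m))
  have h0 : ∀ t, σ.comp (scaling m) (0, t) = coverMap (ContinuousMap.const (Simplex m) r t) := by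
    intro t
    refine Eq.trans ?_ hr.symm
    refine congrArg σ (Subtype.ext (funext fun j => ?_))
    exact zero_mul _
  refine ⟨(isCoveringMap_coverMap.liftHomotopy (σ.comp (scaling m)) (.const _ r) h0).comp
    ((ContinuousMap.const _ 1).prodMk (ContinuousMap.id _)), ContinuousMap.ext fun t => ?_⟩
  refine (congrFun (isCoveringMap_coverMap.liftHomotopy_lifts _ _ h0) (1, t)).trans ?_
  refine congrArg σ (Subtype.ext (funext fun j => ?_))
  exact one_mul _

/-- At one vertex the lifts differ by an integer translation; since Δ^m is connected, they then
agree everywhere. -/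
lemma exists_eq_shift_comp {m : ℕ} {σ τ : C(Simplex m, ℝ)}
    (h : coverMap.comp σ = coverMap.comp τ) : ∃ n : ℤ, (shift n).comp σ = τ := by
  obtain ⟨n, hn⟩ := coverMap_eq_iff (DFunLike.congr_fun h (originVertex m))
  refine ⟨n, DFunLike.coe_injective ?_⟩
  refine isCoveringMap_coverMap.eq_of_comp_eq ((shift n).comp σ).continuous τ.continuous ?_
    (originVertex m) hn
  change ⇑(coverMap.comp ((shift n).comp σ)) = ⇑(coverMap.comp τ)
  rw [← ContinuousMap.comp_assoc, coverMap_comp_shift_int, h]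

/-- A lift of a singular simplex of the circle. -/
def liftSimplex {m : ℕ} (σ : C(Simplex m, UnitAddCircle)) : C(Simplex m, ℝ) :=
  (exists_lift σ).choose

lemma coverMap_comp_liftSimplex {m : ℕ} (σ : C(Simplex m, UnitAddCircle)) :
    coverMap.comp (liftSimplex σ) = σ := (exists_lift σ).choose_spec

/-- The linear extension of `liftSimplex`. -/
def liftChain : Chain UnitAddCircle →ₗ[ℝ] Chain ℝ :=
  Finsupp.linearCombination ℝ fun s => Finsupp.single ⟨s.1, liftSimplex s.2⟩ 1

lemma liftChain_single {m : ℕ} (σ : C(Simplex m, UnitAddCircle)) :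
    liftChain (Finsupp.single ⟨m, σ⟩ 1) = Finsupp.single ⟨m, liftSimplex σ⟩ 1 := by
  rw [liftChain, Finsupp.linearCombination_single, one_smul]

lemma liftChain_mem {n : ℤ} {a : Chain UnitAddCircle} (ha : a ∈ chainPiece UnitAddCircle n) :
    liftChain a ∈ chainPiece ℝ n :=
  map_mem_of_mem_chainPiece _ _ (fun p σ hp => by
    rw [liftChain_single]; exact single_mem_chainPiece _ hp _) ha

lemma push_liftChain (a : Chain UnitAddCircle) : push coverMap (liftChain a) = a := by
  induction a using chain_induction with
  | zero => simp
  | add x y hx hy => rw [map_add, map_add, hx, hy]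
  | smul c x hx => rw [map_smul, map_smul, hx]
  | single p σ => rw [liftChain_single, push_single, coverMap_comp_liftSimplex]

/-- The operator `1 - T_*`, where `T` is the generator of the group of deck transformations. -/
def deckDiff : Chain ℝ →ₗ[ℝ] Chain ℝ := LinearMap.id - push (shift 1)

lemma deckDiff_apply (a : Chain ℝ) : deckDiff a = a - push (shift 1) a := rfl

lemma boundary_deckDiff (a : Chain ℝ) : boundary _ (deckDiff a) = deckDiff (boundary _ a) := by
  rw [deckDiff_apply, deckDiff_apply, map_sub, boundary_push]

lemma push_deckDiff (a : Chain ℝ) : push coverMap (deckDiff a) = 0 := by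
  have := coverMap_comp_shift_int 1
  rw [Int.cast_one] at this
  rw [deckDiff_apply, map_sub, push_push, this, sub_self]

/-- 1 - Tⁿ is divisible by 1 - T: the difference telescopes through the intermediate translates, in
either direction. -/
lemma single_sub_single_shift_mem {m : ℕ} {k : ℤ} (σ : C(Simplex m, ℝ)) (hm : (m : ℤ) = k) (n : ℤ) :
    (Finsupp.single ⟨m, σ⟩ 1 - Finsupp.single ⟨m, (shift n).comp σ⟩ 1 : Chain ℝ) ∈
      (chainPiece ℝ k).map deckDiff := by
  have step : ∀ n : ℤ, (Finsupp.single ⟨m, (shift n).comp σ⟩ 1 -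
      Finsupp.single ⟨m, (shift (n + 1 : ℤ)).comp σ⟩ 1 : Chain ℝ) ∈
        (chainPiece ℝ k).map deckDiff := by
    intro n
    refine ⟨_, single_mem_chainPiece ((shift n).comp σ) hm 1, ?_⟩
    rw [deckDiff_apply, push_single, ← ContinuousMap.comp_assoc]
    have : (shift 1).comp (shift n) = shift (n + 1 : ℤ) := by
      refine ContinuousMap.ext fun x => ?_
      change x + n + 1 = x + ((n + 1 : ℤ) : ℝ)
      push_cast
      ring
    rw [this]
  induction n using Int.induction_on with
  | zero =>
    have : shift ((0 : ℤ) : ℝ) = ContinuousMap.id ℝ := by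
      refine ContinuousMap.ext fun x => ?_
      change x + ((0 : ℤ) : ℝ) = x
      simp
    rw [this, ContinuousMap.id_comp, sub_self]
    exact Submodule.zero_mem _
  | succ i ih =>
    have := Submodule.add_mem _ ih (step i)
    rwa [sub_add_sub_cancel] at this
  | pred i ih =>
    have := Submodule.sub_mem _ ih (step (-i - 1))
    rwa [sub_add_cancel, Int.cast_neg, Int.cast_natCast, sub_sub_sub_cancel_right] at this

/-- Exactness in the middle: a simplex and the chosen lift of its projection differ by a power of T,
so a equals a minus the lift of its projection, which lies in the image of 1 - T. -/
lemma exists_deckDiff_eq {k : ℤ} {a : Chain ℝ} (ha : a ∈ chainPiece ℝ k)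
    (h : push coverMap a = 0) : ∃ w ∈ chainPiece ℝ k, deckDiff w = a := by
  have := map_mem_of_mem_chainPiece (LinearMap.id - liftChain ∘ₗ push coverMap)
    ((chainPiece ℝ k).map deckDiff) (fun p σ hp => ?_) ha
  · rwa [LinearMap.sub_apply, LinearMap.comp_apply, h, map_zero, sub_zero] at this
  · obtain ⟨n, hn⟩ := exists_eq_shift_comp (coverMap_comp_liftSimplex (coverMap.comp σ)).symm
    rw [LinearMap.sub_apply, LinearMap.comp_apply, push_single, liftChain_single, ← hn]
    exact single_sub_single_shift_mem σ hp n

/-- A T-invariant chain has T-invariant support, but orbits of simplices of ℝ are infinite and the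
support is finite. -/
lemma deckDiff_injective {w : Chain ℝ} (h : deckDiff w = 0) : w = 0 := by
  let f : SingularSimplex ℝ → SingularSimplex ℝ := fun s => ⟨s.1, (shift 1).comp s.2⟩
  have hf : Function.Injective f := by
    rintro ⟨p, σ⟩ ⟨q, τ⟩ hst
    obtain rfl : p = q := congrArg Sigma.fst hst
    have h2 : (shift 1).comp σ = (shift 1).comp τ := eq_of_heq (Sigma.mk.inj hst).2
    have : σ = τ := ContinuousMap.ext fun t => add_right_cancel (DFunLike.congr_fun h2 t)
    rw [this]
  have hw : Finsupp.mapDomain f w = w := (sub_eq_zero.1 h).symm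
  have hstep : ∀ s, w (f s) = w s := fun s => by
    conv_lhs => rw [← hw]
    exact Finsupp.mapDomain_apply hf _ _
  by_contra hne
  obtain ⟨⟨p, σ⟩, hs⟩ := Finsupp.ne_iff.1 hne
  have hiter : ∀ n : ℕ, f^[n] ⟨p, σ⟩ = ⟨p, (shift n).comp σ⟩ := by
    intro n
    induction n with
    | zero =>
      have : (shift ((0 : ℕ) : ℝ)).comp σ = σ := ContinuousMap.ext fun t => by
        change σ t + ((0 : ℕ) : ℝ) = σ t
        simp
      rw [this]
      rfl
    | succ n ih =>
      rw [Function.iterate_succ_apply', ih]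
      have : (shift ((n + 1 : ℕ) : ℝ)).comp σ = (shift 1).comp ((shift n).comp σ) :=
        ContinuousMap.ext fun t => by
          change σ t + ((n + 1 : ℕ) : ℝ) = σ t + n + 1
          push_cast
          ring
      rw [this]
  have hval : ∀ n : ℕ, w ⟨p, (shift n).comp σ⟩ = w ⟨p, σ⟩ := by
    intro n
    rw [← hiter]
    induction n with
    | zero => rfl
    | succ n ih => rw [Function.iterate_succ_apply', hstep, ih]
  refine Set.infinite_of_injective_forall_mem (f := fun n : ℕ =>
    (⟨p, (shift n).comp σ⟩ : SingularSimplex ℝ)) (s := w.support) ?_ ?_ w.support.finite_toSet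
  · intro a b hab
    have h2 : (shift a).comp σ = (shift b).comp σ := eq_of_heq (Sigma.mk.inj hab).2
    have h3 : σ (originVertex p) + (a : ℝ) = σ (originVertex p) + b :=
      DFunLike.congr_fun h2 (originVertex p)
    exact_mod_cast add_left_cancel h3
  · intro n
    rw [Finset.mem_coe, Finsupp.mem_support_iff, hval]
    exact hs

/-- The homology of the circle vanishes in degrees at least `2`. -/
lemma exists_boundary_eq_circle {m : ℕ} {z : Chain UnitAddCircle}
    (hz : z ∈ chainPiece UnitAddCircle (m + 2)) (hb : boundary _ z = 0) :
    ∃ v ∈ chainPiece UnitAddCircle (m + 2 + 1), boundary _ v = z := by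
  have e : ((m + 1 : ℕ) : ℤ) + 1 = m + 2 := by push_cast; ring
  have hz' := liftChain_mem hz
  -- Diagram chase in 0 → S(ℝ) → S(ℝ) → S(S¹) → 0, with first map 1 - T. The lift z̃ of z has ∂z̃ =
  -- (1 - T)w for a cycle w of degree m + 1 ≥ 1. So w = ∂v, and z̃ - (1 - T)v is a cycle in ℝ that
  -- still projects to z; it bounds.
  obtain ⟨w, hw, hwz⟩ := exists_deckDiff_eq (boundary_mem_chainPiece hz')
    (by rw [← boundary_push, push_liftChain, hb])
  have hwb : boundary _ w = 0 := deckDiff_injective (by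
    rw [← boundary_deckDiff, hwz, boundary_boundary])
  obtain ⟨v, hv, hvw⟩ := exists_boundary_eq_real (m := m) (a := w)
    (by rwa [show (m : ℤ) + 2 - 1 = m + 1 by ring] at hw) hwb
  obtain ⟨u, hu, hub⟩ := exists_boundary_eq_real (m := m + 1) (a := liftChain z - deckDiff v) (by
      rw [e]
      refine Submodule.sub_mem _ hz' ?_
      rw [add_assoc] at hv
      exact Submodule.sub_mem _ hv (push_mem_chainPiece _ hv))
    (by rw [map_sub, boundary_deckDiff, hvw, hwz, sub_self])
  refine ⟨push coverMap u, push_mem_chainPiece _ (by rwa [e] at hu), ?_⟩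
  rw [boundary_push, hub, map_sub, push_liftChain, push_deckDiff, sub_zero]

lemma exists_boundary_eq_circle_prod {m : ℕ} {z : Chain (UnitAddCircle × Simplex 0)}
    (hz : z ∈ chainPiece _ (m + 2)) (hb : boundary _ z = 0) :
    ∃ v ∈ chainPiece (UnitAddCircle × Simplex 0) (m + 2 + 1), boundary _ v = z := by
  obtain ⟨v, hv, hvz⟩ := exists_boundary_eq_circle
    (push_mem_chainPiece (ContinuousMap.fst : C(UnitAddCircle × Simplex 0, UnitAddCircle)) hz)
    (by rw [boundary_push, hb, map_zero])
  refine ⟨push (slice _ simplexPoint) v, push_mem_chainPiece _ hv, ?_⟩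
  rw [boundary_push, hvz, push_slice_fst]

end Covering

end CocyclicChains

end

noncomputable section

namespace CocyclicChains

/-! ### Homotopies between the infinity-morphisms of two sequences -/

section Homotopy

variable {X : Type*} [TopologicalSpace X] [AddAction UnitAddCircle X]
  [ContinuousVAdd UnitAddCircle X]

variable (X) in
/-- The operator `J - B`. -/
def mixedDiff : TotalChain X →ₗ[ℝ] TotalChain X := totalJ X - connesB X

lemma mixedDiff_apply (c : TotalChain X) : mixedDiff X c = totalJ X c - connesB X c := rfl

lemma mixedDiff_mixedDiff (c : TotalChain X) : mixedDiff X (mixedDiff X c) = 0 := by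
  simp only [mixedDiff_apply, map_sub, totalJ_totalJ, connesB_connesB, connesB_totalJ]
  abel

lemma totalB_mixedDiff (c : TotalChain X) :
    totalB X (mixedDiff X c) = - mixedDiff X (totalB X c) := by
  rw [mixedDiff_apply, mixedDiff_apply, map_sub, totalB_totalJ,
    eq_neg_of_add_eq_zero_left (totalB_connesB c)]
  abel

lemma mixedDiff_mem {n : ℤ} {c : TotalChain X} (hc : c ∈ totalPiece X n ⊓ normalized X) :
    mixedDiff X c ∈ totalPiece X (n + 1) ⊓ normalized X :=
  Submodule.sub_mem _ ⟨totalJ_mem hc.1, totalJ_normalized hc.2⟩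
    ⟨connesB_mem hc.1, connesB_normalized hc.2⟩

lemma exists_totalB_eq_of_circle {n : ℕ} {y : TotalChain UnitAddCircle}
    (hy : y ∈ totalPiece UnitAddCircle (n + 2) ⊓ normalized UnitAddCircle)
    (hb : totalB _ y = 0) :
    ∃ w ∈ totalPiece UnitAddCircle (n + 2 + 1) ⊓ normalized UnitAddCircle, totalB _ w = y := by
  have hy0 := mem_totalPiece.1 hy.1 0
  rw [Nat.cast_zero, add_zero] at hy0
  obtain ⟨e, he, hey⟩ := exists_boundary_eq_circle_prod hy0 (congrFun hb 0)
  exact exists_totalB_eq hy.1 hy.2 hb he hey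

lemma exists_totalB_eq_of_circle_zero {y : TotalChain UnitAddCircle}
    (hy : y ∈ totalPiece UnitAddCircle 0 ⊓ normalized UnitAddCircle)
    (hb : totalB _ y = 0) (hε : augmentation _ (y 0) = 0) :
    ∃ w ∈ totalPiece UnitAddCircle (0 + 1) ⊓ normalized UnitAddCircle, totalB _ w = y := by
  have hy0 := mem_totalPiece.1 hy.1 0
  rw [Nat.cast_zero, add_zero] at hy0
  obtain ⟨e, he, hey⟩ := exists_boundary_eq_of_zero_chain hy0
  rw [hε, zero_smul, sub_zero] at hey
  exact exists_totalB_eq hy.1 hy.2 hb he hey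

/-- With D = J - B, the boundary of ξ^{n+1} - ξ'^{n+1} + Dη^n is D(ξ^n - ξ'^n) - Dbη^n = 0. Its
degree 2n + 2 is at least 2, where the circle has no homology; in degree 0 the equal augmentations
suffice. -/
lemma exists_homotopy_sequence {ξ ξ' : ℕ → TotalChain UnitAddCircle}
    (hξ : IsCircleSequence ξ) (hξ' : IsCircleSequence ξ') :
    ∃ η : ℕ → TotalChain UnitAddCircle,
      (∀ n : ℕ, η n ∈ totalPiece UnitAddCircle (2 * n + 1) ⊓ normalized UnitAddCircle) ∧
      totalB _ (η 0) = ξ 0 - ξ' 0 ∧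
      ∀ n : ℕ, totalB _ (η (n + 1)) = ξ (n + 1) - ξ' (n + 1) + mixedDiff _ (η n) := by
  -- The second clause is the equation for bη^n after applying J - B. It no longer involves η^{n-1},
  -- because (J - B)² = 0, and this lets the induction refer to one term at a time.
  let P : ℕ → TotalChain UnitAddCircle → Prop := fun n η =>
    η ∈ totalPiece UnitAddCircle (2 * n + 1) ⊓ normalized UnitAddCircle ∧
      mixedDiff _ (totalB _ η) = mixedDiff _ (ξ n - ξ' n)
  have mem : ∀ n : ℕ, ξ n - ξ' n ∈ totalPiece UnitAddCircle (2 * n) ⊓ normalized UnitAddCircle :=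
    fun n => Submodule.sub_mem _ (hξ.mem n) (hξ'.mem n)
  obtain ⟨η₀, hη₀, hb₀⟩ := exists_totalB_eq_of_circle_zero (y := ξ 0 - ξ' 0)
    (by simpa using mem 0) (by rw [map_sub, hξ.zero, hξ'.zero, sub_zero])
    (by rw [Pi.sub_apply, map_sub, hξ.aug, hξ'.aug, sub_self])
  have step : ∀ n η, P n η →
      ∃ η', P (n + 1) η' ∧ totalB _ η' = ξ (n + 1) - ξ' (n + 1) + mixedDiff _ η := by
    rintro n η ⟨hη, hbη⟩
    have e : (2 * (n + 1 : ℕ) : ℤ) = (2 * n : ℕ) + 2 := by push_cast; ring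
    have hmem : ξ (n + 1) - ξ' (n + 1) + mixedDiff _ η ∈
        totalPiece UnitAddCircle ((2 * n : ℕ) + 2) ⊓ normalized UnitAddCircle := by
      refine Submodule.add_mem _ (e ▸ mem (n + 1)) ?_
      have := mixedDiff_mem hη
      rwa [show (2 * (n : ℤ) + 1 + 1) = (2 * n : ℕ) + 2 by push_cast; ring] at this
    obtain ⟨η', hη', hb'⟩ := exists_totalB_eq_of_circle hmem (by
      rw [map_add, map_sub, hξ.succ, hξ'.succ, totalB_mixedDiff, hbη, map_sub, mixedDiff_apply,
        mixedDiff_apply, add_neg_cancel])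
    refine ⟨η', ⟨by rwa [e], ?_⟩, hb'⟩
    rw [hb', map_add, mixedDiff_mixedDiff, add_zero]
  choose! next hnext hbnext using step
  let η : ℕ → TotalChain UnitAddCircle := fun n => Nat.rec η₀ next n
  have hP : ∀ n, P n (η n) := by
    intro n
    induction n with
    | zero => exact ⟨by change η₀ ∈ _; simpa using hη₀, by change mixedDiff _ (totalB _ η₀) = _; rw [hb₀]⟩
    | succ n ih => exact hnext n _ ih
  exact ⟨η, fun n => (hP n).1, hb₀, fun n => hbnext n _ (hP n)⟩

/-- The parity inserted in the homotopy turns the Leibniz rule for odd η^n into the form bh + h∂. -/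
lemma totalB_mix_parity (η : TotalChain UnitAddCircle) (a : Chain X) :
    totalB X (mix X η (parity X a)) + mix X η (parity X (boundary X a)) =
      mix X (totalB _ η) a := by
  rw [totalB_mix, parity_parity, boundary_parity, map_neg]
  abel

lemma mix_parity_rotation (η : TotalChain UnitAddCircle) (a : Chain X) :
    mix X η (parity X (rotation (action X) a)) = - mix X (totalJ _ η) a := by
  rw [parity_rotation, map_neg, ← mix_totalJ, parity_parity]

lemma inftyMap_inftyHomotopic {ξ ξ' : ℕ → TotalChain UnitAddCircle}
    (hξ : IsCircleSequence ξ) (hξ' : IsCircleSequence ξ') :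
    MixedData.InftyHomotopic (singularMixed X) (cocyclicMixed X) (inftyMap X ξ)
      (inftyMap X ξ') := by
  obtain ⟨η, hη, hb₀, hb⟩ := exists_homotopy_sequence hξ hξ'
  refine ⟨fun n => mix X (η n) ∘ₗ parity X, fun i n a ha => ?_, fun n a _ => ?_, fun i n a _ => ?_⟩
  · rw [add_assoc]
    exact ⟨mix_mem (hη i).1 (parity_mem_chainPiece ha), mix_normalized (hη i).2 _⟩
  · change mix X (ξ 0) a - mix X (ξ' 0) a = totalB X (mix X (η 0) (parity X a)) +
      mix X (η 0) (parity X (boundary X a))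
    rw [totalB_mix_parity, hb₀, map_sub, LinearMap.sub_apply]
  · change mix X (ξ (i + 1)) a - mix X (ξ' (i + 1)) a =
      totalB X (mix X (η (i + 1)) (parity X a)) +
      mix X (η (i + 1)) (parity X (boundary X a)) + connesB X (mix X (η i) (parity X a)) +
      mix X (η i) (parity X (rotation (action X) a))
    -- The term (J - B)η^i contained in bη^{i+1} is cancelled by Bh_i and h_iJ, which contribute
    -- Bη^i and -Jη^i.
    rw [totalB_mix_parity, hb, connesB_mix, parity_parity, mix_parity_rotation, mixedDiff_apply]
    simp only [map_add, map_sub, LinearMap.add_apply, LinearMap.sub_apply]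
    abel

end Homotopy

end CocyclicChains

end

theorem proposition3 {X : Type*} [TopologicalSpace X] [AddAction UnitAddCircle X]
    [ContinuousVAdd UnitAddCircle X] :
    (CocyclicChains.singularMixed X).IsMixedComplex ∧
    (CocyclicChains.cocyclicMixed X).IsMixedComplex ∧
    (∀ ξ : ℕ → CocyclicChains.TotalChain UnitAddCircle, CocyclicChains.IsCircleSequence ξ →
      CocyclicChains.MixedData.IsInftyQuasiIso (CocyclicChains.singularMixed X)
        (CocyclicChains.cocyclicMixed X) (CocyclicChains.inftyMap X ξ)) ∧
    (∀ ξ ξ' : ℕ → CocyclicChains.TotalChain UnitAddCircle,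
      CocyclicChains.IsCircleSequence ξ → CocyclicChains.IsCircleSequence ξ' →
      CocyclicChains.MixedData.InftyHomotopic (CocyclicChains.singularMixed X)
        (CocyclicChains.cocyclicMixed X) (CocyclicChains.inftyMap X ξ)
        (CocyclicChains.inftyMap X ξ')) :=
  ⟨CocyclicChains.singularMixed_isMixedComplex X, CocyclicChains.cocyclicMixed_isMixedComplex X,
    fun _ hξ => CocyclicChains.inftyMap_isInftyQuasiIso hξ,
    fun _ _ hξ hξ' => CocyclicChains.inftyMap_inftyHomotopic hξ hξ'⟩
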